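/- Let $\mathbb{H}_n$ be the Siegel upper half space of degree $n$ and $\Gamma_n=Sp(n,\mathbb{Z})$, with elements $M=\begin{pmatrix}A&B\\C&D\end{pmatrix}$, and write $e(x)=e^{2\pi i x}$. For $Z\in\mathbb{H}_3$ write $Z=\begin{pmatrix}\widehat Z&\widehat z\\ \widehat z^{\,t}&z_{33}\end{pmatrix}$ with $\widehat Z\in\mathbb{H}_2$, $\widehat z\in\mathbb{C}^2$. Let $[\Gamma_3,r]_0$ be the space of Siegel cusp forms of weight $r$ for $\Gamma_3$, that is, holomorphic $F:\mathbb{H}_3\to\mathbb{C}$ with $F(M\langle Z\rangle)=\det(CZ+D)^rF(Z)$ for all $M\in\Gamma_3$ whose Fourier expansion runs only over positive definite half-integral matrices. Each such $F$ has a Fourier–Jacobi expansion $F(Z)=\sum_{m\ge 0}\Phi_m(F)(\widehat Z,\widehat z)\,e(mz_{33})$. Let $J_{r,1}^{\mathrm{cusp}}$ be the space of Jacobi cusp forms of weight $r$ and scalar index $1$ on $\mathbb{H}_2\times\mathbb{C}^2$, that is, the holomorphic functions $f$ with $$f\big(M\langle \widehat Z\rangle,((C\widehat Z+D)^{-1})^t\,\widehat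 z\,\big)=\det(C\widehat Z+D)^r\,e\big(\widehat z^{\,t}(C\widehat Z+D)^{-1}C\widehat z\,\big)f(\widehat Z,\widehat z)\quad(M\in\Gamma_2),$$ $$f(\widehat Z,\widehat z+\widehat Z\lambda+\mu)=e\big(-\lambda^t\widehat Z\lambda-2\lambda^t\widehat z\,\big)f(\widehat Z,\widehat z)\quad(\lambda,\mu\in\mathbb{Z}^2),$$ and with a Fourier expansion $f(\widehat Z,\widehat z)=\sum c(N,R)\,e(\mathrm{tr}(N\widehat Z)+R^t\widehat z)$ over half-integral $N$ and $R\in\mathbb{Z}^2$ with $4N-RR^t>0$. Theorem 2. There is $r_0$ such that for every integer weight $r\ge r_0$ there are more Jacobi cusp forms of scalar index $1$ than Fourier–Jacobi cusp forms of index $1$: the space $\{\Phi_1(F): F\in[\Gamma_3,r]_0\}$ is a proper subspace of $J_{r,1}^{\mathrm{cusp}}$. -/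

import Mathlib

attribute [local instance] Matrix.normedAddCommGroup Matrix.normedSpace

namespace SiegelJacobi

open Matrix
open scoped ComplexOrder

/-- The standard exponential `e(x) = exp(2 π i x)`. -/
noncomputable def expTwoPiI (x : ℂ) : ℂ := Complex.exp (2 * (Real.pi : ℂ) * Complex.I * x)

/-- The finite-dimensional complex vector space of symmetric complex `n × n` matrices. -/
def SymMat (n : ℕ) : Submodule ℂ (Matrix (Fin n) (Fin n) ℂ) where
  carrier := {Z | Z.IsSymm}
  add_mem' hA hB := Matrix.IsSymm.add hA hB
  zero_mem' := Matrix.isSymm_zero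
  smul_mem' c _ hA := Matrix.IsSymm.smul hA c

/-- The Siegel upper half space of degree `n`, as a subset of the space of
symmetric matrices: those whose imaginary part is positive definite. -/
def siegelSpace (n : ℕ) : Set (SymMat n) :=
  {Z | ((Z : Matrix (Fin n) (Fin n) ℂ).map Complex.im).PosDef}

/-- The complex matrix underlying a point of the Siegel upper half space. -/
def mat {n : ℕ} (Z : siegelSpace n) : Matrix (Fin n) (Fin n) ℂ := Z.1.1

theorem mat_isSymm {n : ℕ} (Z : siegelSpace n) : (mat Z)ᵀ = mat Z := Z.1.2

/-- A point of the Siegel upper half space from its matrix. -/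
def mk {n : ℕ} (W : Matrix (Fin n) (Fin n) ℂ) (h : W.IsSymm) (h' : (W.map Complex.im).PosDef) :
    siegelSpace n := ⟨⟨W, h⟩, h'⟩

/-- The full Siegel modular group `Sp(n, ℤ)`, consisting of integer `2n × 2n` matrices. -/
abbrev Gam (n : ℕ) := Matrix.symplecticGroup (Fin n) ℤ

/-- The block `A` of `M = (A, B; C, D)`, with complex entries. -/
def blockA {n : ℕ} (M : Gam n) : Matrix (Fin n) (Fin n) ℂ :=
  (M.1.toBlocks₁₁).map (Int.cast : ℤ → ℂ)
/-- The block `B` of `M = (A, B; C, D)`, with complex entries. -/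
def blockB {n : ℕ} (M : Gam n) : Matrix (Fin n) (Fin n) ℂ :=
  (M.1.toBlocks₁₂).map (Int.cast : ℤ → ℂ)
/-- The block `C` of `M = (A, B; C, D)`, with complex entries. -/
def blockC {n : ℕ} (M : Gam n) : Matrix (Fin n) (Fin n) ℂ :=
  (M.1.toBlocks₂₁).map (Int.cast : ℤ → ℂ)
/-- The block `D` of `M = (A, B; C, D)`, with complex entries. -/
def blockD {n : ℕ} (M : Gam n) : Matrix (Fin n) (Fin n) ℂ :=
  (M.1.toBlocks₂₂).map (Int.cast : ℤ → ℂ)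

/-- The matrix `A Z + B`. -/
noncomputable def numer {n : ℕ} (M : Gam n) (Z : siegelSpace n) : Matrix (Fin n) (Fin n) ℂ :=
  blockA M * mat Z + blockB M

/-- The automorphy matrix `C Z + D`. -/
noncomputable def denom {n : ℕ} (M : Gam n) (Z : siegelSpace n) : Matrix (Fin n) (Fin n) ℂ :=
  blockC M * mat Z + blockD M

theorem blocks_eq {n : ℕ} (M : Gam n) :
    fromBlocks (blockA M) (blockB M) (blockC M) (blockD M) = M.1.map (Int.castRingHom ℂ) := by
  conv_rhs => rw [← fromBlocks_toBlocks M.1, fromBlocks_map]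
  rfl

theorem fromRows_numer_denom {n : ℕ} (M : Gam n) (Z : siegelSpace n) :
    fromRows (numer M Z) (denom M Z) =
      M.1.map (Int.castRingHom ℂ) * fromRows (mat Z) (1 : Matrix (Fin n) (Fin n) ℂ) := by
  rw [← blocks_eq, fromBlocks_mul_fromRows]
  simp [numer, denom]

theorem transpose_J {n : ℕ} (M : Gam n) :
    (M.1.map (Int.castRingHom ℂ))ᵀ * J (Fin n) ℂ * M.1.map (Int.castRingHom ℂ)
      = J (Fin n) ℂ :=
  SymplecticGroup.mem_iff'.1 (SymplecticGroup.map_mem M.2 (Int.castRingHom ℂ))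

theorem conjTranspose_J {n : ℕ} (M : Gam n) :
    (M.1.map (Int.castRingHom ℂ))ᴴ * J (Fin n) ℂ * M.1.map (Int.castRingHom ℂ)
      = J (Fin n) ℂ := by
  have h : (M.1.map (Int.castRingHom ℂ))ᴴ = (M.1.map (Int.castRingHom ℂ))ᵀ := by
    ext i j
    simp [conjTranspose_apply]
  rw [h, transpose_J]

theorem rows_J {n : ℕ} (P Q : Matrix (Fin n) (Fin n) ℂ) :
    J (Fin n) ℂ * fromRows P Q = fromRows (-Q) P := by
  rw [J, fromBlocks_mul_fromRows]
  simp

theorem numer_denom_transpose {n : ℕ} (M : Gam n) (Z : siegelSpace n) :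
    (denom M Z)ᵀ * numer M Z = (numer M Z)ᵀ * denom M Z := by
  have h0 : ∀ S : Matrix (Fin n ⊕ Fin n) (Fin n) ℂ,
      (M.1.map (Int.castRingHom ℂ) * S)ᵀ * (J (Fin n) ℂ *
        (M.1.map (Int.castRingHom ℂ) * S)) = Sᵀ * (J (Fin n) ℂ * S) := fun S => by
    rw [transpose_mul]
    conv_rhs => rw [← transpose_J M]
    simp only [Matrix.mul_assoc]
  have h := h0 (fromRows (mat Z) 1)
  rw [← fromRows_numer_denom] at h
  rw [rows_J, rows_J, transpose_fromRows, transpose_fromRows, fromCols_mul_fromRows,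
    fromCols_mul_fromRows, mat_isSymm] at h
  simp only [Matrix.mul_neg, transpose_one, Matrix.one_mul, Matrix.mul_one,
    neg_add_cancel] at h
  exact (neg_add_eq_zero.1 h).symm

theorem numer_denom_conjTranspose {n : ℕ} (M : Gam n) (Z : siegelSpace n) :
    (denom M Z)ᴴ * numer M Z - (numer M Z)ᴴ * denom M Z = mat Z - (mat Z)ᴴ := by
  have h0 : ∀ S : Matrix (Fin n ⊕ Fin n) (Fin n) ℂ,
      (M.1.map (Int.castRingHom ℂ) * S)ᴴ * (J (Fin n) ℂ *
        (M.1.map (Int.castRingHom ℂ) * S)) = Sᴴ * (J (Fin n) ℂ * S) := fun S => by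
    rw [conjTranspose_mul]
    conv_rhs => rw [← conjTranspose_J M]
    simp only [Matrix.mul_assoc]
  have h := h0 (fromRows (mat Z) 1)
  rw [← fromRows_numer_denom] at h
  rw [rows_J, rows_J, conjTranspose_fromRows_eq_fromCols_conjTranspose,
    conjTranspose_fromRows_eq_fromCols_conjTranspose, fromCols_mul_fromRows,
    fromCols_mul_fromRows] at h
  simp only [Matrix.mul_neg, conjTranspose_one, Matrix.one_mul, Matrix.mul_one] at h
  rw [sub_eq_neg_add, h, sub_eq_neg_add]

/-- For a symmetric matrix `W`, one has `W - Wᴴ = 2 i Im W`. -/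
theorem sub_conjTranspose {n : ℕ} {W : Matrix (Fin n) (Fin n) ℂ} (hW : Wᵀ = W) :
    W - Wᴴ = (2 * Complex.I) • (W.map Complex.im).map (Complex.ofReal : ℝ → ℂ) := by
  have h : Wᴴ = W.map (starRingEnd ℂ) := by
    conv_lhs => rw [conjTranspose, hW]
    rfl
  rw [h]
  ext i j
  apply Complex.ext <;> simp
  ring

theorem posDef_map_ofReal {n : ℕ} {Y : Matrix (Fin n) (Fin n) ℝ} :
    (Y.map (Complex.ofReal : ℝ → ℂ)).PosDef ↔ Y.PosDef := by
  constructor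
  · intro h
    rw [posDef_iff_dotProduct_mulVec] at h ⊢
    refine ⟨?_, fun x hx => ?_⟩
    · ext i j
      have := congrFun (congrFun h.1 i) j
      simpa [conjTranspose_apply] using this
    · have h1 := h.2 (x := fun i => (x i : ℂ)) (by
        intro h0
        apply hx
        ext i
        simpa using congrFun h0 i)
      have h2 : (star (fun i => (x i : ℂ)) ⬝ᵥ (Y.map (Complex.ofReal : ℝ → ℂ)) *ᵥ
          (fun i => (x i : ℂ))) = ((star x ⬝ᵥ Y *ᵥ x : ℝ) : ℂ) := by
        simp [dotProduct, mulVec]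
      rw [h2] at h1
      exact_mod_cast h1
  · intro h
    rw [posDef_iff_dotProduct_mulVec] at h
    have hs : ∀ i j, Y i j = Y j i := fun i j => by
      simpa [conjTranspose_apply] using (congrFun (congrFun h.1 i) j).symm
    rw [posDef_iff_dotProduct_mulVec]
    refine ⟨?_, fun x hx => ?_⟩
    · ext i j
      simp [conjTranspose_apply, hs j i]
    · set a : Fin n → ℝ := fun i => (x i).re with ha
      set b : Fin n → ℝ := fun i => (x i).im with hb
      have key : (star x ⬝ᵥ (Y.map (Complex.ofReal : ℝ → ℂ)) *ᵥ x) =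
          (((star a ⬝ᵥ Y *ᵥ a) + (star b ⬝ᵥ Y *ᵥ b) : ℝ) : ℂ) := by
        have hx' : ∀ i, x i = a i + b i * Complex.I := fun i => (Complex.re_add_im (x i)).symm
        have hswap : ∑ i, ∑ j, (a i : ℂ) * (Y i j * b j) = ∑ i, ∑ j, (b i : ℂ) * (Y i j * a j) := by
          rw [Finset.sum_comm]
          refine Finset.sum_congr rfl fun i _ => Finset.sum_congr rfl fun j _ => ?_
          rw [hs j i]; ring
        simp only [dotProduct, mulVec, Pi.star_apply, map_apply, Finset.mul_sum]
        push_cast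
        have e : ∀ i j, star (x i) * ((Y i j : ℂ) * x j) =
            ((a i : ℂ) * (Y i j * a j) + (b i : ℂ) * (Y i j * b j)) +
            Complex.I * ((a i : ℂ) * (Y i j * b j) - (b i : ℂ) * (Y i j * a j)) := by
          intro i j
          have hst : star (x i) = (a i : ℂ) - b i * Complex.I := by
            apply Complex.ext <;> simp [ha, hb]
          rw [hst, hx' j]
          linear_combination (-(b i : ℂ) * Y i j * b j) * Complex.I_mul_I
        simp only [e, Finset.sum_add_distrib, ← Finset.mul_sum, Finset.sum_sub_distrib] at *
        rw [hswap]
        simp [Finset.mul_sum]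
      rw [key]
      have hab : a ≠ 0 ∨ b ≠ 0 := by
        by_contra hc
        push Not at hc
        apply hx
        ext i
        apply Complex.ext
        · exact congrFun hc.1 i
        · exact congrFun hc.2 i
      have ps := h.1
      have nn : ∀ v : Fin n → ℝ, 0 ≤ star v ⬝ᵥ Y *ᵥ v := fun v => by
        by_cases hv : v = 0
        · simp [hv]
        · exact (h.2 hv).le
      have : 0 < (star a ⬝ᵥ Y *ᵥ a) + (star b ⬝ᵥ Y *ᵥ b) := by
        rcases hab with h1 | h1
        · exact add_pos_of_pos_of_nonneg (h.2 h1) (nn b)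
        · exact add_pos_of_nonneg_of_pos (nn a) (h.2 h1)
      exact_mod_cast this

theorem denom_det_ne_zero {n : ℕ} (M : Gam n) (Z : siegelSpace n) : (denom M Z).det ≠ 0 := by
  intro h0
  obtain ⟨v, hv, hQ⟩ := exists_mulVec_eq_zero_iff.2 h0
  have hp := (posDef_iff_dotProduct_mulVec.1 (posDef_map_ofReal.2 Z.2)).2 hv
  have h1 : star v ⬝ᵥ ((mat Z - (mat Z)ᴴ) *ᵥ v) = 0 := by
    rw [← numer_denom_conjTranspose M Z, sub_mulVec, dotProduct_sub, ← mulVec_mulVec,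
      ← mulVec_mulVec, hQ, dotProduct_mulVec, ← star_mulVec, hQ]
    simp
  rw [sub_conjTranspose (mat_isSymm Z), smul_mulVec, dotProduct_smul, smul_eq_mul] at h1
  rcases mul_eq_zero.1 h1 with h2 | h2
  · simp at h2
  · exact hp.ne' h2

theorem act_isSymm {n : ℕ} (M : Gam n) (Z : siegelSpace n) :
    (numer M Z * (denom M Z)⁻¹).IsSymm := by
  have hu : IsUnit (denom M Z).det := (denom_det_ne_zero M Z).isUnit
  have hu' : IsUnit ((denom M Z)ᵀ).det := by rwa [det_transpose]
  change (numer M Z * (denom M Z)⁻¹)ᵀ = _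
  rw [transpose_mul, transpose_nonsing_inv]
  calc ((denom M Z)ᵀ)⁻¹ * (numer M Z)ᵀ
      = ((denom M Z)ᵀ)⁻¹ * ((numer M Z)ᵀ * denom M Z) * (denom M Z)⁻¹ := by
        rw [Matrix.mul_assoc, mul_nonsing_inv_cancel_right _ _ hu]
    _ = numer M Z * (denom M Z)⁻¹ := by
        rw [← numer_denom_transpose, nonsing_inv_mul_cancel_left _ _ hu']

theorem act_im_posDef {n : ℕ} (M : Gam n) (Z : siegelSpace n) :
    ((numer M Z * (denom M Z)⁻¹).map Complex.im).PosDef := by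
  have hu : IsUnit (denom M Z).det := (denom_det_ne_zero M Z).isUnit
  have hu' : IsUnit ((denom M Z)ᴴ).det := by
    rw [det_conjTranspose]; exact hu.star
  have h1 := sub_conjTranspose (act_isSymm M Z)
  have h2 : numer M Z * (denom M Z)⁻¹ - (numer M Z * (denom M Z)⁻¹)ᴴ =
      ((denom M Z)⁻¹)ᴴ * (mat Z - (mat Z)ᴴ) * (denom M Z)⁻¹ := by
    rw [← numer_denom_conjTranspose M Z, Matrix.mul_sub, Matrix.sub_mul, conjTranspose_mul,
      conjTranspose_nonsing_inv]
    congr 1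
    · rw [nonsing_inv_mul_cancel_left _ _ hu']
    · rw [Matrix.mul_assoc, Matrix.mul_assoc, mul_nonsing_inv _ hu, Matrix.mul_one]
  rw [h2, sub_conjTranspose (mat_isSymm Z), Matrix.mul_smul, Matrix.smul_mul] at h1
  have h3 := smul_right_injective _ (by simp : (2 * Complex.I) ≠ 0) h1
  rw [← posDef_map_ofReal, ← h3]
  refine (posDef_map_ofReal.2 Z.2).conjTranspose_mul_mul_same ?_
  exact mulVec_injective_iff_isUnit.2 ((isUnit_nonsing_inv_iff).2
    ((isUnit_iff_isUnit_det _).2 hu))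

/-- The action `M ⟨Z⟩ = (A Z + B) (C Z + D)⁻¹` on the Siegel upper half space. -/
noncomputable def act {n : ℕ} (M : Gam n) (Z : siegelSpace n) : siegelSpace n :=
  mk (numer M Z * (denom M Z)⁻¹) (act_isSymm M Z) (act_im_posDef M Z)

/-- Half-integral symmetric matrices: integral diagonal entries, other entries in `½ ℤ`. -/
def HalfIntegral (n : ℕ) :=
  {T : Matrix (Fin n) (Fin n) ℝ // T.IsSymm ∧ (∀ i, ∃ k : ℤ, T i i = k) ∧
    ∀ i j, ∃ k : ℤ, 2 * T i j = k}

/-- The pairing `tr (T Z)`. -/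
noncomputable def pairing {n : ℕ} (T : HalfIntegral n) (Z : siegelSpace n) : ℂ :=
  (T.1.map (Complex.ofReal : ℝ → ℂ) * mat Z).trace

/-- Siegel cusp forms of degree `n` and weight `r` for the full modular group `Sp(n, ℤ)`:
holomorphic functions on the Siegel upper half space, with the modular transformation law,
and with an (absolutely convergent) Fourier expansion supported on
positive definite half-integral matrices. -/
structure IsSiegelCuspForm (n r : ℕ) (F : siegelSpace n → ℂ) : Prop where
  holomorphic : ∃ G : SymMat n → ℂ, DifferentiableOn ℂ G (siegelSpace n) ∧
    ∀ Z : siegelSpace n, G Z.1 = F Z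
  modular : ∀ (M : Gam n) (Z : siegelSpace n), F (act M Z) = (denom M Z).det ^ r * F Z
  cuspidal : ∃ a : HalfIntegral n → ℂ, (∀ T, ¬ T.1.PosDef → a T = 0) ∧
    ∀ Z : siegelSpace n, HasSum (fun T => a T * expTwoPiI (pairing T Z)) (F Z)

/-- The space of Siegel cusp forms of degree `n` and weight `r`. -/
def siegelCuspForms (n r : ℕ) : Submodule ℂ (siegelSpace n → ℂ) where
  carrier := {F | IsSiegelCuspForm n r F}
  zero_mem' :=
    { holomorphic := ⟨0, differentiableOn_const 0, fun _ => rfl⟩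
      modular := fun M Z => by simp
      cuspidal := ⟨0, fun _ _ => rfl, fun Z => by simp⟩ }
  add_mem' := by
    rintro F₁ F₂ ⟨⟨G₁, hG₁, e₁⟩, m₁, a₁, s₁, f₁⟩ ⟨⟨G₂, hG₂, e₂⟩, m₂, a₂, s₂, f₂⟩
    refine ⟨⟨G₁ + G₂, hG₁.add hG₂, fun Z => by simp [e₁, e₂]⟩, fun M Z => ?_,
      ⟨a₁ + a₂, fun T hT => by simp [s₁ T hT, s₂ T hT], fun Z => ?_⟩⟩
    · simp only [Pi.add_apply, m₁, m₂]; ring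
    · simpa [add_mul] using (f₁ Z).add (f₂ Z)
  smul_mem' := by
    rintro c F ⟨⟨G, hG, e⟩, m, a, s, f⟩
    refine ⟨⟨c • G, hG.const_smul c, fun Z => by simp [e]⟩, fun M Z => ?_,
      ⟨c • a, fun T hT => by simp [s T hT], fun Z => ?_⟩⟩
    · simp only [Pi.smul_apply, smul_eq_mul, m]; ring
    · simpa [mul_assoc] using (f Z).mul_left c

/-- Jacobi cusp forms of weight `r` and scalar index `m` on `ℍ_g × ℂ^g`, for the full Jacobi
group `Sp(g, ℤ) ⋉ (ℤ^g × ℤ^g)`. Lattice vectors `l`, `k` give the translations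
`z ↦ z + Z l + k`. The Fourier coefficient at `(N, R)` may be nonzero only if
`4 m N - R Rᵗ` is positive definite. -/
structure IsJacobiCuspForm (g r m : ℕ) (f : siegelSpace g × (Fin g → ℂ) → ℂ) : Prop where
  holomorphic : ∃ G : SymMat g × (Fin g → ℂ) → ℂ,
    DifferentiableOn ℂ G (siegelSpace g ×ˢ Set.univ) ∧
      ∀ (Z : siegelSpace g) (z : Fin g → ℂ), G (Z.1, z) = f (Z, z)
  modular : ∀ (M : Gam g) (Z : siegelSpace g) (z : Fin g → ℂ),
    f (act M Z, ((denom M Z)⁻¹)ᵀ *ᵥ z) =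
      (denom M Z).det ^ r *
        expTwoPiI (m * (z ⬝ᵥ ((denom M Z)⁻¹ * blockC M) *ᵥ z)) * f (Z, z)
  elliptic : ∀ (l k : Fin g → ℤ) (Z : siegelSpace g) (z : Fin g → ℂ),
    f (Z, z + mat Z *ᵥ (fun i => (l i : ℂ)) + fun i => (k i : ℂ)) =
      expTwoPiI (-(m * ((fun i => (l i : ℂ)) ⬝ᵥ mat Z *ᵥ (fun i => (l i : ℂ)) +
        2 * ((fun i => (l i : ℂ)) ⬝ᵥ z)))) * f (Z, z)
  cuspidal : ∃ c : HalfIntegral g × (Fin g → ℤ) → ℂ,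
    (∀ (N : HalfIntegral g) (R : Fin g → ℤ),
      ¬ ((4 * m : ℝ) • N.1 -
        vecMulVec (fun i => (R i : ℝ)) (fun i => (R i : ℝ))).PosDef → c (N, R) = 0) ∧
    ∀ (Z : siegelSpace g) (z : Fin g → ℂ),
      HasSum (fun p : HalfIntegral g × (Fin g → ℤ) =>
        c p * expTwoPiI (pairing p.1 Z + (fun i => (p.2 i : ℂ)) ⬝ᵥ z)) (f (Z, z))

/-- The space of Jacobi cusp forms of weight `r` and index `m` on `ℍ_g × ℂ^g`. -/
def jacobiCuspForms (g r m : ℕ) : Submodule ℂ (siegelSpace g × (Fin g → ℂ) → ℂ) where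
  carrier := {f | IsJacobiCuspForm g r m f}
  zero_mem' :=
    { holomorphic := ⟨0, differentiableOn_const 0, fun _ _ => rfl⟩
      modular := fun M Z z => by simp
      elliptic := fun l k Z z => by simp
      cuspidal := ⟨0, fun _ _ _ => rfl, fun Z z => by simp⟩ }
  add_mem' := by
    rintro F₁ F₂ ⟨⟨G₁, hG₁, e₁⟩, m₁, l₁, a₁, s₁, f₁⟩ ⟨⟨G₂, hG₂, e₂⟩, m₂, l₂, a₂, s₂, f₂⟩
    refine ⟨⟨G₁ + G₂, hG₁.add hG₂, fun Z z => by simp [e₁, e₂]⟩, fun M Z z => ?_,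
      fun l k Z z => ?_, ⟨a₁ + a₂, fun N R h => by simp [s₁ N R h, s₂ N R h], fun Z z => ?_⟩⟩
    · simp only [Pi.add_apply, m₁, m₂]; ring
    · simp only [Pi.add_apply, l₁, l₂]; ring
    · simpa [add_mul] using (f₁ Z z).add (f₂ Z z)
  smul_mem' := by
    rintro c F ⟨⟨G, hG, e⟩, m, l, a, s, f⟩
    refine ⟨⟨c • G, hG.const_smul c, fun Z z => by simp [e]⟩, fun M Z z => ?_,
      fun l' k Z z => ?_, ⟨c • a, fun N R h => by simp [s N R h], fun Z z => ?_⟩⟩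
    · simp only [Pi.smul_apply, smul_eq_mul, m]; ring
    · simp only [Pi.smul_apply, smul_eq_mul, l]; ring
    · simpa [mul_assoc] using (f Z z).mul_left c

/-- The upper left block `Ẑ ∈ ℍ_g` of `Z = (Ẑ, ẑ; ẑᵗ, τ) ∈ ℍ_{g+1}`. -/
def hatBlock {g : ℕ} (Z : siegelSpace (g + 1)) : siegelSpace g :=
  mk ((mat Z).submatrix Fin.castSucc Fin.castSucc)
    (Matrix.IsSymm.submatrix (mat_isSymm Z) Fin.castSucc)
    (Matrix.PosDef.submatrix (M := (mat Z).map Complex.im) Z.2 (Fin.castSucc_injective g))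

/-- The vector `ẑ ∈ ℂ^g` of `Z = (Ẑ, ẑ; ẑᵗ, τ) ∈ ℍ_{g+1}`. -/
def hatVec {g : ℕ} (Z : siegelSpace (g + 1)) : Fin g → ℂ :=
  fun i => mat Z i.castSucc (Fin.last g)

/-- The last diagonal entry `τ` of `Z = (Ẑ, ẑ; ẑᵗ, τ) ∈ ℍ_{g+1}`. -/
def lastEntry {g : ℕ} (Z : siegelSpace (g + 1)) : ℂ := mat Z (Fin.last g) (Fin.last g)

/-- `Φ` is the sequence of Fourier-Jacobi coefficients of `F`, that is,
`F(Z) = ∑_{m ≥ 0} Φ_m(Ẑ, ẑ) e(m τ)` for all `Z = (Ẑ, ẑ; ẑᵗ, τ) ∈ ℍ_{g+1}`. -/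
def IsFourierJacobiExpansion {g : ℕ} (F : siegelSpace (g + 1) → ℂ)
    (Φ : ℕ → siegelSpace g × (Fin g → ℂ) → ℂ) : Prop :=
  ∀ Z : siegelSpace (g + 1),
    HasSum (fun m : ℕ => Φ m (hatBlock Z, hatVec Z) * expTwoPiI (m * lastEntry Z)) (F Z)

/-- The space of `m`-th Fourier-Jacobi coefficients of Siegel cusp forms of
degree `g + 1` and weight `r`. -/
def fourierJacobiCuspForms (g r m : ℕ) : Submodule ℂ (siegelSpace g × (Fin g → ℂ) → ℂ) where
  carrier := {f | ∃ F ∈ siegelCuspForms (g + 1) r, ∃ Φ, IsFourierJacobiExpansion F Φ ∧ f = Φ m}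
  zero_mem' := ⟨0, Submodule.zero_mem _, 0, fun Z => by simp, rfl⟩
  add_mem' := by
    rintro _ _ ⟨F₁, h₁, Φ₁, e₁, rfl⟩ ⟨F₂, h₂, Φ₂, e₂, rfl⟩
    exact ⟨F₁ + F₂, Submodule.add_mem _ h₁ h₂, Φ₁ + Φ₂,
      fun Z => by simpa [add_mul] using (e₁ Z).add (e₂ Z), rfl⟩
  smul_mem' := by
    rintro c _ ⟨F, h, Φ, e, rfl⟩
    exact ⟨c • F, Submodule.smul_mem _ c h, c • Φ,
      fun Z => by simpa [mul_assoc] using (e Z).mul_left c, rfl⟩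

end SiegelJacobi

/-!
The inclusion holds because the transformations of `ℍ₃` that preserve the shape
`(Z, z; zᵗ, τ) ↦ (Z', z'; z'ᵗ, τ + q)` turn the modular law of a Siegel cusp form into the two laws
of Jacobi forms for each Fourier-Jacobi coefficient. As the coefficients are determined by the
values for large `Im τ` (`IsFourierJacobiExpansion.coeff_eq`), the laws hold coefficient by
coefficient (`IsFourierJacobiExpansion.transfer`), and the Fourier expansion of the first one can be
read off from that of the cusp form (`IsFourierJacobiExpansion.hasSum_first`).

That the inclusion is strict is shown by explicit Jacobi cusp forms `g · h₄ⁱ · A`. Here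
`A = ∑ θₘ(Z, w)² θₘ(Z, 0)⁶` and `h₄ = ∑ θₘ(Z, 0)⁸`, summed over the ten even theta functions of
genus two, have weight `4`, and `g` is a cusp form on `ℍ₂`.

* For even weights `g` is either the square of `χ₅ = ∏ θₘ(Z, 0)`, of weight `10`, or a sum of
  products of six fourth powers of theta constants, of weight `12`. A Siegel cusp form of even
  weight is invariant under the exchange of the last two variables, so its Fourier coefficients are
  symmetric. Those with diagonal `(1, 1, 1)` form the limit of `e^{4 π y} f((iy, s₁; s₁, iy), (s₂, s₃))`
  as `y → ∞`, where `f` is the first Fourier-Jacobi coefficient (`tendsto_first`); the limit is thus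
  symmetric in `s₁` and `s₂` (`cornerSum_swap`). For the explicit forms it does depend on `s₁` but
  not on `s₂` (`exists_asymmetric`).
* For odd weights there are no Siegel cusp forms of degree three except zero (`eq_zero_of_odd`),
  and `g = χ₅ · V · (χ₅²)ʲ` with the Vandermonde determinant `V` of the `θₘ(Z, 0)⁸` gives a nonzero
  Jacobi cusp form (`exists_jacobiCuspForm_ne_zero`). Its sign is right because each of the chosen
  generators of `Sp(2, ℤ)` permutes the ten theta functions by an odd permutation.

All laws are checked on four generators of `Sp(2, ℤ)` (`closure_generators`), where those of the
theta functions are elementary (`ThetaLaw`); the inversion reduces to the functional equation of the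
theta function of one variable. Cuspidality is a statement about the exponents of the theta series,
and the integrality of the exponents follows from the periodicity of the product
(`HasExpansion.integral`).
-/


namespace SiegelJacobi

open Matrix Filter Topology
open Complex (I)

/-! ### Series of exponentials -/

/-- Regrouping a convergent series along the fibres of a map. -/
theorem hasSum_fiber {ι κ : Type*} {g : ι → ℂ} {s : ℂ} (h : HasSum g s) (key : ι → κ) :
    HasSum (fun k => ∑' i : {i // key i = k}, g i) s := by
  have h1 := (Equiv.sigmaFiberEquiv key).hasSum_iff.2 h
  exact h1.sigma fun k => (h.summable.comp_injective Subtype.val_injective).hasSum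

/-- Finitely many directions suffice to bound `exp (t ‖l‖)` for all functionals `l`, which gives
locally uniform domination of exponential series. -/
theorem exists_exp_mul_norm_le (E : Type*) [NormedAddCommGroup E] [NormedSpace ℂ E]
    [FiniteDimensional ℂ E] :
    ∃ (D : Finset E) (C : ℝ), 0 < C ∧ ∀ (t : ℝ), 0 ≤ t → ∀ l : E →L[ℂ] ℂ,
      Real.exp (t * ‖l‖) ≤ ∑ d ∈ D, Real.exp (t * C * (l d).re) := by
  classical
  obtain ⟨C, hC, hb⟩ := (Module.finBasis ℂ E).exists_opNorm_le (F := ℂ)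
  set e := Module.finBasis ℂ E
  let u : Fin 4 → ℂ := ![1, -1, -Complex.I, Complex.I]
  refine ⟨insert 0 (Finset.univ.image fun p : Fin (Module.finrank ℂ E) × Fin 4 => u p.2 • e p.1),
    2 * C, by positivity, fun t ht l => ?_⟩
  by_cases hl : ∃ k, ∀ j, ‖l (e j)‖ ≤ ‖l (e k)‖
  · obtain ⟨k, hk⟩ := hl
    have h1 := hb (norm_nonneg _) hk
    have h2 : ∃ j, ‖l (e k)‖ ≤ 2 * (l (u j • e k)).re := by
      have h3 := Complex.norm_le_abs_re_add_abs_im (l (e k))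
      by_contra hcon
      push Not at hcon
      have a0 := hcon 0
      have a1 := hcon 1
      have a2 := hcon 2
      have a3 := hcon 3
      simp [u] at a0 a1 a2 a3
      rcases abs_cases (l (e k)).re with h | h <;> rcases abs_cases (l (e k)).im with h' | h' <;>
        linarith
    obtain ⟨j, hj⟩ := h2
    refine le_trans ?_ (Finset.single_le_sum (f := fun d => Real.exp (t * (2 * C) * (l d).re))
      (fun i _ => (Real.exp_pos _).le)
      (Finset.mem_insert_of_mem (Finset.mem_image.2 ⟨(k, j), Finset.mem_univ _, rfl⟩)))
    apply Real.exp_le_exp.2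
    have h4 : ‖l‖ ≤ C * (2 * (l (u j • e k)).re) :=
      h1.trans (mul_le_mul_of_nonneg_left hj hC.le)
    calc t * ‖l‖ ≤ t * (C * (2 * (l (u j • e k)).re)) := mul_le_mul_of_nonneg_left h4 ht
      _ = _ := by ring
  · have hl0 : ‖l‖ ≤ C * 0 := by
      refine hb le_rfl fun i => ?_
      have : Nonempty (Fin (Module.finrank ℂ E)) := ⟨i⟩
      exact (hl (Finite.exists_max fun j => ‖l (e j)‖)).elim
    refine le_trans ?_ (Finset.single_le_sum (f := fun d => Real.exp (t * (2 * C) * (l d).re))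
      (fun i _ => (Real.exp_pos _).le) (Finset.mem_insert_self 0 _))
    apply Real.exp_le_exp.2
    simp only [map_zero, Complex.zero_re, mul_zero]
    nlinarith [norm_nonneg l]

/-- A generalized Fourier series with complex linear exponents that converges on an open set
is holomorphic there. -/
theorem differentiableOn_of_hasSum_exp {E : Type*} [NormedAddCommGroup E] [NormedSpace ℂ E]
    [FiniteDimensional ℂ E] {ι : Type*} {U : Set E} (hU : IsOpen U) (c : ι → ℂ)
    (l : ι → E →ₗ[ℂ] ℂ) {f : E → ℂ}
    (h : ∀ x ∈ U, HasSum (fun i => c i * Complex.exp (l i x)) (f x)) :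
    DifferentiableOn ℂ f U := by
  intro x₀ hx₀
  obtain ⟨D, C, hC, hD⟩ := exists_exp_mul_norm_le E
  set l' : ι → E →L[ℂ] ℂ := fun i => (l i).toContinuousLinearMap with hl'
  have hll : ∀ i x, l i x = l' i x := fun i x => rfl
  simp only [hll] at h
  -- a radius so small that the ball and all shifted centres stay inside `U`
  obtain ⟨δ, hδ, hball, hshift⟩ : ∃ δ : ℝ, 0 < δ ∧ Metric.ball x₀ δ ⊆ U ∧
      ∀ d ∈ D, x₀ + ((2 * δ * C : ℝ) : ℂ) • d ∈ U := by
    have e1 : ∀ᶠ δ : ℝ in 𝓝[>] 0, Metric.ball x₀ δ ⊆ U := by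
      obtain ⟨ε, hε, hb⟩ := Metric.isOpen_iff.1 hU x₀ hx₀
      filter_upwards [Ioo_mem_nhdsGT hε] with δ hδ
      exact (Metric.ball_subset_ball hδ.2.le).trans hb
    have e2 : ∀ᶠ δ : ℝ in 𝓝[>] 0, ∀ d ∈ D, x₀ + ((2 * δ * C : ℝ) : ℂ) • d ∈ U := by
      rw [Filter.eventually_all_finset]
      intro d _
      have hc : Continuous fun δ : ℝ => x₀ + ((2 * δ * C : ℝ) : ℂ) • d := by fun_prop
      have ht : Tendsto (fun δ : ℝ => x₀ + ((2 * δ * C : ℝ) : ℂ) • d) (𝓝[>] 0) (𝓝 x₀) := by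
        have := hc.tendsto 0
        simp only [mul_zero, zero_mul, Complex.ofReal_zero, zero_smul, add_zero] at this
        exact this.mono_left nhdsWithin_le_nhds
      exact ht.eventually (hU.mem_nhds hx₀)
    obtain ⟨δ, ⟨h1, h2⟩, h3⟩ := ((e1.and e2).and self_mem_nhdsWithin).exists
    exact ⟨δ, h3, h1, h2⟩
  have hn : ∀ x ∈ U, Summable fun i => ‖c i‖ * Real.exp (l' i x).re := fun x hx => by
    have := (h x hx).summable.norm
    simpa [Complex.norm_exp] using this
  set u : ι → ℝ := fun i => δ⁻¹ * ∑ d ∈ D,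
    ‖c i‖ * Real.exp (l' i (x₀ + ((2 * δ * C : ℝ) : ℂ) • d)).re with hu
  have husum : Summable u :=
    (summable_sum fun d hd => hn _ (hshift d hd)).mul_left _
  have hterm : ∀ i x, HasFDerivAt (fun x => c i * Complex.exp (l' i x))
      (c i • (Complex.exp (l' i x) • l' i)) x := fun i x =>
    ((l' i).hasFDerivAt.cexp).const_mul (c i)
  have hbd : ∀ i x, x ∈ Metric.ball x₀ δ →
      ‖c i • (Complex.exp (l' i x) • l' i)‖ ≤ u i := fun i x hx => by
    rw [norm_smul, norm_smul, Complex.norm_exp]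
    have h1 : (l' i x).re ≤ (l' i x₀).re + δ * ‖l' i‖ := by
      have : (l' i (x - x₀)).re ≤ ‖l' i‖ * δ :=
        (Complex.re_le_norm _).trans (((l' i).le_opNorm _).trans
          (mul_le_mul_of_nonneg_left (mem_ball_iff_norm.1 hx).le (norm_nonneg _)))
      rw [map_sub, Complex.sub_re] at this
      linarith
    have h2 : ‖l' i‖ ≤ δ⁻¹ * Real.exp (δ * ‖l' i‖) := by
      have := Real.add_one_le_exp (δ * ‖l' i‖)
      rw [inv_mul_eq_div, le_div_iff₀ hδ]
      linarith
    have h3 := hD (2 * δ) (by positivity) (l' i)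
    have h4 : Real.exp (l' i x).re * ‖l' i‖ ≤
        δ⁻¹ * ∑ d ∈ D, Real.exp (l' i (x₀ + ((2 * δ * C : ℝ) : ℂ) • d)).re := by
      calc Real.exp (l' i x).re * ‖l' i‖
          ≤ Real.exp ((l' i x₀).re + δ * ‖l' i‖) * (δ⁻¹ * Real.exp (δ * ‖l' i‖)) := by gcongr
        _ = δ⁻¹ * (Real.exp (l' i x₀).re * Real.exp (2 * δ * ‖l' i‖)) := by
            rw [Real.exp_add, show 2 * δ * ‖l' i‖ = δ * ‖l' i‖ + δ * ‖l' i‖ by ring, Real.exp_add]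
            ring
        _ ≤ δ⁻¹ * (Real.exp (l' i x₀).re * ∑ d ∈ D, Real.exp (2 * δ * C * (l' i d).re)) := by
            gcongr
        _ = _ := by
            rw [Finset.mul_sum]
            congr 1
            refine Finset.sum_congr rfl fun d _ => ?_
            rw [← Real.exp_add, map_add, map_smul, Complex.add_re, smul_eq_mul,
              Complex.re_ofReal_mul]
    calc ‖c i‖ * (Real.exp (l' i x).re * ‖l' i‖)
        ≤ ‖c i‖ * (δ⁻¹ * ∑ d ∈ D, Real.exp (l' i (x₀ + ((2 * δ * C : ℝ) : ℂ) • d)).re) := by gcongr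
      _ = u i := by rw [hu]; simp only [Finset.mul_sum]; refine Finset.sum_congr rfl fun d _ => ?_; ring
  have key := hasFDerivAt_tsum_of_isPreconnected (𝕜 := ℂ) husum Metric.isOpen_ball
    (convex_ball x₀ δ).isPreconnected (fun i x _ => hterm i x) hbd
    (Metric.mem_ball_self hδ) (h x₀ hx₀).summable (Metric.mem_ball_self hδ)
  refine DifferentiableAt.differentiableWithinAt ?_
  refine key.differentiableAt.congr_of_eventuallyEq ?_
  filter_upwards [hU.mem_nhds hx₀] with x hx
  exact (h x hx).tsum_eq.symm

/-- A series of decaying exponentials tends to the sum of its constant terms. -/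
theorem tendsto_tsum_exp_neg {ι : Type*} {d : ι → ℂ} {lam : ι → ℝ}
    (hl : ∀ i, d i ≠ 0 → 0 ≤ lam i) {y₁ : ℝ}
    (hs : Summable fun i => d i * ((Real.exp (-(lam i * y₁)) : ℝ) : ℂ)) :
    Tendsto (fun y : ℝ => ∑' i, d i * ((Real.exp (-(lam i * y)) : ℝ) : ℂ)) atTop
      (𝓝 (∑' i, if lam i = 0 then d i else 0)) := by
  refine tendsto_tsum_of_dominated_convergence hs.norm (fun i => ?_) ?_
  · by_cases hd : d i = 0
    · simp [hd]
    by_cases h0 : lam i = 0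
    · simp [h0]
    · have hpos : 0 < lam i := lt_of_le_of_ne (hl i hd) (Ne.symm h0)
      have h1 : Tendsto (fun y : ℝ => Real.exp (-(lam i * y))) atTop (𝓝 0) :=
        Real.tendsto_exp_neg_atTop_nhds_zero.comp (tendsto_id.const_mul_atTop hpos)
      have h2 := (Complex.continuous_ofReal.tendsto 0).comp h1
      simpa [h0] using h2.const_mul (d i)
  · filter_upwards [eventually_ge_atTop y₁] with y hy i
    by_cases hd : d i = 0
    · simp [hd]
    rw [norm_mul, norm_mul]
    refine mul_le_mul_of_nonneg_left ?_ (norm_nonneg _)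
    rw [Complex.norm_real, Complex.norm_real, Real.norm_of_nonneg (Real.exp_pos _).le,
      Real.norm_of_nonneg (Real.exp_pos _).le]
    exact Real.exp_le_exp.2 (neg_le_neg (mul_le_mul_of_nonneg_left hy (hl i hd)))

/-- Uniqueness of the coefficients of a power series in `q = e(τ)`, known to converge only
for large imaginary part. -/
theorem coeff_eq_of_hasSum {α β : ℕ → ℂ} {F : ℂ → ℂ} {y₀ : ℝ}
    (hα : ∀ τ : ℂ, y₀ < τ.im → HasSum (fun m : ℕ => α m * expTwoPiI (m * τ)) (F τ))
    (hβ : ∀ τ : ℂ, y₀ < τ.im → HasSum (fun m : ℕ => β m * expTwoPiI (m * τ)) (F τ)) :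
    α = β := by
  by_contra hne
  have hex : ∃ m, α m - β m ≠ 0 := by
    by_contra hcon
    push Not at hcon
    exact hne (funext fun m => sub_eq_zero.1 (hcon m))
  classical
  set m₀ := Nat.find hex with hm₀
  have hmin : ∀ m < m₀, α m - β m = 0 := fun m hm => by
    simpa using Nat.find_min hex hm
  have hexp : ∀ (m : ℕ) (y : ℝ), expTwoPiI (m * (y * Complex.I)) =
      ((Real.exp (-(2 * Real.pi * m * y)) : ℝ) : ℂ) := fun m y => by
    rw [expTwoPiI, Complex.ofReal_exp]
    congr 1
    push_cast
    linear_combination (2 * Real.pi * m * y : ℂ) * Complex.I_mul_I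
  have hs : ∀ y : ℝ, y₀ < y → HasSum (fun m : ℕ => (α m - β m) *
      ((Real.exp (-((2 * Real.pi * ((m : ℝ) - m₀)) * y)) : ℝ) : ℂ)) 0 := fun y hy => by
    have h1 := (hα (y * Complex.I) (by simpa using hy)).sub (hβ (y * Complex.I) (by simpa using hy))
    have h2 := h1.mul_right ((Real.exp (2 * Real.pi * m₀ * y) : ℝ) : ℂ)
    rw [sub_self, zero_mul] at h2
    refine Eq.mp (congrArg (fun g => HasSum g 0) (funext fun m => ?_)) h2
    symm
    rw [hexp, ← sub_mul, mul_assoc (α m - β m), ← Complex.ofReal_mul, ← Real.exp_add]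
    congr 3
    ring
  have hpos : ∀ m : ℕ, α m - β m ≠ 0 → 0 ≤ 2 * Real.pi * ((m : ℝ) - m₀) := fun m hm => by
    have h1 : m₀ ≤ m := not_lt.1 fun h => hm (hmin m h)
    have h2 : (m₀ : ℝ) ≤ m := by exact_mod_cast h1
    have := Real.pi_pos
    have : 0 ≤ (m : ℝ) - m₀ := by linarith
    positivity
  have ht := tendsto_tsum_exp_neg hpos (hs (y₀ + 1) (by linarith)).summable
  have h0 : Tendsto (fun y : ℝ => ∑' m : ℕ, (α m - β m) *
      ((Real.exp (-((2 * Real.pi * ((m : ℝ) - m₀)) * y)) : ℝ) : ℂ)) atTop (𝓝 0) := by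
    refine tendsto_const_nhds.congr' ?_
    filter_upwards [eventually_gt_atTop y₀] with y hy
    exact (hs y hy).tsum_eq.symm
  have hz := tendsto_nhds_unique ht h0
  rw [tsum_eq_single m₀] at hz
  · simp only [sub_self, mul_zero, if_true] at hz
    exact Nat.find_spec hex hz
  · intro m hm
    rw [if_neg]
    have hm' : (m : ℝ) - m₀ ≠ 0 := sub_ne_zero.2 (by exact_mod_cast hm)
    have := Real.pi_pos
    positivity

/-! ### The action of the modular group and the law of Jacobi forms -/

section Cocycle

variable {n : ℕ}

theorem toBlocks_mul_eq (M M' : Gam n) :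
    fromBlocks (blockA (M * M')) (blockB (M * M')) (blockC (M * M')) (blockD (M * M')) =
      fromBlocks (blockA M * blockA M' + blockB M * blockC M')
        (blockA M * blockB M' + blockB M * blockD M')
        (blockC M * blockA M' + blockD M * blockC M')
        (blockC M * blockB M' + blockD M * blockD M') := by
  rw [blocks_eq, ← fromBlocks_multiply, blocks_eq, blocks_eq]
  exact Matrix.map_mul (f := Int.castRingHom ℂ)

theorem block_symplectic (M : Gam n) :
    (blockA M)ᵀ * blockC M = (blockC M)ᵀ * blockA M ∧
    (blockD M)ᵀ * blockA M - (blockB M)ᵀ * blockC M = 1 := by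
  have h := SymplecticGroup.map_mem M.2 (Int.castRingHom ℂ)
  rw [← blocks_eq, SymplecticGroup.fromBlocks_mem_iff] at h
  exact ⟨h.1, by simpa using congrArg Matrix.transpose h.2.2⟩

theorem mat_act (M : Gam n) (Z : siegelSpace n) :
    mat (act M Z) = numer M Z * (denom M Z)⁻¹ := rfl

theorem isUnit_denom_det (M : Gam n) (Z : siegelSpace n) : IsUnit (denom M Z).det :=
  (denom_det_ne_zero M Z).isUnit

theorem mat_act_mul_denom (M : Gam n) (Z : siegelSpace n) :
    mat (act M Z) * denom M Z = numer M Z := by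
  rw [mat_act, Matrix.mul_assoc, nonsing_inv_mul _ (isUnit_denom_det M Z), Matrix.mul_one]

theorem mat_act_eq_of_mul {M : Gam n} {Z W : siegelSpace n}
    (h : mat W * denom M Z = numer M Z) : act M Z = W := by
  apply Subtype.ext
  apply Subtype.ext
  change mat (act M Z) = mat W
  rw [mat_act, ← h, Matrix.mul_assoc, mul_nonsing_inv _ (isUnit_denom_det M Z), Matrix.mul_one]

theorem denom_mul (M M' : Gam n) (Z : siegelSpace n) :
    denom (M * M') Z = denom M (act M' Z) * denom M' Z := by
  obtain ⟨-, -, hC, hD⟩ := fromBlocks_inj.1 (toBlocks_mul_eq M M')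
  rw [denom, denom, hC, hD, Matrix.add_mul (blockC M * mat (act M' Z)), Matrix.mul_assoc (blockC M),
    mat_act_mul_denom, numer, denom]
  simp only [Matrix.add_mul, Matrix.mul_add, Matrix.mul_assoc]
  abel

theorem numer_mul (M M' : Gam n) (Z : siegelSpace n) :
    numer (M * M') Z = numer M (act M' Z) * denom M' Z := by
  obtain ⟨hA, hB, -, -⟩ := fromBlocks_inj.1 (toBlocks_mul_eq M M')
  rw [numer, numer, hA, hB, Matrix.add_mul (blockA M * mat (act M' Z)), Matrix.mul_assoc (blockA M),
    mat_act_mul_denom, numer, denom]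
  simp only [Matrix.add_mul, Matrix.mul_add, Matrix.mul_assoc]
  abel

theorem act_mul (M M' : Gam n) (Z : siegelSpace n) : act (M * M') Z = act M (act M' Z) := by
  apply mat_act_eq_of_mul
  rw [denom_mul, numer_mul, ← Matrix.mul_assoc, mat_act_mul_denom]

theorem block_one : blockA (1 : Gam n) = 1 ∧ blockB (1 : Gam n) = 0 ∧ blockC (1 : Gam n) = 0 ∧
    blockD (1 : Gam n) = 1 := by
  rw [← fromBlocks_inj, blocks_eq, fromBlocks_one]
  exact Matrix.map_one _ (by simp) (by simp)

theorem denom_one (Z : siegelSpace n) : denom (1 : Gam n) Z = 1 := by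
  rw [denom, block_one.2.2.1, block_one.2.2.2]; simp

theorem act_one (Z : siegelSpace n) : act (1 : Gam n) Z = Z := by
  apply mat_act_eq_of_mul
  rw [denom_one, numer, block_one.1, block_one.2.1]; simp

theorem denom_transpose_mul_blockA (M : Gam n) (Z : siegelSpace n) :
    (denom M Z)ᵀ * blockA M - (numer M Z)ᵀ * blockC M = 1 := by
  obtain ⟨h1, h2⟩ := block_symplectic M
  rw [denom, numer, transpose_add, transpose_add, transpose_mul, transpose_mul, mat_isSymm,
    Matrix.add_mul, Matrix.add_mul, Matrix.mul_assoc, Matrix.mul_assoc, h1, ← h2]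
  abel

/-- The cocycle identity of the quadratic form in the automorphy factor of Jacobi forms. -/
theorem inv_denom_mul_blockC_mul (M M' : Gam n) (Z : siegelSpace n) :
    (denom (M * M') Z)⁻¹ * blockC (M * M') = (denom M' Z)⁻¹ * blockC M' +
      (denom M' Z)⁻¹ * ((denom M (act M' Z))⁻¹ * blockC M) * ((denom M' Z)⁻¹)ᵀ := by
  obtain ⟨-, -, hC, -⟩ := fromBlocks_inj.1 (toBlocks_mul_eq M M')
  set W := act M' Z
  set Q := denom M W
  set Q' := denom M' Z with hQ'
  have hu : IsUnit Q.det := isUnit_denom_det M W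
  have hu' : IsUnit Q'.det := isUnit_denom_det M' Z
  have huT : IsUnit (Q'ᵀ).det := by rwa [det_transpose]
  have hA : blockA M' = mat W * blockC M' + (Q'⁻¹)ᵀ := by
    have h1 := denom_transpose_mul_blockA M' Z
    rw [← hQ', ← mat_act_mul_denom, transpose_mul, mat_isSymm, ← hQ', Matrix.mul_assoc,
      ← Matrix.mul_sub] at h1
    rw [transpose_nonsing_inv, ← sub_eq_iff_eq_add']
    exact (inv_eq_right_inv h1).symm
  have key : blockC (M * M') = Q * blockC M' + blockC M * (Q'⁻¹)ᵀ := by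
    rw [hC, hA]
    simp only [Q, denom, Matrix.add_mul, Matrix.mul_add, Matrix.mul_assoc]
    abel
  rw [denom_mul, key, Matrix.mul_inv_rev, Matrix.mul_add, Matrix.mul_assoc, Matrix.mul_assoc,
    nonsing_inv_mul_cancel_left _ _ hu, Matrix.mul_assoc, Matrix.mul_assoc]

/-- The transformation law of Jacobi forms of weight `k` and index `m` under one element of the
modular group. -/
def JacobiLaw (k m : ℕ) (f : siegelSpace n × (Fin n → ℂ) → ℂ) (M : Gam n) : Prop :=
  ∀ (Z : siegelSpace n) (z : Fin n → ℂ),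
    f (act M Z, ((denom M Z)⁻¹)ᵀ *ᵥ z) =
      (denom M Z).det ^ k * expTwoPiI (m * (z ⬝ᵥ ((denom M Z)⁻¹ * blockC M) *ᵥ z)) * f (Z, z)

theorem expTwoPiI_add (x y : ℂ) : expTwoPiI (x + y) = expTwoPiI x * expTwoPiI y := by
  rw [expTwoPiI, mul_add, Complex.exp_add]; rfl

theorem expTwoPiI_zero : expTwoPiI 0 = 1 := by simp [expTwoPiI]

theorem jacobi_factor_mul (k m : ℕ) (M M' : Gam n) (Z : siegelSpace n) (z : Fin n → ℂ) :
    (denom (M * M') Z).det ^ k *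
        expTwoPiI (m * (z ⬝ᵥ ((denom (M * M') Z)⁻¹ * blockC (M * M')) *ᵥ z)) =
      ((denom M (act M' Z)).det ^ k * expTwoPiI (m * ((((denom M' Z)⁻¹)ᵀ *ᵥ z) ⬝ᵥ
        ((denom M (act M' Z))⁻¹ * blockC M) *ᵥ (((denom M' Z)⁻¹)ᵀ *ᵥ z)))) *
      ((denom M' Z).det ^ k * expTwoPiI (m * (z ⬝ᵥ ((denom M' Z)⁻¹ * blockC M') *ᵥ z))) := by
  have h : (((denom M' Z)⁻¹)ᵀ *ᵥ z) ⬝ᵥ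
        ((denom M (act M' Z))⁻¹ * blockC M) *ᵥ (((denom M' Z)⁻¹)ᵀ *ᵥ z) =
      z ⬝ᵥ ((denom M' Z)⁻¹ * ((denom M (act M' Z))⁻¹ * blockC M) * ((denom M' Z)⁻¹)ᵀ) *ᵥ z := by
    rw [mulVec_transpose, ← dotProduct_mulVec, mulVec_mulVec, ← mulVec_transpose, mulVec_mulVec]
  rw [h, inv_denom_mul_blockC_mul, denom_mul, det_mul, mul_pow, add_mulVec, dotProduct_add, mul_add,
    expTwoPiI_add]
  ring

theorem JacobiLaw.mul {k m : ℕ} {f : siegelSpace n × (Fin n → ℂ) → ℂ} {M M' : Gam n}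
    (h : JacobiLaw k m f M) (h' : JacobiLaw k m f M') : JacobiLaw k m f (M * M') := fun Z z => by
  have h1 := h (act M' Z) (((denom M' Z)⁻¹)ᵀ *ᵥ z)
  rw [h' Z z] at h1
  rw [jacobi_factor_mul, mul_assoc, ← h1, act_mul, denom_mul, Matrix.mul_inv_rev, transpose_mul,
    mulVec_mulVec]

theorem JacobiLaw.inv {k m : ℕ} {f : siegelSpace n × (Fin n → ℂ) → ℂ} {M : Gam n}
    (h : JacobiLaw k m f M) : JacobiLaw k m f M⁻¹ := fun Z z => by
  have h1 := h (act M⁻¹ Z) (((denom M⁻¹ Z)⁻¹)ᵀ *ᵥ z)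
  have h2 := jacobi_factor_mul k m M M⁻¹ Z z
  have h3 := denom_mul M M⁻¹ Z
  rw [mul_inv_cancel, denom_one] at h3
  rw [mulVec_mulVec, ← transpose_mul, ← Matrix.mul_inv_rev, ← h3, ← act_mul, mul_inv_cancel, act_one,
    inv_one, transpose_one, one_mulVec] at h1
  rw [mul_inv_cancel, denom_one, block_one.2.2.1] at h2
  simp only [det_one, one_pow, mul_zero, zero_mulVec, dotProduct_zero, expTwoPiI_zero,
    one_mul] at h2
  rw [h1, ← mul_assoc, mul_comm (_ * _) (_ * expTwoPiI _), ← h2, one_mul]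

theorem JacobiLaw.of_closure {k m : ℕ} {f : siegelSpace n × (Fin n → ℂ) → ℂ} {S : Set (Gam n)}
    (h : ∀ M ∈ S, JacobiLaw k m f M) {M : Gam n} (hM : M ∈ Subgroup.closure S) :
    JacobiLaw k m f M := by
  induction hM using Subgroup.closure_induction with
  | mem M hM => exact h M hM
  | one => intro Z z; simp [denom_one, act_one, block_one.2.2.1, expTwoPiI_zero]
  | mul M M' _ _ h h' => exact h.mul h'
  | inv M _ h => exact h.inv

end Cocycle

/-! ### Generators of the modular group of degree two -/

/-- The translation `Z ↦ Z + S` by an integral symmetric matrix `S`. -/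
def translation {n : ℕ} (S : Matrix (Fin n) (Fin n) ℤ) (hS : Sᵀ = S) : Gam n :=
  ⟨fromBlocks 1 S 0 1, SymplecticGroup.fromBlocks_mem_iff.2 (by simp [hS])⟩

/-- The element `Z ↦ U Z Uᵗ` of the modular group, where `V` is the contragredient of `U`. -/
def levi {n : ℕ} (U V : Matrix (Fin n) (Fin n) ℤ) (h : Uᵀ * V = 1) : Gam n :=
  ⟨fromBlocks U 0 0 V, SymplecticGroup.fromBlocks_mem_iff.2 (by simp [h])⟩

/-- `SL(2, ℤ)` acting on the first and third coordinates of `ℤ⁴`. -/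
def embedFst : SpecialLinearGroup (Fin 2) ℤ →* Gam 2 where
  toFun g := ⟨fromBlocks !![g 0 0, 0; 0, 1] !![g 0 1, 0; 0, 0] !![g 1 0, 0; 0, 0]
    !![g 1 1, 0; 0, 1], SymplecticGroup.fromBlocks_mem_iff.2 (by
      have h := g.2
      rw [det_fin_two] at h
      refine ⟨?_, ?_, ?_⟩ <;> ext i j <;> fin_cases i <;> fin_cases j <;>
        simp [Matrix.mul_apply, Fin.sum_univ_two] <;> linarith)⟩
  map_one' := by
    apply Subtype.ext
    ext (i | i) (j | j) <;> fin_cases i <;> fin_cases j <;> simp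
  map_mul' g h := by
    apply Subtype.ext
    ext (i | i) (j | j) <;> fin_cases i <;> fin_cases j <;>
      simp [Matrix.mul_apply, Fin.sum_univ_two]

/-- `SL(2, ℤ)` acting on the second and fourth coordinates of `ℤ⁴`. -/
def embedSnd : SpecialLinearGroup (Fin 2) ℤ →* Gam 2 where
  toFun g := ⟨fromBlocks !![1, 0; 0, g 0 0] !![0, 0; 0, g 0 1] !![0, 0; 0, g 1 0]
    !![1, 0; 0, g 1 1], SymplecticGroup.fromBlocks_mem_iff.2 (by
      have h := g.2
      rw [det_fin_two] at h
      refine ⟨?_, ?_, ?_⟩ <;> ext i j <;> fin_cases i <;> fin_cases j <;>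
        simp [Matrix.mul_apply, Fin.sum_univ_two] <;> linarith)⟩
  map_one' := by
    apply Subtype.ext
    ext (i | i) (j | j) <;> fin_cases i <;> fin_cases j <;> simp
  map_mul' g h := by
    apply Subtype.ext
    ext (i | i) (j | j) <;> fin_cases i <;> fin_cases j <;>
      simp [Matrix.mul_apply, Fin.sum_univ_two]

/-- `SL(2, ℤ)` in the Levi subgroup of `Sp(2, ℤ)`. -/
def embedLevi : SpecialLinearGroup (Fin 2) ℤ →* Gam 2 where
  toFun g := levi !![g 0 0, g 0 1; g 1 0, g 1 1] !![g 1 1, -g 1 0; -g 0 1, g 0 0] (by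
      have h := g.2
      rw [det_fin_two] at h
      ext i j; fin_cases i <;> fin_cases j <;>
        simp [Matrix.mul_apply, Fin.sum_univ_two] <;> linarith)
  map_one' := by
    apply Subtype.ext
    ext (i | i) (j | j) <;> fin_cases i <;> fin_cases j <;> simp [levi]
  map_mul' g h := by
    apply Subtype.ext
    ext (i | i) (j | j) <;> fin_cases i <;> fin_cases j <;>
      simp [levi, Matrix.mul_apply, Fin.sum_univ_two] <;> ring

/-- The translation `τ₁ ↦ τ₁ + 1`. -/
def genT₁ : Gam 2 := translation !![1, 0; 0, 0] (by decide)
/-- The translation of the off-diagonal entry by `1`. -/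
def genT₁₂ : Gam 2 := translation !![0, 1; 1, 0] (by decide)
/-- The inversion of the first variable, `τ₁ ↦ -1 / τ₁`. -/
def genJ : Gam 2 := ⟨fromBlocks !![0, 0; 0, 1] !![-1, 0; 0, 0] !![1, 0; 0, 0] !![0, 0; 0, 1],
  SymplecticGroup.fromBlocks_mem_iff.2 (by decide)⟩
/-- The exchange of the two variables. -/
def genW : Gam 2 := levi !![0, 1; 1, 0] !![0, 1; 1, 0] (by decide)

/-- Four elements that generate `Sp(2, ℤ)`. -/
def generators : Set (Gam 2) := {genT₁, genT₁₂, genJ, genW}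

theorem gen_mem : genT₁ ∈ Subgroup.closure generators ∧ genT₁₂ ∈ Subgroup.closure generators ∧
    genJ ∈ Subgroup.closure generators ∧ genW ∈ Subgroup.closure generators := by
  refine ⟨?_, ?_, ?_, ?_⟩ <;> apply Subgroup.subset_closure <;> simp [generators]

open ModularGroup in
theorem range_le_closure {φ : SpecialLinearGroup (Fin 2) ℤ →* Gam 2} {H : Subgroup (Gam 2)}
    (hS : φ S ∈ H) (hT : φ T ∈ H) (g : SpecialLinearGroup (Fin 2) ℤ) : φ g ∈ H := by
  have h : Subgroup.closure {S, T} ≤ H.comap φ := by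
    rw [Subgroup.closure_le]
    rintro x (rfl | rfl)
    · exact hS
    · exact hT
  rw [SpecialLinearGroup.SL2Z_generators] at h
  exact h (Subgroup.mem_top g)

theorem embedFst_mem (g : SpecialLinearGroup (Fin 2) ℤ) :
    embedFst g ∈ Subgroup.closure generators := by
  refine range_le_closure ?_ ?_ g
  · convert gen_mem.2.2.1
    apply Subtype.ext
    decide
  · convert gen_mem.1
    apply Subtype.ext
    decide

theorem embedSnd_mem (g : SpecialLinearGroup (Fin 2) ℤ) :
    embedSnd g ∈ Subgroup.closure generators := by
  have h : embedSnd g = genW * embedFst g * genW := by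
    apply Subtype.ext
    ext (i | i) (j | j) <;> fin_cases i <;> fin_cases j <;>
      simp [genW, levi, embedFst, embedSnd, Matrix.mul_apply, Fin.sum_univ_two]
  rw [h]
  exact mul_mem (mul_mem gen_mem.2.2.2 (embedFst_mem g)) gen_mem.2.2.2

/-- The translations of the off-diagonal entry. -/
def offDiagTranslation : Multiplicative ℤ →* Gam 2 where
  toFun b := translation !![0, b.toAdd; b.toAdd, 0] (by ext i j; fin_cases i <;> fin_cases j <;> rfl)
  map_one' := by
    apply Subtype.ext
    ext (i | i) (j | j) <;> fin_cases i <;> fin_cases j <;> simp [translation]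
  map_mul' b c := by
    apply Subtype.ext
    simp only [translation, Submonoid.coe_mul, fromBlocks_multiply]
    ext (i | i) (j | j) <;> fin_cases i <;> fin_cases j <;> simp [add_comm]

theorem translation_mem (S : Matrix (Fin 2) (Fin 2) ℤ) (hS : Sᵀ = S) :
    translation S hS ∈ Subgroup.closure generators := by
  have h10 : S 1 0 = S 0 1 := congrFun (congrFun hS 0) 1
  have h : translation S hS = embedFst ⟨!![1, S 0 0; 0, 1], by simp⟩ *
      embedSnd ⟨!![1, S 1 1; 0, 1], by simp⟩ * offDiagTranslation (Multiplicative.ofAdd (S 0 1)) := by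
    apply Subtype.ext
    ext (i | i) (j | j) <;> fin_cases i <;> fin_cases j <;>
      simp [translation, embedFst, embedSnd, offDiagTranslation, Matrix.mul_apply,
        Fin.sum_univ_two, h10]
  have h2 : offDiagTranslation (Multiplicative.ofAdd (S 0 1)) = genT₁₂ ^ (S 0 1) := by
    rw [← mul_one (S 0 1), ← smul_eq_mul, ofAdd_zsmul, map_zpow]
    simp
    rfl
  rw [h, h2]
  exact mul_mem (mul_mem (embedFst_mem _) (embedSnd_mem _)) (zpow_mem gen_mem.2.1 _)

open ModularGroup in
theorem embedLevi_mem (g : SpecialLinearGroup (Fin 2) ℤ) :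
    embedLevi g ∈ Subgroup.closure generators := by
  refine range_le_closure ?_ ?_ g
  · have h : embedLevi S = genW * embedSnd (-1) := by
      apply Subtype.ext
      decide
    rw [h]
    exact mul_mem gen_mem.2.2.2 (embedSnd_mem _)
  · -- a symmetric element of `GL(2, ℤ)` is, up to sign, a word in translations and inversions
    have h : embedLevi T = embedFst (-1) * embedSnd (-1) *
        ((translation !![1, 1; 1, 0] (by decide) * (embedFst S * embedSnd S)) *
        (translation !![0, 1; 1, -1] (by decide) * (embedFst S * embedSnd S)) *
        (translation !![1, 1; 1, 0] (by decide) * (embedFst S * embedSnd S))) * genW := by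
      apply Subtype.ext
      decide
    rw [h]
    have hJ := mul_mem (embedFst_mem S) (embedSnd_mem S)
    exact mul_mem (mul_mem (mul_mem (embedFst_mem _) (embedSnd_mem _)) (mul_mem (mul_mem
      (mul_mem (translation_mem _ _) hJ) (mul_mem (translation_mem _ _) hJ))
      (mul_mem (translation_mem _ _) hJ))) gen_mem.2.2.2

theorem exists_SL2_mul_eq_zero (a c : ℤ) :
    ∃ g : SpecialLinearGroup (Fin 2) ℤ, g 1 0 * a + g 1 1 * c = 0 := by
  by_cases h : a = 0 ∧ c = 0
  · exact ⟨1, by simp [h.1, h.2]⟩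
  · have hg : Int.gcd a c ≠ 0 := by rwa [Ne, Int.gcd_eq_zero_iff]
    obtain ⟨a', ha⟩ := Int.gcd_dvd_left (a := a) (b := c)
    obtain ⟨c', hc⟩ := Int.gcd_dvd_right (a := a) (b := c)
    have hb := Int.gcd_eq_gcd_ab a c
    have hg' : (Int.gcd a c : ℤ) ≠ 0 := by exact_mod_cast hg
    refine ⟨⟨!![Int.gcdA a c, Int.gcdB a c; -c', a'], ?_⟩, ?_⟩
    · rw [det_fin_two_of]
      apply mul_left_cancel₀ hg'
      linear_combination -hb - Int.gcdA a c * ha - Int.gcdB a c * hc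
    · change -c' * a + a' * c = 0
      linear_combination -c' * ha + a' * hc

theorem entry_relations (M : Gam 2) :
    (M.1.toBlocks₁₁)ᵀ * M.1.toBlocks₂₁ = (M.1.toBlocks₂₁)ᵀ * M.1.toBlocks₁₁ ∧
    (M.1.toBlocks₁₂)ᵀ * M.1.toBlocks₂₂ = (M.1.toBlocks₂₂)ᵀ * M.1.toBlocks₁₂ ∧
    (M.1.toBlocks₁₁)ᵀ * M.1.toBlocks₂₂ - (M.1.toBlocks₂₁)ᵀ * M.1.toBlocks₁₂ = 1 := by
  have h := M.2
  rwa [← fromBlocks_toBlocks M.1, SymplecticGroup.fromBlocks_mem_iff] at h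

theorem mem_closure_of_blocks {M : Gam 2} (hA : M.1.toBlocks₁₁ = 1) (hC : M.1.toBlocks₂₁ = 0) :
    M ∈ Subgroup.closure generators := by
  obtain ⟨-, h2, h3⟩ := entry_relations M
  have hD : M.1.toBlocks₂₂ = 1 := by simpa [hA, hC] using h3
  have hB : (M.1.toBlocks₁₂)ᵀ = M.1.toBlocks₁₂ := by simpa [hD] using h2
  have h : M = translation _ hB := by
    apply Subtype.ext
    refine (fromBlocks_toBlocks M.1).symm.trans ?_
    rw [hA, hC, hD]
    rfl
  rw [h]
  exact translation_mem _ hB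

theorem embedFst_mul_apply (g : SpecialLinearGroup (Fin 2) ℤ) (M : Gam 2) (j : Fin 2 ⊕ Fin 2) :
    (embedFst g * M).1 (Sum.inl 0) j = g 0 0 * M.1 (Sum.inl 0) j + g 0 1 * M.1 (Sum.inr 0) j ∧
    (embedFst g * M).1 (Sum.inl 1) j = M.1 (Sum.inl 1) j ∧
    (embedFst g * M).1 (Sum.inr 0) j = g 1 0 * M.1 (Sum.inl 0) j + g 1 1 * M.1 (Sum.inr 0) j ∧
    (embedFst g * M).1 (Sum.inr 1) j = M.1 (Sum.inr 1) j := by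
  refine ⟨?_, ?_, ?_, ?_⟩ <;> simp [embedFst, Matrix.mul_apply, Fin.sum_univ_two]

theorem embedSnd_mul_apply (g : SpecialLinearGroup (Fin 2) ℤ) (M : Gam 2) (j : Fin 2 ⊕ Fin 2) :
    (embedSnd g * M).1 (Sum.inl 0) j = M.1 (Sum.inl 0) j ∧
    (embedSnd g * M).1 (Sum.inl 1) j = g 0 0 * M.1 (Sum.inl 1) j + g 0 1 * M.1 (Sum.inr 1) j ∧
    (embedSnd g * M).1 (Sum.inr 0) j = M.1 (Sum.inr 0) j ∧
    (embedSnd g * M).1 (Sum.inr 1) j = g 1 0 * M.1 (Sum.inl 1) j + g 1 1 * M.1 (Sum.inr 1) j := by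
  refine ⟨?_, ?_, ?_, ?_⟩ <;> simp [embedSnd, Matrix.mul_apply, Fin.sum_univ_two]

theorem embedLevi_mul_apply (g : SpecialLinearGroup (Fin 2) ℤ) (M : Gam 2) (j : Fin 2 ⊕ Fin 2) :
    (embedLevi g * M).1 (Sum.inl 0) j = g 0 0 * M.1 (Sum.inl 0) j + g 0 1 * M.1 (Sum.inl 1) j ∧
    (embedLevi g * M).1 (Sum.inl 1) j = g 1 0 * M.1 (Sum.inl 0) j + g 1 1 * M.1 (Sum.inl 1) j ∧
    (embedLevi g * M).1 (Sum.inr 0) j = g 1 1 * M.1 (Sum.inr 0) j - g 1 0 * M.1 (Sum.inr 1) j ∧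
    (embedLevi g * M).1 (Sum.inr 1) j = -g 0 1 * M.1 (Sum.inr 0) j + g 0 0 * M.1 (Sum.inr 1) j := by
  refine ⟨?_, ?_, ?_, ?_⟩ <;>
    simp [embedLevi, levi, Matrix.mul_apply, Fin.sum_univ_two, sub_eq_add_neg]

theorem mem_closure_iff_mul {h M : Gam 2} (hh : h ∈ Subgroup.closure generators) :
    h * M ∈ Subgroup.closure generators ↔ M ∈ Subgroup.closure generators :=
  Subgroup.mul_mem_cancel_left _ hh

theorem closure_generators : Subgroup.closure generators = ⊤ := by
  rw [Subgroup.eq_top_iff']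
  -- the stages of the reduction, from the most reduced matrices to all matrices
  have s1 : ∀ M : Gam 2, M.1 (Sum.inl 0) (Sum.inl 0) = 1 → M.1 (Sum.inl 1) (Sum.inl 0) = 0 →
      M.1 (Sum.inr 0) (Sum.inl 0) = 0 → M.1 (Sum.inr 1) (Sum.inl 0) = 0 →
      M ∈ Subgroup.closure generators := by
    intro M h00 h10 h20 h30
    obtain ⟨r1, -, r3⟩ := entry_relations M
    have e1 := congrFun (congrFun r1 0) 1
    have e2 := congrFun (congrFun r3 0) 0
    have e3 := congrFun (congrFun r3 0) 1
    have e4 := congrFun (congrFun r3 1) 1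
    simp [Matrix.mul_apply, Fin.sum_univ_two, toBlocks₁₁, toBlocks₁₂, toBlocks₂₁, toBlocks₂₂,
      h00, h10, h20, h30] at e1 e2 e3 e4
    rw [e3, e1] at e4
    simp at e4
    let g : SpecialLinearGroup (Fin 2) ℤ := ⟨!![M.1 (Sum.inr 1) (Sum.inr 1),
      -M.1 (Sum.inl 1) (Sum.inr 1); -M.1 (Sum.inr 1) (Sum.inl 1), M.1 (Sum.inl 1) (Sum.inl 1)], by
        rw [det_fin_two_of]; linarith⟩
    let u : SpecialLinearGroup (Fin 2) ℤ := ⟨!![1, -M.1 (Sum.inl 0) (Sum.inl 1); 0, 1], by simp⟩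
    rw [← mem_closure_iff_mul (embedSnd_mem g), ← mem_closure_iff_mul (embedLevi_mem u)]
    have g00 : g 0 0 = M.1 (Sum.inr 1) (Sum.inr 1) := rfl
    have g01 : g 0 1 = -M.1 (Sum.inl 1) (Sum.inr 1) := rfl
    have g10 : g 1 0 = -M.1 (Sum.inr 1) (Sum.inl 1) := rfl
    have g11 : g 1 1 = M.1 (Sum.inl 1) (Sum.inl 1) := rfl
    have u00 : u 0 0 = 1 := rfl
    have u01 : u 0 1 = -M.1 (Sum.inl 0) (Sum.inl 1) := rfl
    have u10 : u 1 0 = 0 := rfl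
    have u11 : u 1 1 = 1 := rfl
    have rowA := embedLevi_mul_apply u (embedSnd g * M)
    simp only [embedSnd_mul_apply, g00, g01, g10, g11, u00, u01, u10, u11] at rowA
    have c0 := rowA (Sum.inl 0)
    have c1 := rowA (Sum.inl 1)
    rw [h00, h10, h20, h30] at c0
    rw [e1] at c1
    apply mem_closure_of_blocks
    · ext i j
      fin_cases i <;> fin_cases j
      · exact c0.1.trans (by simp)
      · exact c1.1.trans (by simp; linear_combination (-M.1 (Sum.inl 0) (Sum.inl 1)) * e4)
      · exact c0.2.1.trans (by simp)
      · exact c1.2.1.trans (by simp; linear_combination e4)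
    · ext i j
      fin_cases i <;> fin_cases j
      · exact c0.2.2.1.trans (by simp)
      · exact c1.2.2.1.trans (by simp)
      · exact c0.2.2.2.trans (by simp)
      · exact c1.2.2.2.trans (by simp; ring)
  have s2 : ∀ M : Gam 2, M.1 (Sum.inl 1) (Sum.inl 0) = 0 →
      M.1 (Sum.inr 0) (Sum.inl 0) = 0 → M.1 (Sum.inr 1) (Sum.inl 0) = 0 →
      M ∈ Subgroup.closure generators := by
    intro M h10 h20 h30
    obtain ⟨-, -, r3⟩ := entry_relations M
    have e2 := congrFun (congrFun r3 0) 0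
    simp [Matrix.mul_apply, Fin.sum_univ_two, toBlocks₁₁, toBlocks₁₂, toBlocks₂₁, toBlocks₂₂,
      h10, h20, h30] at e2
    rcases Int.eq_one_or_neg_one_of_mul_eq_one e2 with h | h
    · exact s1 M h h10 h20 h30
    · rw [← mem_closure_iff_mul (embedFst_mem (-1))]
      refine s1 _ ?_ ?_ ?_ ?_ <;> simp [embedFst_mul_apply, *]
  have s3 : ∀ M : Gam 2, M.1 (Sum.inr 0) (Sum.inl 0) = 0 → M.1 (Sum.inr 1) (Sum.inl 0) = 0 →
      M ∈ Subgroup.closure generators := by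
    intro M h20 h30
    obtain ⟨g, hg⟩ := exists_SL2_mul_eq_zero (M.1 (Sum.inl 0) (Sum.inl 0))
      (M.1 (Sum.inl 1) (Sum.inl 0))
    rw [← mem_closure_iff_mul (embedLevi_mem g)]
    refine s2 _ ?_ ?_ ?_ <;> simp [embedLevi_mul_apply, *]
  intro M
  obtain ⟨g, hg⟩ := exists_SL2_mul_eq_zero (M.1 (Sum.inl 0) (Sum.inl 0))
    (M.1 (Sum.inr 0) (Sum.inl 0))
  obtain ⟨g', hg'⟩ := exists_SL2_mul_eq_zero (M.1 (Sum.inl 1) (Sum.inl 0))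
    (M.1 (Sum.inr 1) (Sum.inl 0))
  rw [← mem_closure_iff_mul (embedFst_mem g), ← mem_closure_iff_mul (embedSnd_mem g')]
  refine s3 _ ?_ ?_ <;> simp [embedFst_mul_apply, embedSnd_mul_apply, *]

/-! ### Theta functions of genus two -/

/-- The term of index `n` of the theta series of genus two with characteristic `(a; b)`,
where `ν = 2 n + a` runs over the integral vectors congruent to `a` modulo `2`. -/
noncomputable def thetaTerm (a₁ a₂ b₁ b₂ : ℤ) (t₁ z t₂ w₁ w₂ : ℂ) (n : ℤ × ℤ) : ℂ :=
  Complex.exp (Real.pi * I / 4 * ((2 * n.1 + a₁) ^ 2 * t₁ + 2 * ((2 * n.1 + a₁) * (2 * n.2 + a₂)) * z +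
      (2 * n.2 + a₂) ^ 2 * t₂) +
    Real.pi * I * ((2 * n.1 + a₁) * (w₁ + b₁ / 2) + (2 * n.2 + a₂) * (w₂ + b₂ / 2)))

/-- The theta function of genus two with integral characteristic `(a; b)` (half-characteristic
`(a / 2; b / 2)`) at the point `(t₁, z; z, t₂)`, `(w₁, w₂)`. -/
noncomputable def theta (a₁ a₂ b₁ b₂ : ℤ) (t₁ z t₂ w₁ w₂ : ℂ) : ℂ :=
  ∑' n : ℤ × ℤ, thetaTerm a₁ a₂ b₁ b₂ t₁ z t₂ w₁ w₂ n

theorem summable_exp_quadratic {c : ℝ} (hc : 0 < c) (a v : ℝ) :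
    Summable fun n : ℤ => Real.exp (-(Real.pi / 4 * c * (2 * n + a) ^ 2) - Real.pi * ((2 * n + a) * v)) := by
  have h := ((summable_jacobiTheta₂_term_iff (I * (c * a / 2 + v : ℝ)) (I * c)).2
    (by simpa using hc)).norm
  simp only [norm_jacobiTheta₂_term] at h
  refine (h.mul_left (Real.exp (-(Real.pi / 4 * c * a ^ 2) - Real.pi * (a * v)))).congr fun n => ?_
  rw [← Real.exp_add]
  congr 1
  simp
  ring

theorem quadratic_lower_bound {y₁ y y₂ : ℝ} (h₁ : 0 < y₁) (h : y ^ 2 < y₁ * y₂) :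
    ∃ c : ℝ, 0 < c ∧ ∀ u v : ℝ, c * (u ^ 2 + v ^ 2) ≤ u ^ 2 * y₁ + 2 * (u * v) * y + v ^ 2 * y₂ := by
  have h₂ : 0 < y₂ := by
    by_contra hcon
    push Not at hcon
    nlinarith [sq_nonneg y, mul_nonneg h₁.le (neg_nonneg.2 hcon)]
  have ht : 0 < y₁ + y₂ := by positivity
  refine ⟨(y₁ * y₂ - y ^ 2) / (y₁ + y₂), div_pos (by linarith) ht, fun u v => ?_⟩
  rw [div_mul_eq_mul_div, div_le_iff₀ ht]
  nlinarith [sq_nonneg (u * y₁ + v * y), sq_nonneg (u * y + v * y₂)]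

theorem summable_thetaTerm (a₁ a₂ b₁ b₂ : ℤ) {t₁ z t₂ : ℂ} (w₁ w₂ : ℂ) (h₁ : 0 < t₁.im)
    (h : z.im ^ 2 < t₁.im * t₂.im) : Summable (thetaTerm a₁ a₂ b₁ b₂ t₁ z t₂ w₁ w₂) := by
  obtain ⟨c, hc, hb⟩ := quadratic_lower_bound h₁ h
  refine Summable.of_norm_bounded ((summable_exp_quadratic hc a₁ w₁.im).mul_of_nonneg
    (summable_exp_quadratic hc a₂ w₂.im) (fun _ => (Real.exp_pos _).le)
    fun _ => (Real.exp_pos _).le) fun n => ?_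
  rw [thetaTerm, Complex.norm_exp, ← Real.exp_add]
  apply Real.exp_le_exp.2
  have h2 := hb (2 * n.1 + a₁) (2 * n.2 + a₂)
  have hre : (Real.pi * I / 4 * ((2 * n.1 + a₁) ^ 2 * t₁ +
      2 * ((2 * n.1 + a₁) * (2 * n.2 + a₂)) * z + (2 * n.2 + a₂) ^ 2 * t₂) +
      Real.pi * I * ((2 * n.1 + a₁) * (w₁ + b₁ / 2) + (2 * n.2 + a₂) * (w₂ + b₂ / 2)) : ℂ).re =
      -(Real.pi / 4 * ((2 * n.1 + a₁) ^ 2 * t₁.im + 2 * ((2 * n.1 + a₁) * (2 * n.2 + a₂)) * z.im +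
        (2 * n.2 + a₂) ^ 2 * t₂.im)) -
      Real.pi * ((2 * n.1 + a₁) * w₁.im + (2 * n.2 + a₂) * w₂.im) := by
    have e1 : (Real.pi * I / 4 * ((2 * n.1 + a₁) ^ 2 * t₁ +
      2 * ((2 * n.1 + a₁) * (2 * n.2 + a₂)) * z + (2 * n.2 + a₂) ^ 2 * t₂) +
      Real.pi * I * ((2 * n.1 + a₁) * (w₁ + b₁ / 2) + (2 * n.2 + a₂) * (w₂ + b₂ / 2)) : ℂ) =
      I * (((Real.pi / 4 * (2 * n.1 + a₁) ^ 2 : ℝ) : ℂ) * t₁ +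
        ((Real.pi / 4 * (2 * ((2 * n.1 + a₁) * (2 * n.2 + a₂))) : ℝ) : ℂ) * z +
        ((Real.pi / 4 * (2 * n.2 + a₂) ^ 2 : ℝ) : ℂ) * t₂ + ((Real.pi * (2 * n.1 + a₁) : ℝ) : ℂ) * w₁ +
        ((Real.pi * (2 * n.2 + a₂) : ℝ) : ℂ) * w₂ +
        ((Real.pi * (2 * n.1 + a₁) * b₁ / 2 + Real.pi * (2 * n.2 + a₂) * b₂ / 2 : ℝ) : ℂ)) := by
      push_cast; ring
    rw [e1, Complex.I_mul_re]
    simp only [Complex.add_im, Complex.im_ofReal_mul, Complex.ofReal_im]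
    ring
  rw [hre]
  nlinarith [Real.pi_pos, mul_le_mul_of_nonneg_left h2 (by positivity : (0:ℝ) ≤ Real.pi / 4)]

theorem exp_pi_mul_I_int_eq {x : ℂ} (m : ℤ) (y : ℂ) (h : x = y + 2 * Real.pi * I * m) :
    Complex.exp x = Complex.exp y := by
  rw [h, Complex.exp_add, mul_comm (2 * Real.pi * I) (m : ℂ), Complex.exp_int_mul_two_pi_mul_I, mul_one]

section Laws

variable (a₁ a₂ b₁ b₂ : ℤ) (t₁ z t₂ w₁ w₂ : ℂ)

theorem theta_b₁_add_two_mul (k : ℤ) : theta a₁ a₂ (b₁ + 2 * k) b₂ t₁ z t₂ w₁ w₂ =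
    Complex.exp (Real.pi * I * (a₁ * k)) * theta a₁ a₂ b₁ b₂ t₁ z t₂ w₁ w₂ := by
  rw [theta, theta, ← tsum_mul_left]
  refine tsum_congr fun n => ?_
  rw [thetaTerm, thetaTerm, ← Complex.exp_add]
  refine exp_pi_mul_I_int_eq (n.1 * k) _ ?_
  push_cast; ring

theorem theta_b₂_add_two_mul (k : ℤ) : theta a₁ a₂ b₁ (b₂ + 2 * k) t₁ z t₂ w₁ w₂ =
    Complex.exp (Real.pi * I * (a₂ * k)) * theta a₁ a₂ b₁ b₂ t₁ z t₂ w₁ w₂ := by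
  rw [theta, theta, ← tsum_mul_left]
  refine tsum_congr fun n => ?_
  rw [thetaTerm, thetaTerm, ← Complex.exp_add]
  refine exp_pi_mul_I_int_eq (n.2 * k) _ ?_
  push_cast; ring

theorem theta_t₁_add_one : theta a₁ a₂ b₁ b₂ (t₁ + 1) z t₂ w₁ w₂ =
    Complex.exp (-(Real.pi * I / 4 * (a₁ * (a₁ + 2)))) *
      theta a₁ a₂ (b₁ + (a₁ + 1)) b₂ t₁ z t₂ w₁ w₂ := by
  rw [theta, theta, ← tsum_mul_left]
  refine tsum_congr fun n => ?_
  rw [thetaTerm, thetaTerm, ← Complex.exp_add]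
  obtain ⟨m, hm⟩ := Int.even_mul_succ_self (n.1 - 1)
  have hm' : (n.1 : ℂ) * n.1 - n.1 = 2 * m := by
    have : n.1 * n.1 - n.1 = 2 * m := by linarith
    exact_mod_cast this
  refine exp_pi_mul_I_int_eq m _ ?_
  push_cast
  linear_combination (Real.pi * I) * hm'

theorem theta_z_add_one : theta a₁ a₂ b₁ b₂ t₁ (z + 1) t₂ w₁ w₂ =
    Complex.exp (-(Real.pi * I / 2 * (a₁ * a₂))) *
      theta a₁ a₂ (b₁ + a₂) (b₂ + a₁) t₁ z t₂ w₁ w₂ := by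
  rw [theta, theta, ← tsum_mul_left]
  refine tsum_congr fun n => ?_
  rw [thetaTerm, thetaTerm, ← Complex.exp_add]
  refine exp_pi_mul_I_int_eq (n.1 * n.2) _ ?_
  push_cast; ring

theorem theta_swap : theta a₁ a₂ b₁ b₂ t₂ z t₁ w₂ w₁ = theta a₂ a₁ b₂ b₁ t₁ z t₂ w₁ w₂ := by
  rw [theta, theta, ← (Equiv.prodComm ℤ ℤ).tsum_eq]
  refine tsum_congr fun n => ?_
  rw [thetaTerm, thetaTerm]
  congr 1
  simp only [Equiv.prodComm_apply, Prod.fst_swap, Prod.snd_swap]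
  ring

theorem theta_add_lattice (l₁ l₂ k₁ k₂ : ℤ) :
    theta a₁ a₂ b₁ b₂ t₁ z t₂ (w₁ + (t₁ * l₁ + z * l₂) + k₁) (w₂ + (z * l₁ + t₂ * l₂) + k₂) =
    Complex.exp (-(Real.pi * I * (l₁ ^ 2 * t₁ + 2 * (l₁ * l₂) * z + l₂ ^ 2 * t₂ +
      2 * (l₁ * w₁ + l₂ * w₂))) + Real.pi * I * (a₁ * k₁ + a₂ * k₂ - b₁ * l₁ - b₂ * l₂)) *
      theta a₁ a₂ b₁ b₂ t₁ z t₂ w₁ w₂ := by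
  rw [theta, theta, ← tsum_mul_left, ← (Equiv.addRight ((l₁, l₂) : ℤ × ℤ)).tsum_eq
    fun n => _ * thetaTerm a₁ a₂ b₁ b₂ t₁ z t₂ w₁ w₂ n]
  refine tsum_congr fun n => ?_
  rw [thetaTerm, thetaTerm, ← Complex.exp_add]
  refine exp_pi_mul_I_int_eq (n.1 * k₁ + n.2 * k₂) _ ?_
  simp only [Equiv.coe_addRight, Prod.fst_add, Prod.snd_add]
  push_cast; ring

end Laws

/-- The one-variable theta series with integral characteristic. -/
noncomputable def thetaOne (a b : ℤ) (t w : ℂ) : ℂ :=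
  ∑' n : ℤ, Complex.exp (Real.pi * I / 4 * ((2 * n + a) ^ 2 * t) + Real.pi * I * ((2 * n + a) * (w + b / 2)))

theorem thetaOne_eq (a b : ℤ) (t w : ℂ) : thetaOne a b t w =
    Complex.exp (Real.pi * I / 4 * (a ^ 2 * t) + Real.pi * I * (a * (w + b / 2))) *
      jacobiTheta₂ (w + b / 2 + a * t / 2) t := by
  rw [thetaOne, jacobiTheta₂, ← tsum_mul_left]
  refine tsum_congr fun n => ?_
  rw [jacobiTheta₂_term, ← Complex.exp_add]
  congr 1
  ring

theorem thetaOne_inversion (a b : ℤ) {t : ℂ} (ht : 0 < t.im) (w : ℂ) :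
    thetaOne a b (-1 / t) (w / t) =
      (-I * t) ^ (1 / 2 : ℂ) * Complex.exp (Real.pi * I * (w ^ 2 / t) + Real.pi * I / 2 * (a * b)) *
        thetaOne b (-a) t w := by
  have ht0 : t ≠ 0 := by rintro rfl; simp at ht
  have hI : -I * t ≠ 0 := mul_ne_zero (neg_ne_zero.2 Complex.I_ne_zero) ht0
  have hroot : (-I * t) ^ (1 / 2 : ℂ) ≠ 0 := by
    rw [Ne, Complex.cpow_eq_zero_iff]
    exact fun h => hI h.1
  have h := jacobiTheta₂_functional_equation (w + b * t / 2 - a / 2) t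
  rw [thetaOne_eq, thetaOne_eq]
  have e1 : (w / t + b / 2 + a * (-1 / t) / 2 : ℂ) = (w + b * t / 2 - a / 2) / t := by
    field_simp
    ring
  have e2 : (w + ((-a : ℤ) : ℂ) / 2 + b * t / 2 : ℂ) = w + b * t / 2 - a / 2 := by
    push_cast; ring
  rw [e1, e2, h]
  set X := jacobiTheta₂ ((w + b * t / 2 - a / 2) / t) (-1 / t)
  set r := (-I * t) ^ (1 / 2 : ℂ)
  have e3 : Complex.exp (Real.pi * I / 4 * (a ^ 2 * (-1 / t)) + Real.pi * I * (a * (w / t + b / 2))) =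
      Complex.exp (Real.pi * I * (w ^ 2 / t) + Real.pi * I / 2 * (a * b)) *
      Complex.exp (Real.pi * I / 4 * (b ^ 2 * t) + Real.pi * I * (b * (w + ((-a : ℤ) : ℂ) / 2))) *
      Complex.exp (-Real.pi * I * (w + b * t / 2 - a / 2) ^ 2 / t) := by
    rw [← Complex.exp_add, ← Complex.exp_add]
    congr 1
    push_cast
    field_simp
    ring
  rw [e3]
  field_simp

theorem theta_eq_tsum_thetaOne (a₁ a₂ b₁ b₂ : ℤ) {t₁ z t₂ : ℂ} (w₁ w₂ : ℂ) (h₁ : 0 < t₁.im)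
    (h : z.im ^ 2 < t₁.im * t₂.im) : theta a₁ a₂ b₁ b₂ t₁ z t₂ w₁ w₂ =
      ∑' m : ℤ, Complex.exp (Real.pi * I / 4 * ((2 * m + a₂) ^ 2 * t₂) +
        Real.pi * I * ((2 * m + a₂) * (w₂ + b₂ / 2))) * thetaOne a₁ b₁ t₁ (w₁ + (2 * m + a₂) * z / 2) := by
  have hs := summable_thetaTerm a₁ a₂ b₁ b₂ w₁ w₂ h₁ h
  rw [theta, ← (Equiv.prodComm ℤ ℤ).tsum_eq]
  refine ((Equiv.prodComm ℤ ℤ).summable_iff.2 hs).tsum_prod.trans ?_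
  refine tsum_congr fun m => ?_
  rw [thetaOne, ← tsum_mul_left]
  refine tsum_congr fun n => ?_
  rw [← Complex.exp_add]
  simp only [Function.comp_apply, Equiv.prodComm_apply, Prod.swap_prod_mk, thetaTerm]
  congr 1
  ring

/-- The behaviour of the theta functions under the inversion of the first variable; it reduces to
the functional equation of the one-variable theta function in each term of the outer sum. -/
theorem theta_inversion (a₁ a₂ b₁ b₂ : ℤ) {t₁ z t₂ : ℂ} (w₁ w₂ : ℂ) (h₁ : 0 < t₁.im)
    (h : z.im ^ 2 < t₁.im * t₂.im) (h₁' : 0 < (-1 / t₁).im)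
    (h' : (z / t₁).im ^ 2 < (-1 / t₁).im * (t₂ - z ^ 2 / t₁).im) :
    theta a₁ a₂ b₁ b₂ (-1 / t₁) (z / t₁) (t₂ - z ^ 2 / t₁) (w₁ / t₁) (w₂ - z * w₁ / t₁) =
      (-I * t₁) ^ (1 / 2 : ℂ) * Complex.exp (Real.pi * I * (w₁ ^ 2 / t₁) + Real.pi * I / 2 * (a₁ * b₁)) *
        theta b₁ a₂ (-a₁) b₂ t₁ z t₂ w₁ w₂ := by
  have ht0 : t₁ ≠ 0 := by rintro rfl; simp at h₁
  rw [theta_eq_tsum_thetaOne _ _ _ _ _ _ h₁' h', theta_eq_tsum_thetaOne _ _ _ _ _ _ h₁ h,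
    ← tsum_mul_left]
  refine tsum_congr fun m => ?_
  have e1 : (w₁ / t₁ + (2 * m + a₂) * (z / t₁) / 2 : ℂ) = (w₁ + (2 * m + a₂) * z / 2) / t₁ := by
    field_simp
  rw [e1, thetaOne_inversion _ _ h₁]
  have e2 : Complex.exp (Real.pi * I / 4 * ((2 * m + a₂) ^ 2 * (t₂ - z ^ 2 / t₁)) +
        Real.pi * I * ((2 * m + a₂) * (w₂ - z * w₁ / t₁ + b₂ / 2))) *
      Complex.exp (Real.pi * I * ((w₁ + (2 * m + a₂) * z / 2) ^ 2 / t₁) + Real.pi * I / 2 * (a₁ * b₁)) =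
      Complex.exp (Real.pi * I * (w₁ ^ 2 / t₁) + Real.pi * I / 2 * (a₁ * b₁)) *
      Complex.exp (Real.pi * I / 4 * ((2 * m + a₂) ^ 2 * t₂) +
        Real.pi * I * ((2 * m + a₂) * (w₂ + b₂ / 2))) := by
    rw [← Complex.exp_add, ← Complex.exp_add]
    congr 1
    field_simp
    ring
  linear_combination ((-I * t₁) ^ (1 / 2 : ℂ) *
    thetaOne b₁ (-a₁) t₁ (w₁ + (2 * m + a₂) * z / 2)) * e2

/-! ### The law of the theta functions under the generators -/

/-- The first upper entries of the ten even characteristics, in lexicographic order. -/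
def charA₁ : Fin 10 → ℤ := ![0, 0, 0, 0, 0, 0, 1, 1, 1, 1]
/-- The second upper entries of the ten even characteristics. -/
def charA₂ : Fin 10 → ℤ := ![0, 0, 0, 0, 1, 1, 0, 0, 1, 1]
/-- The first lower entries of the ten even characteristics. -/
def charB₁ : Fin 10 → ℤ := ![0, 0, 1, 1, 0, 1, 0, 0, 0, 1]
/-- The second lower entries of the ten even characteristics. -/
def charB₂ : Fin 10 → ℤ := ![0, 1, 0, 1, 0, 0, 0, 1, 0, 1]

/-- The ten even theta functions on `ℍ₂ × ℂ²`. -/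
noncomputable def evenTheta (i : Fin 10) (p : siegelSpace 2 × (Fin 2 → ℂ)) : ℂ :=
  theta (charA₁ i) (charA₂ i) (charB₁ i) (charB₂ i) (mat p.1 0 0) (mat p.1 0 1) (mat p.1 1 1)
    (p.2 0) (p.2 1)

/-- The sum of the fifteen products of six distinct variables whose characteristics add up to zero
modulo `2`; it is invariant under the action of the modular group on even characteristics. -/
def sexticSum (x : Fin 10 → ℂ) : ℂ :=
  x 0 * x 1 * x 2 * x 4 * x 6 * x 9 + x 0 * x 1 * x 2 * x 5 * x 7 * x 8 +
  x 0 * x 1 * x 3 * x 4 * x 7 * x 9 + x 0 * x 1 * x 3 * x 5 * x 6 * x 8 +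
  x 0 * x 1 * x 4 * x 5 * x 8 * x 9 + x 0 * x 2 * x 3 * x 4 * x 7 * x 8 +
  x 0 * x 2 * x 3 * x 5 * x 6 * x 9 + x 0 * x 2 * x 6 * x 7 * x 8 * x 9 +
  x 0 * x 3 * x 4 * x 5 * x 6 * x 7 + x 1 * x 2 * x 3 * x 4 * x 6 * x 8 +
  x 1 * x 2 * x 3 * x 5 * x 7 * x 9 + x 1 * x 2 * x 4 * x 5 * x 6 * x 7 +
  x 1 * x 3 * x 6 * x 7 * x 8 * x 9 + x 2 * x 3 * x 4 * x 5 * x 8 * x 9 +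
  x 4 * x 5 * x 6 * x 7 * x 8 * x 9

theorem mat_one_zero (Z : siegelSpace 2) : mat Z 1 0 = mat Z 0 1 :=
  congrFun (congrFun (mat_isSymm Z) 0) 1

theorem im_pos (Z : siegelSpace 2) : 0 < (mat Z 0 0).im := Z.2.diag_pos (i := 0)

theorem im_det_pos (Z : siegelSpace 2) :
    (mat Z 0 1).im ^ 2 < (mat Z 0 0).im * (mat Z 1 1).im := by
  have h := Z.2.det_pos
  rw [det_fin_two] at h
  change 0 < (mat Z 0 0).im * (mat Z 1 1).im - (mat Z 0 1).im * (mat Z 1 0).im at h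
  rw [mat_one_zero] at h
  linarith

/-- The modular substitution `M` permutes the ten even theta functions by `σ`, up to eighth roots of unity
`exp (π i eᵢ / 4)` and a common factor of automorphy. The permutation is odd, and the remaining
clauses record what the product of the thetas and `sexticSum` need. -/
def ThetaLaw (M : Gam 2) (σ : Equiv.Perm (Fin 10)) : Prop :=
  Equiv.Perm.sign σ = -1 ∧ ∃ e : Fin 10 → ℤ, ∀ Z : siegelSpace 2,
    ∃ j : ℂ, j ^ 8 = (denom M Z).det ^ 4 ∧
      j ^ 10 * Complex.exp (Real.pi * I / 4 * ((∑ i, e i : ℤ) : ℂ)) = -(denom M Z).det ^ 5 ∧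
      (∀ x : Fin 10 → ℂ, sexticSum (fun i => (-1) ^ (e i).natAbs * x (σ i)) = sexticSum x) ∧
      ∀ w i, evenTheta i (act M Z, ((denom M Z)⁻¹)ᵀ *ᵥ w) =
        Complex.exp (Real.pi * I / 4 * e i) * j *
          Complex.exp (Real.pi * I * (w ⬝ᵥ ((denom M Z)⁻¹ * blockC M) *ᵥ w)) * evenTheta (σ i) (Z, w)

theorem block_translation {n : ℕ} (S : Matrix (Fin n) (Fin n) ℤ) (hS : Sᵀ = S) :
    blockA (translation S hS) = 1 ∧ blockB (translation S hS) = S.map (Int.cast : ℤ → ℂ) ∧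
    blockC (translation S hS) = 0 ∧ blockD (translation S hS) = 1 := by
  simp [blockA, blockB, blockC, blockD, translation]

theorem denom_translation {n : ℕ} (S : Matrix (Fin n) (Fin n) ℤ) (hS : Sᵀ = S)
    (Z : siegelSpace n) : denom (translation S hS) Z = 1 := by
  obtain ⟨-, -, hC, hD⟩ := block_translation S hS
  simp [denom, hC, hD]

theorem mat_act_translation {n : ℕ} (S : Matrix (Fin n) (Fin n) ℤ) (hS : Sᵀ = S)
    (Z : siegelSpace n) :
    mat (act (translation S hS) Z) = mat Z + S.map (Int.cast : ℤ → ℂ) := by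
  obtain ⟨hA, hB, -, -⟩ := block_translation S hS
  simp [mat_act, denom_translation, numer, hA, hB]

theorem block_levi {n : ℕ} (U V : Matrix (Fin n) (Fin n) ℤ) (h : Uᵀ * V = 1) :
    blockA (levi U V h) = U.map (Int.cast : ℤ → ℂ) ∧ blockB (levi U V h) = 0 ∧
    blockC (levi U V h) = 0 ∧ blockD (levi U V h) = V.map (Int.cast : ℤ → ℂ) := by
  simp [blockA, blockB, blockC, blockD, levi]

theorem denom_levi {n : ℕ} (U V : Matrix (Fin n) (Fin n) ℤ) (h : Uᵀ * V = 1)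
    (Z : siegelSpace n) : denom (levi U V h) Z = V.map (Int.cast : ℤ → ℂ) := by
  obtain ⟨-, -, hC, hD⟩ := block_levi U V h
  simp [denom, hC, hD]

theorem map_mul_intCast {n : ℕ} (U V : Matrix (Fin n) (Fin n) ℤ) :
    (U * V).map (Int.cast : ℤ → ℂ) = U.map (Int.cast : ℤ → ℂ) * V.map (Int.cast : ℤ → ℂ) :=
  Matrix.map_mul (f := Int.castRingHom ℂ)

theorem levi_inv {n : ℕ} (U V : Matrix (Fin n) (Fin n) ℤ) (h : Uᵀ * V = 1) :
    (V.map (Int.cast : ℤ → ℂ))⁻¹ = (U.map (Int.cast : ℤ → ℂ))ᵀ := by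
  apply inv_eq_left_inv
  rw [← transpose_map, ← map_mul_intCast, h]
  exact Matrix.map_one _ (by simp) (by simp)

theorem mat_act_levi {n : ℕ} (U V : Matrix (Fin n) (Fin n) ℤ) (h : Uᵀ * V = 1)
    (Z : siegelSpace n) : mat (act (levi U V h) Z) =
      U.map (Int.cast : ℤ → ℂ) * mat Z * (U.map (Int.cast : ℤ → ℂ))ᵀ := by
  obtain ⟨hA, hB, -, -⟩ := block_levi U V h
  rw [mat_act, denom_levi, levi_inv U V h, numer, hA, hB, add_zero]

theorem thetaLaw_genT₁ :
    ThetaLaw genT₁ (Equiv.swap 0 2 * Equiv.swap 1 3 * Equiv.swap 4 5) := by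
  let σ : Equiv.Perm (Fin 10) := Equiv.swap 0 2 * Equiv.swap 1 3 * Equiv.swap 4 5
  change ThetaLaw genT₁ σ
  let e : Fin 10 → ℤ := ![0, 0, 0, 0, 0, 0, 1, 1, 1, 1]
  let k : Fin 10 → ℤ := ![0, 0, 1, 1, 0, 1, 1, 1, 1, 1]
  refine ⟨by decide, e, fun Z => ⟨1, ?_, ?_, fun x => ?_, fun w i => ?_⟩⟩
  · simp [genT₁, denom_translation]
  · have h : ∑ i, e i = 4 := by decide
    rw [h, genT₁, denom_translation]
    simp [Complex.exp_pi_mul_I]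
  · have hσ : ∀ i, σ i = ![2, 3, 0, 1, 5, 4, 6, 7, 8, 9] i := by decide
    simp only [hσ, e, sexticSum]
    simp
    ring
  · have hA₁ : charA₁ (σ i) = charA₁ i := by revert i; decide
    have hA₂ : charA₂ (σ i) = charA₂ i := by revert i; decide
    have hB₁ : charB₁ i + (charA₁ i + 1) = charB₁ (σ i) + 2 * k i := by revert i; decide
    have hB₂ : charB₂ (σ i) = charB₂ i := by revert i; decide
    have he : -(charA₁ i * (charA₁ i + 2)) + 4 * (charA₁ i * k i) = e i := by revert i; decide
    have hb := (block_translation !![1, 0; 0, 0] (by decide)).2.2.1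
    simp only [evenTheta, genT₁, denom_translation, mat_act_translation, hb]
    simp only [hA₁, hA₂, hB₂]
    simp only [Matrix.add_apply, Matrix.map_apply]
    simp only [Matrix.of_apply, Matrix.cons_val_zero, Matrix.cons_val_one, Int.cast_zero,
      Int.cast_one, add_zero, inv_one, transpose_one, one_mulVec, mul_zero, zero_mulVec,
      dotProduct_zero, Complex.exp_zero, mul_one]
    rw [theta_t₁_add_one, hB₁, theta_b₁_add_two_mul, ← mul_assoc, ← Complex.exp_add, ← he]
    congr 2
    push_cast
    ring

theorem thetaLaw_genT₁₂ :
    ThetaLaw genT₁₂ (Equiv.swap 4 5 * Equiv.swap 6 7 * Equiv.swap 8 9) := by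
  let σ : Equiv.Perm (Fin 10) := Equiv.swap 4 5 * Equiv.swap 6 7 * Equiv.swap 8 9
  change ThetaLaw genT₁₂ σ
  let e : Fin 10 → ℤ := ![0, 0, 0, 0, 0, 0, 0, 0, -2, 6]
  let k₁ : Fin 10 → ℤ := ![0, 0, 0, 0, 0, 1, 0, 0, 0, 1]
  let k₂ : Fin 10 → ℤ := ![0, 0, 0, 0, 0, 0, 0, 1, 0, 1]
  refine ⟨by decide, e, fun Z => ⟨1, ?_, ?_, fun x => ?_, fun w i => ?_⟩⟩
  · simp [genT₁₂, denom_translation]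
  · have h : ∑ i, e i = 4 := by decide
    rw [h, genT₁₂, denom_translation]
    simp [Complex.exp_pi_mul_I]
  · have hσ : ∀ i, σ i = ![0, 1, 2, 3, 5, 4, 7, 6, 9, 8] i := by decide
    simp only [hσ, e, sexticSum]
    simp
    ring
  · have hA₁ : charA₁ (σ i) = charA₁ i := by revert i; decide
    have hA₂ : charA₂ (σ i) = charA₂ i := by revert i; decide
    have hB₁ : charB₁ i + charA₂ i = charB₁ (σ i) + 2 * k₁ i := by revert i; decide
    have hB₂ : charB₂ i + charA₁ i = charB₂ (σ i) + 2 * k₂ i := by revert i; decide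
    have he : -(2 * (charA₁ i * charA₂ i)) + 4 * (charA₁ i * k₁ i + charA₂ i * k₂ i) = e i := by
      revert i; decide
    have hb := (block_translation !![0, 1; 1, 0] (by decide)).2.2.1
    simp only [evenTheta, genT₁₂, denom_translation, mat_act_translation, hb]
    simp only [hA₁, hA₂]
    simp only [Matrix.add_apply, Matrix.map_apply]
    simp only [Matrix.of_apply, Matrix.cons_val_zero, Matrix.cons_val_one, Int.cast_zero,
      Int.cast_one, add_zero, inv_one, transpose_one, one_mulVec, mul_zero, zero_mulVec,
      dotProduct_zero, Complex.exp_zero, mul_one]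
    rw [theta_z_add_one, hB₁, hB₂, theta_b₁_add_two_mul, theta_b₂_add_two_mul, ← mul_assoc,
      ← mul_assoc, ← Complex.exp_add, ← Complex.exp_add, ← he]
    congr 2
    push_cast
    ring

theorem thetaLaw_genW :
    ThetaLaw genW (Equiv.swap 1 2 * Equiv.swap 4 6 * Equiv.swap 5 7) := by
  let σ : Equiv.Perm (Fin 10) := Equiv.swap 1 2 * Equiv.swap 4 6 * Equiv.swap 5 7
  change ThetaLaw genW σ
  refine ⟨by decide, 0, fun Z => ⟨1, ?_, ?_, fun x => ?_, fun w i => ?_⟩⟩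
  · simp [genW, denom_levi, det_fin_two]
    norm_num
  · simp [genW, denom_levi, det_fin_two]
    norm_num
  · have hσ : ∀ i, σ i = ![0, 2, 1, 3, 6, 7, 4, 5, 8, 9] i := by decide
    simp only [hσ, sexticSum]
    simp
    ring
  · have hA₁ : charA₁ (σ i) = charA₂ i := by revert i; decide
    have hA₂ : charA₂ (σ i) = charA₁ i := by revert i; decide
    have hB₁ : charB₁ (σ i) = charB₂ i := by revert i; decide
    have hB₂ : charB₂ (σ i) = charB₁ i := by revert i; decide
    have hb := (block_levi !![0, 1; 1, 0] !![0, 1; 1, 0] (by decide)).2.2.1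
    simp only [evenTheta, genW, denom_levi, levi_inv !![0, 1; 1, 0] !![0, 1; 1, 0] (by decide),
      mat_act_levi, hb, hA₁, hA₂, hB₁, hB₂]
    rw [← theta_swap]
    simp [Matrix.mul_apply, Fin.sum_univ_two, mulVec, dotProduct, mat_one_zero]

theorem thetaLaw_genJ :
    ThetaLaw genJ (Equiv.swap 2 6 * Equiv.swap 3 7 * Equiv.swap 5 8) := by
  let σ : Equiv.Perm (Fin 10) := Equiv.swap 2 6 * Equiv.swap 3 7 * Equiv.swap 5 8
  change ThetaLaw genJ σ
  let e : Fin 10 → ℤ := ![0, 0, 0, 0, 0, 0, 0, 0, 0, -2]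
  have hblock : blockA genJ = !![0, 0; 0, 1] ∧ blockB genJ = !![-1, 0; 0, 0] ∧
      blockC genJ = !![1, 0; 0, 0] ∧ blockD genJ = !![0, 0; 0, 1] := by
    refine ⟨?_, ?_, ?_, ?_⟩ <;> ext i j <;> fin_cases i <;> fin_cases j <;>
      simp [genJ, blockA, blockB, blockC, blockD]
  obtain ⟨hA, hB, hC, hD⟩ := hblock
  have hden : ∀ Z, denom genJ Z = !![mat Z 0 0, mat Z 0 1; 0, 1] := fun Z => by
    rw [denom, hC, hD]
    ext i j; fin_cases i <;> fin_cases j <;>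
      simp [vecMul, dotProduct, Fin.sum_univ_two]
  have hdet : ∀ Z, (denom genJ Z).det = mat Z 0 0 := fun Z => by simp [hden]
  have hroot : ∀ Z : siegelSpace 2, ((-I * mat Z 0 0) ^ (1 / 2 : ℂ)) ^ 2 = -I * mat Z 0 0 := fun Z => by
    rw [← Complex.cpow_nat_mul]
    norm_num
  refine ⟨by decide, e, fun Z => ⟨(-I * mat Z 0 0) ^ (1 / 2 : ℂ), ?_, ?_, fun x => ?_,
    fun w i => ?_⟩⟩
  · rw [hdet, show (8 : ℕ) = 2 * 4 from rfl, pow_mul, hroot Z]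
    linear_combination (mat Z 0 0) ^ 4 * (I ^ 2 - 1) * Complex.I_sq
  · have h : ∑ i, e i = -2 := by decide
    have h2 : (Real.pi * I / 4 * ((-2 : ℤ) : ℂ)) = -(Real.pi / 2 * I) := by push_cast; ring
    rw [h, h2, Complex.exp_neg, Complex.exp_pi_div_two_mul_I, Complex.inv_I, hdet,
      show (10 : ℕ) = 2 * 5 from rfl, pow_mul, hroot Z]
    linear_combination (mat Z 0 0) ^ 5 * (I ^ 4 - I ^ 2 + 1) * Complex.I_sq
  · have hσ : ∀ i, σ i = ![0, 1, 6, 7, 4, 8, 2, 3, 5, 9] i := by decide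
    simp only [hσ, e, sexticSum]
    simp
    ring
  · have hA₁ : charA₁ (σ i) = charB₁ i := by revert i; decide
    have hA₂ : charA₂ (σ i) = charA₂ i := by revert i; decide
    have hB₁ : charB₁ (σ i) = charA₁ i := by revert i; decide
    have hB₂ : charB₂ (σ i) = charB₂ i := by revert i; decide
    have he : -(2 * (charA₁ i * charB₁ i)) = e i := by revert i; decide
    have ht0 : mat Z 0 0 ≠ 0 := fun h => (im_pos Z).ne' (by rw [h]; rfl)
    have hinv : (denom genJ Z)⁻¹ = !![1 / mat Z 0 0, -(mat Z 0 1 / mat Z 0 0); 0, 1] := by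
      apply inv_eq_right_inv
      rw [hden]
      ext i j; fin_cases i <;> fin_cases j <;> simp [Matrix.mul_apply, Fin.sum_univ_two, ht0]
      field_simp
      ring
    have hact : mat (act genJ Z) = !![-1 / mat Z 0 0, mat Z 0 1 / mat Z 0 0;
        mat Z 0 1 / mat Z 0 0, mat Z 1 1 - mat Z 0 1 ^ 2 / mat Z 0 0] := by
      rw [mat_act, hinv, numer, hA, hB]
      ext i j; fin_cases i <;> fin_cases j <;>
        simp [vecMul, vecHead, vecTail, dotProduct, Fin.sum_univ_two, mat_one_zero, ht0] <;>
        field_simp <;> ring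
    have hp := im_pos (act genJ Z)
    have hp' := im_det_pos (act genJ Z)
    rw [hact] at hp hp'
    have h := theta_inversion (charA₁ i) (charA₂ i) (charB₁ i) (charB₂ i) (w 0) (w 1)
      (im_pos Z) (im_det_pos Z) hp hp'
    have hneg : -charA₁ i = charA₁ i + 2 * (-charA₁ i) := by ring
    rw [hneg, theta_b₁_add_two_mul] at h
    have hw : (!![1 / mat Z 0 0, -(mat Z 0 1 / mat Z 0 0); 0, 1] : Matrix (Fin 2) (Fin 2) ℂ)ᵀ *ᵥ w =
        ![w 0 / mat Z 0 0, w 1 - mat Z 0 1 * w 0 / mat Z 0 0] := by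
      ext i; fin_cases i <;> simp [mulVec, dotProduct, Fin.sum_univ_two] <;> ring
    have hq : w ⬝ᵥ ((!![1 / mat Z 0 0, -(mat Z 0 1 / mat Z 0 0); 0, 1] : Matrix (Fin 2) (Fin 2) ℂ) *
        !![1, 0; 0, 0]) *ᵥ w = w 0 ^ 2 / mat Z 0 0 := by
      simp [mulVec, dotProduct, Fin.sum_univ_two, Matrix.mul_apply]
      ring
    simp only [evenTheta, hinv, hact, hw, hC, hq, hA₁, hA₂, hB₁, hB₂, ← he]
    refine h.trans ?_
    have hexp : Complex.exp (Real.pi * I * (w 0 ^ 2 / mat Z 0 0) +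
        Real.pi * I / 2 * (charA₁ i * charB₁ i)) *
        Complex.exp (Real.pi * I * (charB₁ i * ((-charA₁ i : ℤ) : ℂ))) =
        Complex.exp (Real.pi * I / 4 * ((-(2 * (charA₁ i * charB₁ i)) : ℤ) : ℂ)) *
        Complex.exp (Real.pi * I * (w 0 ^ 2 / mat Z 0 0)) := by
      rw [← Complex.exp_add, ← Complex.exp_add]
      congr 1
      push_cast
      ring
    rw [mul_assoc, ← mul_assoc (Complex.exp _) (Complex.exp _), hexp]
    ring

theorem thetaLaw_of_mem {M : Gam 2} (hM : M ∈ generators) : ∃ σ, ThetaLaw M σ := by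
  rcases hM with rfl | rfl | rfl | rfl
  exacts [⟨_, thetaLaw_genT₁⟩, ⟨_, thetaLaw_genT₁₂⟩, ⟨_, thetaLaw_genJ⟩, ⟨_, thetaLaw_genW⟩]

/-! ### Expansions in characters -/

/-- The space of exponents `(N, R)`, whose characters are `e(tr (N Z) + Rᵗ z)`. -/
abbrev Exponent := Matrix (Fin 2) (Fin 2) ℝ × (Fin 2 → ℝ)

/-- The character `e(tr (N Z) + Rᵗ z)` of the exponent `(N, R)`. -/
noncomputable def character (k : Exponent) (p : siegelSpace 2 × (Fin 2 → ℂ)) : ℂ :=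
  expTwoPiI ((k.1.map (Complex.ofReal : ℝ → ℂ) * mat p.1).trace +
    (fun i => (k.2 i : ℂ)) ⬝ᵥ p.2)

theorem character_eq (k : Exponent) (p : siegelSpace 2 × (Fin 2 → ℂ)) :
    character k p = expTwoPiI (k.1 0 0 * mat p.1 0 0 + (k.1 0 1 + k.1 1 0) * mat p.1 0 1 +
      k.1 1 1 * mat p.1 1 1 + (k.2 0 * p.2 0 + k.2 1 * p.2 1)) := by
  simp [character, trace, Matrix.mul_apply, dotProduct, Fin.sum_univ_two, mat_one_zero]
  congr 1
  ring

theorem character_add (k l : Exponent) (p : siegelSpace 2 × (Fin 2 → ℂ)) :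
    character (k + l) p = character k p * character l p := by
  simp only [character_eq, ← expTwoPiI_add, Prod.fst_add, Prod.snd_add, Matrix.add_apply,
    Pi.add_apply]
  congr 1
  push_cast
  ring

theorem character_zero (p : siegelSpace 2 × (Fin 2 → ℂ)) : character 0 p = 1 := by
  simp [character_eq, expTwoPiI_zero]

/-- `F` is the sum of an absolutely convergent series of characters with exponents in `S`.
The exponents are allowed to repeat, so that products of series need no regrouping. -/
def HasExpansion (S : Set Exponent) (F : siegelSpace 2 × (Fin 2 → ℂ) → ℂ) : Prop :=
  ∃ (ι : Type) (d : ι → ℂ) (key : ι → Exponent), (∀ i, key i ∈ S) ∧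
    ∀ p, HasSum (fun i => d i * character (key i) p) (F p)

theorem hasSum_mul_of_complex {ι κ : Type*} {f : ι → ℂ} {g : κ → ℂ} {a b : ℂ} (hf : HasSum f a)
    (hg : HasSum g b) : HasSum (fun x : ι × κ => f x.1 * g x.2) (a * b) :=
  hf.mul hg (summable_mul_of_summable_norm hf.summable.norm hg.summable.norm)

namespace HasExpansion

variable {S S' S'' : Set Exponent} {F G : siegelSpace 2 × (Fin 2 → ℂ) → ℂ}

theorem mono (hF : HasExpansion S F) (h : S ⊆ S') : HasExpansion S' F := by
  obtain ⟨ι, d, key, hk, hs⟩ := hF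
  exact ⟨ι, d, key, fun i => h (hk i), hs⟩

theorem zero : HasExpansion S fun _ => 0 :=
  ⟨Empty, fun _ => 0, fun _ => 0, fun i => i.elim, fun p => by simp⟩

theorem const (h : 0 ∈ S) (c : ℂ) : HasExpansion S fun _ => c :=
  ⟨Unit, fun _ => c, fun _ => 0, fun _ => h, fun p => by
    simp [character_zero]⟩

theorem add (hF : HasExpansion S F) (hG : HasExpansion S G) :
    HasExpansion S fun p => F p + G p := by
  obtain ⟨ι, d, key, hk, hs⟩ := hF
  obtain ⟨κ, d', key', hk', hs'⟩ := hG
  refine ⟨ι ⊕ κ, Sum.elim d d', Sum.elim key key', ?_, fun p => ?_⟩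
  · rintro (i | i)
    exacts [hk i, hk' i]
  · have h1 := Sum.inl_injective.hasSum_range_iff (f := fun x : ι ⊕ κ =>
      Sum.elim d d' x * character (Sum.elim key key' x) p) |>.2 (hs p)
    have h2 := Sum.inr_injective.hasSum_range_iff (f := fun x : ι ⊕ κ =>
      Sum.elim d d' x * character (Sum.elim key key' x) p) |>.2 (hs' p)
    exact h1.add_isCompl Set.isCompl_range_inl_range_inr h2

theorem mul (hF : HasExpansion S F) (hG : HasExpansion S' G)
    (h : ∀ k ∈ S, ∀ l ∈ S', k + l ∈ S'') : HasExpansion S'' fun p => F p * G p := by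
  obtain ⟨ι, d, key, hk, hs⟩ := hF
  obtain ⟨κ, d', key', hk', hs'⟩ := hG
  have h1 : ∀ p, HasSum (fun x : ι × κ => (d x.1 * d' x.2) * character (key x.1 + key' x.2) p)
      (F p * G p) := fun p => by
    have h2 := hasSum_mul_of_complex (hs p) (hs' p)
    simpa only [character_add, mul_mul_mul_comm] using h2
  exact ⟨ι × κ, fun x => d x.1 * d' x.2, fun x => key x.1 + key' x.2,
    fun x => h _ (hk x.1) _ (hk' x.2), h1⟩

theorem sum {κ : Type*} (s : Finset κ) {f : κ → siegelSpace 2 × (Fin 2 → ℂ) → ℂ}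
    (h : ∀ i ∈ s, HasExpansion S (f i)) : HasExpansion S fun p => ∑ i ∈ s, f i p := by
  classical
  induction s using Finset.induction_on with
  | empty => simpa using zero
  | insert i s hi ih =>
    simp only [Finset.sum_insert hi]
    exact (h i (Finset.mem_insert_self i s)).add
      (ih fun j hj => h j (Finset.mem_insert_of_mem hj))

theorem smul (hF : HasExpansion S F) (c : ℂ) : HasExpansion S fun p => c * F p := by
  obtain ⟨ι, d, key, hk, hs⟩ := hF
  exact ⟨ι, fun i => c * d i, key, hk, fun p => by simpa [mul_assoc] using (hs p).mul_left c⟩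

theorem prod {M : AddSubmonoid Exponent} {κ : Type*} (s : Finset κ)
    {f : κ → siegelSpace 2 × (Fin 2 → ℂ) → ℂ} (h : ∀ i ∈ s, HasExpansion (M : Set Exponent) (f i)) :
    HasExpansion (M : Set Exponent) fun p => ∏ i ∈ s, f i p := by
  classical
  induction s using Finset.induction_on with
  | empty => simpa using const M.zero_mem 1
  | insert i s hi ih =>
    simp only [Finset.prod_insert hi]
    exact (h i (Finset.mem_insert_self i s)).mul
      (ih fun j hj => h j (Finset.mem_insert_of_mem hj)) fun k hk l hl => M.add_mem hk hl

theorem pow {M : AddSubmonoid Exponent} (h : HasExpansion (M : Set Exponent) F) (n : ℕ) :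
    HasExpansion (M : Set Exponent) fun p => F p ^ n := by
  simpa using prod (Finset.range n) (f := fun _ => F) fun _ _ => h

/-- Invariance under a shift of order eight restricts the exponents to those whose character is
invariant: average the expansion over the shifts. -/
theorem of_invariant (hF : HasExpansion S F)
    (T : siegelSpace 2 × (Fin 2 → ℂ) → siegelSpace 2 × (Fin 2 → ℂ)) (hT : ∀ p, F (T p) = F p)
    (ζ : Exponent → ℂ) (hζ : ∀ k ∈ S, ζ k ^ 8 = 1)
    (hch : ∀ k p, character k (T p) = ζ k * character k p) :
    HasExpansion {k ∈ S | ζ k = 1} F := by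
  obtain ⟨ι, d, key, hk, hs⟩ := hF
  refine ⟨{i // ζ (key i) = 1}, fun i => d i, fun i => key i, fun i => ⟨hk i, i.2⟩, fun p => ?_⟩
  have hTj : ∀ j : ℕ, F (T^[j] p) = F p := fun j => by
    induction j with
    | zero => rfl
    | succ j ih => rw [Function.iterate_succ_apply', hT, ih]
  have hcj : ∀ (j : ℕ) k, character k (T^[j] p) = ζ k ^ j * character k p := fun j k => by
    induction j with
    | zero => simp
    | succ j ih => rw [Function.iterate_succ_apply', hch, ih]; ring
  have h1 := (hasSum_sum fun j (_ : j ∈ Finset.range 8) => hs (T^[j] p)).mul_left (1 / 8)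
  simp only [hTj, hcj, Finset.sum_const, Finset.card_range, nsmul_eq_mul] at h1
  rw [show (1 / 8 * (((8 : ℕ) : ℂ) * F p)) = F p by push_cast; ring] at h1
  have e : (fun i => 1 / 8 * ∑ j ∈ Finset.range 8, d i * (ζ (key i) ^ j * character (key i) p)) =
      Set.indicator {i | ζ (key i) = 1} fun i => d i * character (key i) p := by
    funext i
    rw [← Finset.mul_sum, ← Finset.sum_mul]
    by_cases h : ζ (key i) = 1
    · rw [Set.indicator_of_mem (by exact h), h]
      simp
      ring
    · have h0 : ∑ j ∈ Finset.range 8, ζ (key i) ^ j = 0 := by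
        have := geom_sum_mul (ζ (key i)) 8
        rw [hζ _ (hk i), sub_self] at this
        exact (mul_eq_zero.1 this).resolve_right (sub_ne_zero.2 h)
      rw [Set.indicator_of_notMem (by exact h), h0]
      simp
  rw [e] at h1
  exact hasSum_subtype_iff_indicator.2 h1

end HasExpansion

/-! ### Expansions of the theta functions -/

/-- The symmetric exponents with entries in `(1/8) ℤ`. -/
def fracExponents : AddSubmonoid Exponent where
  carrier := {k | k.1.IsSymm ∧ (∀ i j, ∃ m : ℤ, 8 * k.1 i j = m) ∧ ∀ i, ∃ m : ℤ, 8 * k.2 i = m}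
  zero_mem' := ⟨Matrix.isSymm_zero, fun _ _ => ⟨0, by simp⟩, fun _ => ⟨0, by simp⟩⟩
  add_mem' := by
    rintro k l ⟨h1, h2, h3⟩ ⟨h1', h2', h3'⟩
    refine ⟨h1.add h1', fun i j => ?_, fun i => ?_⟩
    · obtain ⟨m, hm⟩ := h2 i j
      obtain ⟨m', hm'⟩ := h2' i j
      exact ⟨m + m', by rw [Prod.fst_add, Matrix.add_apply, mul_add, hm, hm']; push_cast; rfl⟩
    · obtain ⟨m, hm⟩ := h3 i
      obtain ⟨m', hm'⟩ := h3' i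
      exact ⟨m + m', by rw [Prod.snd_add, Pi.add_apply, mul_add, hm, hm']; push_cast; rfl⟩

/-- The quadratic form of the first component of an exponent. -/
def quad (k : Exponent) (x : Fin 2 → ℝ) : ℝ := x ⬝ᵥ k.1 *ᵥ x

theorem quad_add (k l : Exponent) (x : Fin 2 → ℝ) : quad (k + l) x = quad k x + quad l x := by
  rw [quad, quad, quad, Prod.fst_add, add_mulVec, dotProduct_add]

/-- The exponents `(N, 0)` with `N` positive semidefinite: those of modular forms on `ℍ₂`. -/
def psdExponents : AddSubmonoid Exponent where
  carrier := {k | k ∈ fracExponents ∧ k.2 = 0 ∧ ∀ x, 0 ≤ quad k x}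
  zero_mem' := ⟨zero_mem _, rfl, fun x => by simp [quad]⟩
  add_mem' := by
    rintro k l ⟨h1, h2, h3⟩ ⟨h1', h2', h3'⟩
    exact ⟨add_mem h1 h1', by simp [h2, h2'], fun x => by
      rw [quad_add]; exact add_nonneg (h3 x) (h3' x)⟩

/-- The exponents `(N, 0)` with `N` positive definite: those of cusp forms on `ℍ₂`. -/
def pdExponents : Set Exponent :=
  {k | k ∈ fracExponents ∧ k.2 = 0 ∧ ∀ x, x ≠ 0 → 0 < quad k x}

/-- The exponents `(N, R)` with `4 N - R Rᵗ` positive semidefinite: those of Jacobi forms of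
index one. -/
def jacobiExponents : Set Exponent :=
  {k | k ∈ fracExponents ∧ ∀ x, (k.2 ⬝ᵥ x) ^ 2 ≤ 4 * quad k x}

/-- The exponents `(N, R)` with `4 N - R Rᵗ` positive definite: those of Jacobi cusp forms of
index one. -/
def jacobiCuspExponents : Set Exponent :=
  {k | k ∈ fracExponents ∧ ∀ x, x ≠ 0 → (k.2 ⬝ᵥ x) ^ 2 < 4 * quad k x}

/-- The exponents in `jacobiCuspExponents` that are half-integral. -/
def integralCuspExponents : Set Exponent :=
  {k | k.1.IsSymm ∧ (∀ i, ∃ m : ℤ, k.1 i i = m) ∧ (∀ i j, ∃ m : ℤ, 2 * k.1 i j = m) ∧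
    (∀ i, ∃ m : ℤ, k.2 i = m) ∧ ∀ x, x ≠ 0 → (k.2 ⬝ᵥ x) ^ 2 < 4 * quad k x}

theorem pd_add_psd {k l : Exponent} (hk : k ∈ pdExponents) (hl : l ∈ psdExponents) :
    k + l ∈ pdExponents :=
  ⟨add_mem hk.1 hl.1, by simp [hk.2.1, hl.2.1], fun x hx => by
    rw [quad_add]; exact add_pos_of_pos_of_nonneg (hk.2.2 x hx) (hl.2.2 x)⟩

theorem jacobi_add_psd {k l : Exponent} (hk : k ∈ jacobiExponents) (hl : l ∈ psdExponents) :
    k + l ∈ jacobiExponents :=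
  ⟨add_mem hk.1 hl.1, fun x => by
    have h1 := hk.2 x
    have h2 := hl.2.2 x
    rw [quad_add, Prod.snd_add, hl.2.1, add_zero]
    linarith⟩

theorem pd_add_jacobi {k l : Exponent} (hk : k ∈ pdExponents) (hl : l ∈ jacobiExponents) :
    k + l ∈ jacobiCuspExponents :=
  ⟨add_mem hk.1 hl.1, fun x hx => by
    have h1 := hl.2 x
    have h2 := hk.2.2 x hx
    rw [quad_add, Prod.snd_add, hk.2.1, zero_add]
    linarith⟩

/-- The exponent `(ν νᵗ / 8, ν / 2)` of a term of a theta series. -/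
noncomputable def thetaExponent (u v : ℤ) : Exponent :=
  (!![u * u / 8, u * v / 8; u * v / 8, v * v / 8], ![u / 2, v / 2])

/-- The exponent `(ν νᵗ / 8, 0)` of a term of a theta constant. -/
noncomputable def nullExponent (u v : ℤ) : Exponent :=
  (!![u * u / 8, u * v / 8; u * v / 8, v * v / 8], 0)

theorem quad_thetaExponent (u v : ℤ) (x : Fin 2 → ℝ) :
    quad (thetaExponent u v) x = (u * x 0 + v * x 1) ^ 2 / 8 := by
  simp [quad, thetaExponent, mulVec, dotProduct, Fin.sum_univ_two]; ring

theorem quad_nullExponent (u v : ℤ) (x : Fin 2 → ℝ) :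
    quad (nullExponent u v) x = (u * x 0 + v * x 1) ^ 2 / 8 := by
  simp [quad, nullExponent, mulVec, dotProduct, Fin.sum_univ_two]; ring

theorem thetaExponent_mem_frac (u v : ℤ) : thetaExponent u v ∈ fracExponents := by
  refine ⟨?_, fun i j => ?_, fun i => ?_⟩
  · ext i j; fin_cases i <;> fin_cases j <;> simp [thetaExponent]
  · refine ⟨![![u * u, u * v], ![u * v, v * v]] i j, ?_⟩
    fin_cases i <;> fin_cases j <;> simp [thetaExponent] <;> ring
  · refine ⟨![4 * u, 4 * v] i, ?_⟩
    fin_cases i <;> simp [thetaExponent] <;> ring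

theorem nullExponent_mem_frac (u v : ℤ) : nullExponent u v ∈ fracExponents := by
  obtain ⟨h1, h2, -⟩ := thetaExponent_mem_frac u v
  exact ⟨h1, h2, fun i => ⟨0, by simp [nullExponent]⟩⟩

theorem nullExponent_mem_psd (u v : ℤ) : nullExponent u v ∈ psdExponents :=
  ⟨nullExponent_mem_frac u v, rfl, fun x => by rw [quad_nullExponent]; positivity⟩

theorem nullExponent_add_mem_pd {u v u' v' : ℤ} (h : u * v' - v * u' ≠ 0) :
    nullExponent u v + nullExponent u' v' ∈ pdExponents := by
  refine ⟨add_mem (nullExponent_mem_frac u v) (nullExponent_mem_frac u' v'), by simp [nullExponent],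
    fun x hx => ?_⟩
  rw [quad_add, quad_nullExponent, quad_nullExponent]
  by_contra hcon
  have h1 : (u * x 0 + v * x 1 : ℝ) = 0 := by
    nlinarith [sq_nonneg (u * x 0 + v * x 1 : ℝ), sq_nonneg (u' * x 0 + v' * x 1 : ℝ)]
  have h2 : (u' * x 0 + v' * x 1 : ℝ) = 0 := by
    nlinarith [sq_nonneg (u * x 0 + v * x 1 : ℝ), sq_nonneg (u' * x 0 + v' * x 1 : ℝ)]
  have hd : (u * v' - v * u' : ℝ) ≠ 0 := by exact_mod_cast h
  apply hx
  ext i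
  fin_cases i
  · refine (mul_eq_zero.1 ?_).resolve_left hd
    change (u * v' - v * u' : ℝ) * x 0 = 0
    linear_combination (v' : ℝ) * h1 - v * h2
  · refine (mul_eq_zero.1 ?_).resolve_left hd
    change (u * v' - v * u' : ℝ) * x 1 = 0
    linear_combination (u : ℝ) * h2 - u' * h1

theorem thetaExponent_add_mem_jacobi (u v u' v' : ℤ) :
    thetaExponent u v + thetaExponent u' v' ∈ jacobiExponents := by
  refine ⟨add_mem (thetaExponent_mem_frac u v) (thetaExponent_mem_frac u' v'), fun x => ?_⟩
  rw [quad_add, quad_thetaExponent, quad_thetaExponent]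
  have : (thetaExponent u v + thetaExponent u' v').2 ⬝ᵥ x =
      (u * x 0 + v * x 1) / 2 + (u' * x 0 + v' * x 1) / 2 := by
    simp [thetaExponent, dotProduct, Fin.sum_univ_two]; ring
  rw [this]
  nlinarith [sq_nonneg ((u * x 0 + v * x 1) - (u' * x 0 + v' * x 1) : ℝ)]

/-- The even theta constants, viewed as functions on `ℍ₂ × ℂ²`. -/
noncomputable def evenNull (i : Fin 10) (p : siegelSpace 2 × (Fin 2 → ℂ)) : ℂ :=
  evenTheta i (p.1, 0)

theorem hasExpansion_evenTheta (i : Fin 10) : HasExpansion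
    {k | ∃ u v : ℤ, k = thetaExponent u v} (evenTheta i) := by
  refine ⟨ℤ × ℤ, fun n => Complex.exp (Real.pi * I * ((2 * n.1 + charA₁ i) * (charB₁ i / 2) +
    (2 * n.2 + charA₂ i) * (charB₂ i / 2))),
    fun n => thetaExponent (2 * n.1 + charA₁ i) (2 * n.2 + charA₂ i), fun n => ⟨_, _, rfl⟩,
    fun p => ?_⟩
  have h := (summable_thetaTerm (charA₁ i) (charA₂ i) (charB₁ i) (charB₂ i) (p.2 0) (p.2 1)
    (im_pos p.1) (im_det_pos p.1)).hasSum
  refine Eq.mp (congrArg (fun g => HasSum g (evenTheta i p)) (funext fun n => ?_)) h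
  rw [thetaTerm, character_eq, expTwoPiI, ← Complex.exp_add]
  congr 1
  simp [thetaExponent]
  ring

theorem hasExpansion_evenNull (i : Fin 10) : HasExpansion
    {k | ∃ u v : ℤ, 2 ∣ u - charA₁ i ∧ 2 ∣ v - charA₂ i ∧ k = nullExponent u v} (evenNull i) := by
  refine ⟨ℤ × ℤ, fun n => Complex.exp (Real.pi * I * ((2 * n.1 + charA₁ i) * (charB₁ i / 2) +
    (2 * n.2 + charA₂ i) * (charB₂ i / 2))),
    fun n => nullExponent (2 * n.1 + charA₁ i) (2 * n.2 + charA₂ i),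
    fun n => ⟨_, _, ⟨n.1, by ring⟩, ⟨n.2, by ring⟩, rfl⟩, fun p => ?_⟩
  have h := (summable_thetaTerm (charA₁ i) (charA₂ i) (charB₁ i) (charB₂ i) 0 0
    (im_pos p.1) (im_det_pos p.1)).hasSum
  refine Eq.mp (congrArg (fun g => HasSum g (evenNull i p)) (funext fun n => ?_)) h
  rw [thetaTerm, character_eq, expTwoPiI, ← Complex.exp_add]
  congr 1
  simp [nullExponent]
  ring

theorem evenNull_psd (i : Fin 10) : HasExpansion (psdExponents : Set Exponent) (evenNull i) :=
  (hasExpansion_evenNull i).mono fun _ ⟨u, v, _, _, hk⟩ => hk ▸ nullExponent_mem_psd u v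

/-- Two theta constants whose upper characteristics are linearly independent modulo `2` have a
product with positive definite exponents. -/
theorem evenNull_mul_pd {i j : Fin 10}
    (h : ¬ 2 ∣ charA₁ i * charA₂ j - charA₂ i * charA₁ j) :
    HasExpansion pdExponents fun p => evenNull i p * evenNull j p := by
  refine (hasExpansion_evenNull i).mul (hasExpansion_evenNull j) ?_
  rintro _ ⟨u, v, ⟨m, hm⟩, ⟨n, hn⟩, rfl⟩ _ ⟨u', v', ⟨m', hm'⟩, ⟨n', hn'⟩, rfl⟩
  refine nullExponent_add_mem_pd fun h0 => h ?_
  refine ⟨-(m * v' + charA₁ i * n' - n * u' - charA₂ i * m'), ?_⟩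
  linear_combination h0 - v' * hm - charA₁ i * hn' + u' * hn + charA₂ i * hm'

theorem evenTheta_sq_jacobi (i : Fin 10) :
    HasExpansion jacobiExponents fun p => evenTheta i p * evenTheta i p := by
  refine (hasExpansion_evenTheta i).mul (hasExpansion_evenTheta i) ?_
  rintro _ ⟨u, v, rfl⟩ _ ⟨u', v', rfl⟩
  exact thetaExponent_add_mem_jacobi u v u' v'

/-! ### Holomorphy and Fourier expansions -/

theorem mem_siegelSpace_two_iff (Z : SymMat 2) : Z ∈ siegelSpace 2 ↔
    0 < (Z.1 0 0).im ∧ (Z.1 0 1).im ^ 2 < (Z.1 0 0).im * (Z.1 1 1).im := by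
  refine ⟨fun h => ⟨im_pos ⟨Z, h⟩, im_det_pos ⟨Z, h⟩⟩, fun ⟨h1, h2⟩ => ?_⟩
  have hs : Z.1 1 0 = Z.1 0 1 := congrFun (congrFun Z.2 0) 1
  obtain ⟨c, hc, hb⟩ := quadratic_lower_bound h1 h2
  change ((Z.1).map Complex.im).PosDef
  rw [posDef_iff_dotProduct_mulVec]
  refine ⟨?_, fun x hx => ?_⟩
  · ext i j
    fin_cases i <;> fin_cases j <;> simp [hs]
  · have h3 := hb (x 0) (x 1)
    have h4 : 0 < c * (x 0 ^ 2 + x 1 ^ 2) := by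
      apply mul_pos hc
      by_contra hcon
      apply hx
      ext i
      fin_cases i
      · change x 0 = 0
        nlinarith [sq_nonneg (x 0), sq_nonneg (x 1)]
      · change x 1 = 0
        nlinarith [sq_nonneg (x 0), sq_nonneg (x 1)]
    have h5 : star x ⬝ᵥ ((Z.1).map Complex.im) *ᵥ x =
        x 0 ^ 2 * (Z.1 0 0).im + 2 * (x 0 * x 1) * (Z.1 0 1).im + x 1 ^ 2 * (Z.1 1 1).im := by
      simp [mulVec, dotProduct, Fin.sum_univ_two, hs]; ring
    rw [h5]
    linarith

theorem isOpen_siegelSpace_two : IsOpen (siegelSpace 2) := by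
  have h : siegelSpace 2 = {Z | 0 < (Z.1 0 0).im} ∩
      {Z | (Z.1 0 1).im ^ 2 < (Z.1 0 0).im * (Z.1 1 1).im} := by
    ext Z
    exact mem_siegelSpace_two_iff Z
  have hc : ∀ i j, Continuous fun Z : SymMat 2 => (Z.1 i j).im := fun i j =>
    Complex.continuous_im.comp (continuous_subtype_val.matrix_elem i j)
  rw [h]
  exact (isOpen_lt continuous_const (hc 0 0)).inter
    (isOpen_lt ((hc 0 1).pow 2) ((hc 0 0).mul (hc 1 1)))

/-- The exponent of a character as a linear form on the ambient space of `ℍ₂ × ℂ²`. -/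
noncomputable def exponentForm (k : Exponent) : SymMat 2 × (Fin 2 → ℂ) →ₗ[ℂ] ℂ where
  toFun x := 2 * Real.pi * I * ((k.1.map (Complex.ofReal : ℝ → ℂ) * x.1.1).trace +
    (fun i => (k.2 i : ℂ)) ⬝ᵥ x.2)
  map_add' x y := by
    simp [Matrix.mul_add, trace_add, dotProduct_add]; ring
  map_smul' c x := by
    simp [trace_smul, dotProduct_smul]; ring

theorem HasExpansion.exists_holomorphic {S : Set Exponent}
    {F : siegelSpace 2 × (Fin 2 → ℂ) → ℂ} (hF : HasExpansion S F) :
    ∃ G : SymMat 2 × (Fin 2 → ℂ) → ℂ, DifferentiableOn ℂ G (siegelSpace 2 ×ˢ Set.univ) ∧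
      ∀ (Z : siegelSpace 2) (z : Fin 2 → ℂ), G (Z.1, z) = F (Z, z) := by
  obtain ⟨ι, d, key, -, hs⟩ := hF
  refine ⟨fun x => ∑' i, d i * Complex.exp (exponentForm (key i) x), ?_, fun Z z =>
    (hs (Z, z)).tsum_eq⟩
  refine differentiableOn_of_hasSum_exp (isOpen_siegelSpace_two.prod isOpen_univ) d
    (fun i => exponentForm (key i)) fun x hx => ?_
  exact (hs (⟨x.1, hx.1⟩, x.2)).summable.hasSum

/-- A convergent series of half-integral exponents satisfying the cusp condition is a Fourier
expansion of the kind required of Jacobi cusp forms. -/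
theorem HasExpansion.cuspidal {F : siegelSpace 2 × (Fin 2 → ℂ) → ℂ}
    (hF : HasExpansion integralCuspExponents F) :
    ∃ c : HalfIntegral 2 × (Fin 2 → ℤ) → ℂ,
    (∀ (N : HalfIntegral 2) (R : Fin 2 → ℤ),
      ¬ ((4 * (1 : ℕ) : ℝ) • N.1 -
        vecMulVec (fun i => (R i : ℝ)) (fun i => (R i : ℝ))).PosDef → c (N, R) = 0) ∧
    ∀ (Z : siegelSpace 2) (z : Fin 2 → ℂ),
      HasSum (fun p : HalfIntegral 2 × (Fin 2 → ℤ) =>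
        c p * expTwoPiI (pairing p.1 Z + (fun i => (p.2 i : ℂ)) ⬝ᵥ z)) (F (Z, z)) := by
  obtain ⟨ι, d, key, hk, hs⟩ := hF
  choose h1 h2 h3 h4 h5 using hk
  choose R hR using h4
  set K : ι → HalfIntegral 2 × (Fin 2 → ℤ) := fun i => (⟨(key i).1, h1 i, h2 i, h3 i⟩, R i) with hK
  refine ⟨fun p => ∑' i : {i // K i = p}, d i, fun N R' hN => ?_, fun Z z => ?_⟩
  · suffices h : IsEmpty {i // K i = (N, R')} by
      exact tsum_empty
    refine ⟨fun ⟨i, hi⟩ => hN ?_⟩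
    have hN' : N.1 = (key i).1 := by rw [← congrArg (fun p => p.1.1) hi]
    have hR' : (fun j => (R' j : ℝ)) = (key i).2 := by
      funext j
      have h := congrFun (congrArg Prod.snd hi) j
      rw [hR i j]
      exact congrArg (Int.cast : ℤ → ℝ) h.symm
    rw [hN', hR', posDef_iff_dotProduct_mulVec]
    refine ⟨?_, fun x hx => ?_⟩
    · ext a b
      have := congrFun (congrFun (h1 i) a) b
      simp only [transpose_apply] at this
      simp [this, vecMulVec_apply, mul_comm]
    · have := h5 i x hx
      have e : star x ⬝ᵥ ((4 * (1 : ℕ) : ℝ) • (key i).1 - vecMulVec (key i).2 (key i).2) *ᵥ x =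
          4 * quad (key i) x - ((key i).2 ⬝ᵥ x) ^ 2 := by
        simp only [quad, star_trivial, sub_mulVec, smul_mulVec, dotProduct_sub, dotProduct_smul,
          vecMulVec_mulVec, smul_eq_mul, Nat.cast_one, mul_one]
        simp [dotProduct_comm x, sq]; ring
      rw [e]
      linarith
  · have hf := hasSum_fiber (hs (Z, z)) K
    refine Eq.mp (congrArg (fun g => HasSum g (F (Z, z))) (funext fun p => ?_)) hf
    dsimp only
    rw [← tsum_mul_right]
    refine tsum_congr ?_
    rintro ⟨i, rfl⟩
    rw [character]
    simp only [hK, pairing, hR]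
    simp

theorem expTwoPiI_eq_one_iff (x : ℝ) : expTwoPiI x = 1 ↔ ∃ m : ℤ, x = m := by
  rw [expTwoPiI, Complex.exp_eq_one_iff]
  have h : (2 * Real.pi * I : ℂ) ≠ 0 := Complex.two_pi_I_ne_zero
  refine exists_congr fun m => ⟨fun hm => ?_, fun hm => by rw [hm]; push_cast; ring⟩
  have : (x : ℂ) = (m : ℂ) := mul_left_cancel₀ h (by rw [hm]; ring)
  exact_mod_cast this

theorem expTwoPiI_pow_eight {x : ℝ} (h : ∃ m : ℤ, 8 * x = m) : expTwoPiI x ^ 8 = 1 := by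
  have : expTwoPiI x ^ 8 = expTwoPiI ((8 * x : ℝ) : ℂ) := by
    rw [expTwoPiI, expTwoPiI, ← Complex.exp_nat_mul]
    congr 1
    push_cast
    ring
  rw [this, expTwoPiI_eq_one_iff]
  exact h

/-! ### Jacobi forms built from theta functions -/

theorem HasExpansion.pd_mul_psd {F G : siegelSpace 2 × (Fin 2 → ℂ) → ℂ}
    (hF : HasExpansion pdExponents F) (hG : HasExpansion (psdExponents : Set Exponent) G) :
    HasExpansion pdExponents fun p => F p * G p :=
  hF.mul hG fun _ hk _ hl => pd_add_psd hk hl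

/-- The Jacobi form `∑ θᵢ(Z, w)² θᵢ(Z, 0)⁶` of weight `4` and index `1`. -/
noncomputable def jacobiFour (p : siegelSpace 2 × (Fin 2 → ℂ)) : ℂ :=
  ∑ i, evenTheta i p * evenTheta i p * evenNull i p ^ 6

/-- The modular form `∑ θᵢ⁸` of weight `4`. -/
noncomputable def modularFour (p : siegelSpace 2 × (Fin 2 → ℂ)) : ℂ := ∑ i, evenNull i p ^ 8

/-- The product of the ten even theta constants, a cusp form of weight `5` with a character. -/
noncomputable def chiFive (p : siegelSpace 2 × (Fin 2 → ℂ)) : ℂ := ∏ i, evenNull i p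

/-- The polynomial `sexticSum` in the fourth powers of the theta constants, a cusp form
of weight `12`. -/
noncomputable def cuspTwelve (p : siegelSpace 2 × (Fin 2 → ℂ)) : ℂ :=
  sexticSum fun i => evenNull i p ^ 4

/-- The Vandermonde determinant of the eighth powers of the theta constants, a modular form of
weight `180` with the same character as `chiFive`. -/
noncomputable def thetaVandermonde (p : siegelSpace 2 × (Fin 2 → ℂ)) : ℂ :=
  (vandermonde fun i => evenNull i p ^ 8).det

theorem jacobiFour_jacobi : HasExpansion jacobiExponents jacobiFour :=
  HasExpansion.sum _ fun i _ => (evenTheta_sq_jacobi i).mul ((evenNull_psd i).pow 6)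
    fun _ hk _ hl => jacobi_add_psd hk hl

theorem modularFour_psd : HasExpansion (psdExponents : Set Exponent) modularFour :=
  HasExpansion.sum _ fun i _ => (evenNull_psd i).pow 8

theorem psd_mul {F G : siegelSpace 2 × (Fin 2 → ℂ) → ℂ}
    (hF : HasExpansion (psdExponents : Set Exponent) F)
    (hG : HasExpansion (psdExponents : Set Exponent) G) :
    HasExpansion (psdExponents : Set Exponent) fun p => F p * G p :=
  hF.mul hG fun _ hk _ hl => psdExponents.add_mem hk hl

theorem chiFive_pd : HasExpansion pdExponents chiFive := by
  have h := (evenNull_mul_pd (i := 4) (j := 6) (by decide)).pd_mul_psd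
    (HasExpansion.prod ({0, 1, 2, 3, 5, 7, 8, 9} : Finset (Fin 10)) fun i _ => evenNull_psd i)
  convert h using 1
  funext p
  rw [chiFive, ← Finset.prod_pair (f := fun i => evenNull i p) (by decide : (4 : Fin 10) ≠ 6),
    ← Finset.prod_union (by decide)]
  exact Finset.prod_congr (by decide) fun _ _ => rfl

theorem thetaVandermonde_psd : HasExpansion (psdExponents : Set Exponent) thetaVandermonde := by
  have h : HasExpansion (psdExponents : Set Exponent) fun p =>
      ∏ i : Fin 10, ∏ j ∈ Finset.Ioi i, (evenNull j p ^ 8 + -1 * evenNull i p ^ 8) :=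
    HasExpansion.prod _ fun i _ => HasExpansion.prod _ fun j _ =>
      ((evenNull_psd j).pow 8).add (((evenNull_psd i).pow 8).smul (-1))
  convert h using 1
  funext p
  simp only [thetaVandermonde, det_vandermonde, neg_one_mul, sub_eq_add_neg]

theorem sextic_pd (a b c f : Fin 10) {d e : Fin 10}
    (h : ¬ 2 ∣ charA₁ d * charA₂ e - charA₂ d * charA₁ e) :
    HasExpansion pdExponents fun p => evenNull a p ^ 4 * evenNull b p ^ 4 * evenNull c p ^ 4 *
      evenNull d p ^ 4 * evenNull e p ^ 4 * evenNull f p ^ 4 := by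
  have h1 := (evenNull_mul_pd h).pd_mul_psd (psd_mul (psd_mul (psd_mul ((evenNull_psd a).pow 4)
    ((evenNull_psd b).pow 4)) (psd_mul ((evenNull_psd c).pow 4) ((evenNull_psd f).pow 4)))
    (psd_mul ((evenNull_psd d).pow 3) ((evenNull_psd e).pow 3)))
  convert h1 using 1
  funext p
  ring

theorem cuspTwelve_pd : HasExpansion pdExponents cuspTwelve := by
  unfold cuspTwelve sexticSum
  repeat' apply HasExpansion.add
  all_goals exact sextic_pd _ _ _ _ (by decide)

section Laws

variable {M : Gam 2} {σ : Equiv.Perm (Fin 10)}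

theorem JacobiLaw.mul_fun {k k' m m' : ℕ} {f g : siegelSpace 2 × (Fin 2 → ℂ) → ℂ}
    (hf : JacobiLaw k m f M) (hg : JacobiLaw k' m' g M) :
    JacobiLaw (k + k') (m + m') (fun p => f p * g p) M := fun Z z => by
  simp only [hf Z z, hg Z z]
  rw [pow_add, Nat.cast_add, add_mul, expTwoPiI_add]
  ring

theorem JacobiLaw.pow_fun {k : ℕ} {f : siegelSpace 2 × (Fin 2 → ℂ) → ℂ}
    (hf : JacobiLaw k 0 f M) (i : ℕ) : JacobiLaw (i * k) 0 (fun p => f p ^ i) M := fun Z z => by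
  simp only [hf Z z, mul_pow, ← pow_mul]
  simp [expTwoPiI_zero, mul_comm i k]

theorem evenNull_eq (i : Fin 10) (Z : siegelSpace 2) (w : Fin 2 → ℂ) :
    evenNull i (Z, w) = evenTheta i (Z, 0) := rfl

theorem exp_eighth_pow (e : ℤ) : Complex.exp (Real.pi * I / 4 * e) ^ 8 = 1 := by
  rw [← Complex.exp_nat_mul, Complex.exp_eq_one_iff]
  exact ⟨e, by push_cast; ring⟩

theorem exp_eighth_pow_four (e : ℤ) :
    Complex.exp (Real.pi * I / 4 * e) ^ 4 = (-1) ^ e.natAbs := by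
  rw [← Complex.exp_nat_mul]
  have h : (((4 : ℕ) : ℂ) * (Real.pi * I / 4 * e)) = e * (Real.pi * I) := by push_cast; ring
  rw [h, Complex.exp_int_mul, Complex.exp_pi_mul_I]
  rcases Int.natAbs_eq e with he | he
  · conv_lhs => rw [he, zpow_natCast]
  · conv_lhs => rw [he, _root_.zpow_neg, zpow_natCast]
    rw [← inv_pow]
    norm_num

/-- The consequences of `ThetaLaw` in terms of both the theta functions and the theta constants. -/
theorem ThetaLaw.null (h : ThetaLaw M σ) :
    ∃ e : Fin 10 → ℤ, ∀ Z : siegelSpace 2, ∃ j : ℂ, j ^ 8 = (denom M Z).det ^ 4 ∧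
      j ^ 10 * Complex.exp (Real.pi * I / 4 * ((∑ i, e i : ℤ) : ℂ)) = -(denom M Z).det ^ 5 ∧
      (∀ x : Fin 10 → ℂ, sexticSum (fun i => (-1) ^ (e i).natAbs * x (σ i)) = sexticSum x) ∧
      (∀ w i, evenTheta i (act M Z, ((denom M Z)⁻¹)ᵀ *ᵥ w) =
        Complex.exp (Real.pi * I / 4 * e i) * j *
          Complex.exp (Real.pi * I * (w ⬝ᵥ ((denom M Z)⁻¹ * blockC M) *ᵥ w)) *
            evenTheta (σ i) (Z, w)) ∧
      ∀ w w' i, evenNull i (act M Z, w') =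
        Complex.exp (Real.pi * I / 4 * e i) * j * evenNull (σ i) (Z, w) := by
  obtain ⟨-, e, h⟩ := h
  refine ⟨e, fun Z => ?_⟩
  obtain ⟨j, h1, h2, h3, h4⟩ := h Z
  refine ⟨j, h1, h2, h3, h4, fun w w' i => ?_⟩
  have := h4 0 i
  simpa [evenNull_eq] using this

theorem expTwoPiI_nat_zero_mul (x : ℂ) : expTwoPiI (((0 : ℕ) : ℂ) * x) = 1 := by
  simp [expTwoPiI_zero]

theorem ThetaLaw.jacobiLaw_modularFour (h : ThetaLaw M σ) : JacobiLaw 4 0 modularFour M := fun Z z => by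
  obtain ⟨e, h⟩ := h.null
  obtain ⟨j, h1, -, -, -, h5⟩ := h Z
  simp only [modularFour, h5 z, mul_pow, exp_eighth_pow, h1, one_mul,
    expTwoPiI_nat_zero_mul, mul_one]
  rw [← Finset.mul_sum, Equiv.sum_comp σ fun i => evenNull i (Z, z) ^ 8]

theorem ThetaLaw.jacobiLaw_jacobiFour (h : ThetaLaw M σ) : JacobiLaw 4 1 jacobiFour M := fun Z z => by
  obtain ⟨e, h⟩ := h.null
  obtain ⟨j, h1, -, -, h4, h5⟩ := h Z
  simp only [jacobiFour, h4, h5 z]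
  set q := z ⬝ᵥ ((denom M Z)⁻¹ * blockC M) *ᵥ z
  have hq : Complex.exp (Real.pi * I * q) * Complex.exp (Real.pi * I * q) =
      expTwoPiI (((1 : ℕ) : ℂ) * q) := by
    rw [expTwoPiI, ← Complex.exp_add]
    congr 1
    push_cast
    ring
  rw [← hq, ← h1, ← Equiv.sum_comp σ fun i => evenTheta i (Z, z) * evenTheta i (Z, z) * evenNull i (Z, z) ^ 6,
    Finset.mul_sum]
  refine Finset.sum_congr rfl fun i _ => ?_
  linear_combination (j ^ 8 * Complex.exp (Real.pi * I * q) ^ 2 * evenTheta (σ i) (Z, z) ^ 2 *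
    evenNull (σ i) (Z, z) ^ 6) * exp_eighth_pow (e i)

theorem ThetaLaw.chiFive_act (h : ThetaLaw M σ) (Z : siegelSpace 2) (z w : Fin 2 → ℂ) :
    chiFive (act M Z, w) = -(denom M Z).det ^ 5 * chiFive (Z, z) := by
  obtain ⟨e, h⟩ := h.null
  obtain ⟨j, -, h2, -, -, h5⟩ := h Z
  simp only [chiFive, h5 z]
  rw [Finset.prod_mul_distrib, Finset.prod_mul_distrib, ← h2, ← Complex.exp_sum,
    Equiv.prod_comp σ fun i => evenNull i (Z, z), ← Finset.mul_sum]
  simp only [Finset.prod_const, Finset.card_univ, Fintype.card_fin]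
  push_cast
  ring

theorem ThetaLaw.thetaVandermonde_act (h : ThetaLaw M σ) (Z : siegelSpace 2) (z w : Fin 2 → ℂ) :
    thetaVandermonde (act M Z, w) = -(denom M Z).det ^ 180 * thetaVandermonde (Z, z) := by
  have hσ := h.1
  obtain ⟨e, h⟩ := h.null
  obtain ⟨j, h1, -, -, -, h5⟩ := h Z
  have hv : (vandermonde fun i => evenNull i (act M Z, w) ^ 8) = Matrix.of fun (i k : Fin 10) =>
      (j ^ 8) ^ (k : ℕ) * ((vandermonde fun i => evenNull i (Z, z) ^ 8).submatrix σ id) i k := by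
    ext i k
    simp only [vandermonde_apply, of_apply, submatrix_apply, id, h5 z, mul_pow, exp_eighth_pow,
      one_mul]
  have h45 : ∑ k : Fin 10, (k : ℕ) = 45 := by decide
  rw [thetaVandermonde, thetaVandermonde, hv, det_mul_row, det_permute,
    hσ, Finset.prod_pow_eq_pow_sum, h45, h1]
  push_cast
  ring

theorem ThetaLaw.jacobiLaw_cuspTwelve (h : ThetaLaw M σ) : JacobiLaw 12 0 cuspTwelve M := fun Z z => by
  obtain ⟨e, h⟩ := h.null
  obtain ⟨j, h1, -, h3, -, h5⟩ := h Z
  have hs : ∀ (c : ℂ) (x : Fin 10 → ℂ), sexticSum (fun i => c * x i) = c ^ 6 * sexticSum x :=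
    fun c x => by simp only [sexticSum]; ring
  have e1 : (fun i => evenNull i (act M Z, ((denom M Z)⁻¹)ᵀ *ᵥ z) ^ 4) =
      fun i => j ^ 4 * ((-1) ^ (e i).natAbs * evenNull (σ i) (Z, z) ^ 4) := by
    funext i
    rw [h5 z, mul_pow, mul_pow, exp_eighth_pow_four]
    ring
  rw [cuspTwelve, cuspTwelve, e1, hs,
    h3 fun i => evenNull i (Z, z) ^ 4, expTwoPiI_nat_zero_mul]
  linear_combination ((j ^ 8) ^ 2 + j ^ 8 * (denom M Z).det ^ 4 + (denom M Z).det ^ 8) *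
    sexticSum (fun i => evenNull i (Z, z) ^ 4) * h1

theorem ThetaLaw.jacobiLaw_chiFive_sq (h : ThetaLaw M σ) : JacobiLaw 10 0 (fun p => chiFive p ^ 2) M :=
  fun Z z => by
    simp only [h.chiFive_act Z z]
    rw [expTwoPiI_nat_zero_mul]
    ring

theorem ThetaLaw.jacobiLaw_chiFive_mul_thetaVandermonde (h : ThetaLaw M σ) :
    JacobiLaw 185 0 (fun p => chiFive p * thetaVandermonde p) M :=
  fun Z z => by
    simp only [h.chiFive_act Z z, h.thetaVandermonde_act Z z]
    rw [expTwoPiI_nat_zero_mul]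
    ring

end Laws

theorem evenTheta_sq_add_lattice (i : Fin 10) (l k : Fin 2 → ℤ) (Z : siegelSpace 2)
    (z : Fin 2 → ℂ) :
    evenTheta i (Z, z + mat Z *ᵥ (fun i => (l i : ℂ)) + fun i => (k i : ℂ)) ^ 2 =
      expTwoPiI (-((1 : ℕ) * ((fun i => (l i : ℂ)) ⬝ᵥ mat Z *ᵥ (fun i => (l i : ℂ)) +
        2 * ((fun i => (l i : ℂ)) ⬝ᵥ z)))) * evenTheta i (Z, z) ^ 2 := by
  have h := theta_add_lattice (charA₁ i) (charA₂ i) (charB₁ i) (charB₂ i) (mat Z 0 0) (mat Z 0 1)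
    (mat Z 1 1) (z 0) (z 1) (l 0) (l 1) (k 0) (k 1)
  have e0 : (z + mat Z *ᵥ (fun i => (l i : ℂ)) + fun i => (k i : ℂ)) 0 =
      z 0 + (mat Z 0 0 * l 0 + mat Z 0 1 * l 1) + k 0 := by
    simp [vecHead]
  have e1 : (z + mat Z *ᵥ (fun i => (l i : ℂ)) + fun i => (k i : ℂ)) 1 =
      z 1 + (mat Z 0 1 * l 0 + mat Z 1 1 * l 1) + k 1 := by
    simp [vecHead, vecTail, mat_one_zero]
  simp only [evenTheta]
  rw [e0, e1, h, mul_pow, ← Complex.exp_nat_mul, expTwoPiI]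
  congr 1
  refine exp_pi_mul_I_int_eq (charA₁ i * k 0 + charA₂ i * k 1 - charB₁ i * l 0 - charB₂ i * l 1)
    _ ?_
  simp [mulVec, dotProduct, Fin.sum_univ_two, mat_one_zero]
  ring

theorem jacobiFour_elliptic (l k : Fin 2 → ℤ) (Z : siegelSpace 2) (z : Fin 2 → ℂ) :
    jacobiFour (Z, z + mat Z *ᵥ (fun i => (l i : ℂ)) + fun i => (k i : ℂ)) =
      expTwoPiI (-((1 : ℕ) * ((fun i => (l i : ℂ)) ⬝ᵥ mat Z *ᵥ (fun i => (l i : ℂ)) +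
        2 * ((fun i => (l i : ℂ)) ⬝ᵥ z)))) * jacobiFour (Z, z) := by
  simp only [jacobiFour, ← sq, evenTheta_sq_add_lattice]
  rw [Finset.mul_sum]
  refine Finset.sum_congr rfl fun i _ => ?_
  rw [evenNull_eq, evenNull_eq]
  ring

/-- Invariance under the integral translations of `Z` and `z` makes the exponents half-integral. -/
theorem HasExpansion.integral {F : siegelSpace 2 × (Fin 2 → ℂ) → ℂ}
    (hF : HasExpansion jacobiCuspExponents F)
    (hZ : ∀ (S : Matrix (Fin 2) (Fin 2) ℤ) (hS : Sᵀ = S) (p : siegelSpace 2 × (Fin 2 → ℂ)),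
      F (act (translation S hS) p.1, p.2) = F p)
    (hz : ∀ (v : Fin 2 → ℤ) (p : siegelSpace 2 × (Fin 2 → ℂ)),
      F (p.1, p.2 + fun i => (v i : ℂ)) = F p) :
    HasExpansion integralCuspExponents F := by
  have stepZ : ∀ (S : Matrix (Fin 2) (Fin 2) ℤ) (_ : Sᵀ = S) {X : Set Exponent},
      X ⊆ fracExponents → HasExpansion X F → HasExpansion
        {k ∈ X | expTwoPiI ((k.1 0 0 * S 0 0 + (k.1 0 1 + k.1 1 0) * S 0 1 + k.1 1 1 * S 1 1 : ℝ) : ℂ)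
          = 1} F := fun S hS X hX hF => by
    refine hF.of_invariant (fun p => (act (translation S hS) p.1, p.2)) (hZ S hS) _
      (fun k hk => expTwoPiI_pow_eight ?_) fun k p => ?_
    · obtain ⟨-, h, -⟩ := hX hk
      obtain ⟨a, ha⟩ := h 0 0
      obtain ⟨b, hb⟩ := h 0 1
      obtain ⟨c, hc⟩ := h 1 0
      obtain ⟨d, hd⟩ := h 1 1
      refine ⟨a * S 0 0 + (b + c) * S 0 1 + d * S 1 1, ?_⟩
      push_cast
      rw [← ha, ← hb, ← hc, ← hd]
      ring
    · rw [character_eq, character_eq, mat_act_translation, ← expTwoPiI_add]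
      congr 1
      simp only [Matrix.add_apply, Matrix.map_apply]
      push_cast
      ring
  have stepz : ∀ (v : Fin 2 → ℤ) {X : Set Exponent},
      X ⊆ fracExponents → HasExpansion X F → HasExpansion
        {k ∈ X | expTwoPiI ((k.2 0 * v 0 + k.2 1 * v 1 : ℝ) : ℂ) = 1} F := fun v X hX hF => by
    refine hF.of_invariant (fun p => (p.1, p.2 + fun i => (v i : ℂ))) (hz v) _
      (fun k hk => expTwoPiI_pow_eight ?_) fun k p => ?_
    · obtain ⟨-, -, h⟩ := hX hk
      obtain ⟨a, ha⟩ := h 0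
      obtain ⟨b, hb⟩ := h 1
      refine ⟨a * v 0 + b * v 1, ?_⟩
      push_cast
      rw [← ha, ← hb]
      ring
    · rw [character_eq, character_eq, ← expTwoPiI_add]
      congr 1
      simp only [Pi.add_apply]
      push_cast
      ring
  have h0 : jacobiCuspExponents ⊆ (fracExponents : Set Exponent) := fun k hk => hk.1
  have h1 := stepZ !![1, 0; 0, 0] (by decide) h0 hF
  have h2 := stepZ !![0, 0; 0, 1] (by decide) (fun k hk => h0 hk.1) h1
  have h3 := stepZ !![0, 1; 1, 0] (by decide) (fun k hk => h0 hk.1.1) h2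
  have h4 := stepz ![1, 0] (fun k hk => h0 hk.1.1.1) h3
  have h5 := stepz ![0, 1] (fun k hk => h0 hk.1.1.1.1) h4
  refine h5.mono ?_
  rintro k ⟨⟨⟨⟨⟨hk, e1⟩, e2⟩, e3⟩, e4⟩, e5⟩
  rw [expTwoPiI_eq_one_iff] at e1 e2 e3 e4 e5
  simp at e1 e2 e3 e4 e5
  have hs : k.1 1 0 = k.1 0 1 := congrFun (congrFun hk.1.1 0) 1
  refine ⟨hk.1.1, fun i => ?_, fun i j => ?_, fun i => ?_, hk.2⟩
  · fin_cases i
    exacts [e1, e2]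
  · rw [hs] at e3
    have e1' : ∃ m : ℤ, 2 * k.1 0 0 = m := by
      obtain ⟨m, hm⟩ := e1
      exact ⟨2 * m, by rw [hm]; push_cast; rfl⟩
    have e2' : ∃ m : ℤ, 2 * k.1 1 1 = m := by
      obtain ⟨m, hm⟩ := e2
      exact ⟨2 * m, by rw [hm]; push_cast; rfl⟩
    fin_cases i <;> fin_cases j
    · exact e1'
    · simpa [two_mul] using e3
    · simpa [two_mul, hs] using e3
    · exact e2'
  · fin_cases i
    exacts [e4, e5]

/-- The product of a cusp form on `ℍ₂` with `jacobiFour` is a Jacobi cusp form of index `1`. The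
cusp form is given with an expansion in characters whose exponents need not be half-integral. -/
theorem mul_jacobiFour_mem {k : ℕ} {G : siegelSpace 2 × (Fin 2 → ℂ) → ℂ}
    (hG : HasExpansion pdExponents G) (hlaw : ∀ M ∈ generators, JacobiLaw k 0 G M)
    (hind : ∀ Z w, G (Z, w) = G (Z, 0)) :
    (fun p => G p * jacobiFour p) ∈ jacobiCuspForms 2 (k + 4) 1 := by
  have hmod : ∀ M, JacobiLaw (k + 4) 1 (fun p => G p * jacobiFour p) M := fun M => by
    refine JacobiLaw.of_closure (S := generators) (fun M hM => ?_)
      (closure_generators ▸ Subgroup.mem_top M)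
    obtain ⟨σ, hσ⟩ := thetaLaw_of_mem hM
    have := (hlaw M hM).mul_fun hσ.jacobiLaw_jacobiFour
    rwa [zero_add] at this
  have hell : ∀ (l k : Fin 2 → ℤ) (Z : siegelSpace 2) (z : Fin 2 → ℂ),
      G (Z, z + mat Z *ᵥ (fun i => (l i : ℂ)) + fun i => (k i : ℂ)) *
        jacobiFour (Z, z + mat Z *ᵥ (fun i => (l i : ℂ)) + fun i => (k i : ℂ)) =
      expTwoPiI (-((1 : ℕ) * ((fun i => (l i : ℂ)) ⬝ᵥ mat Z *ᵥ (fun i => (l i : ℂ)) +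
        2 * ((fun i => (l i : ℂ)) ⬝ᵥ z)))) * (G (Z, z) * jacobiFour (Z, z)) := fun l k Z z => by
    rw [jacobiFour_elliptic, hind Z (z + _ + _), hind Z z]
    ring
  have hexp : HasExpansion integralCuspExponents fun p => G p * jacobiFour p := by
    refine (hG.mul jacobiFour_jacobi fun _ hk _ hl => pd_add_jacobi hk hl).integral
      (fun S hS p => ?_) fun v p => ?_
    · have h := hmod (translation S hS) p.1 p.2
      rw [denom_translation, (block_translation S hS).2.2.1] at h
      simpa [expTwoPiI_zero] using h
    · have h := hell 0 v p.1 p.2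
      have e1 : (fun i => (((0 : Fin 2 → ℤ) i : ℤ) : ℂ)) = 0 := by ext i; simp
      have e2 : p.2 + mat p.1 *ᵥ (0 : Fin 2 → ℂ) = p.2 := by rw [mulVec_zero, add_zero]
      rw [e1, e2, zero_dotProduct, zero_dotProduct, mul_zero, add_zero, mul_zero, neg_zero,
        expTwoPiI_zero, one_mul] at h
      exact h
  exact ⟨hexp.exists_holomorphic, hmod, hell, hexp.cuspidal⟩

/-! ### Leading terms along rays to the cusp -/

/-- A ray of points of `ℍ₂` with constant real off-diagonal entry `s` and diagonal entries
`i y` and `i (k + 1) y` once `y ≥ 1`. -/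
noncomputable def ray (k : ℕ) (s y : ℝ) : siegelSpace 2 :=
  ⟨⟨!![I * (max 1 y : ℝ), s; s, I * ((k + 1) * max 1 y : ℝ)], by
    change _ = _
    ext i j; fin_cases i <;> fin_cases j <;> simp⟩, by
    rw [mem_siegelSpace_two_iff]
    have h : 0 < max 1 y := lt_max_of_lt_left one_pos
    have hI : ∀ x : ℝ, (I * (x : ℂ)).im = x := fun x => by simp
    simp only [of_apply, cons_val_zero, cons_val_one, Complex.ofReal_im, hI]
    exact ⟨h, by rw [sq, zero_mul]; positivity⟩⟩

theorem mat_ray (k : ℕ) (s : ℝ) {y : ℝ} (hy : 1 ≤ y) :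
    mat (ray k s y) = !![I * y, s; s, I * ((k + 1) * y)] := by
  change !![I * ((max 1 y : ℝ) : ℂ), (s : ℂ); (s : ℂ), I * (((k + 1) * max 1 y : ℝ) : ℂ)] = _
  rw [max_eq_right hy]
  push_cast
  rfl

/-- The order of decay of the `i`-th theta function along a ray, in units of `π / 4`. -/
def rayRate (k : ℕ) (i : Fin 10) : ℤ := charA₁ i + (k + 1) * charA₂ i

/-- The leading coefficient of the `i`-th theta function along a ray. -/
noncomputable def rayLead (i : Fin 10) (s : ℝ) (w : Fin 2 → ℝ) : ℂ :=
  ∑ n ∈ ({0, -charA₁ i} : Finset ℤ) ×ˢ ({0, -charA₂ i} : Finset ℤ),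
    Complex.exp (Real.pi * I / 2 * ((2 * n.1 + charA₁ i) * (2 * n.2 + charA₂ i) * s) +
      Real.pi * I * ((2 * n.1 + charA₁ i) * (w 0 + charB₁ i / 2) +
        (2 * n.2 + charA₂ i) * (w 1 + charB₂ i / 2)))

theorem charA_zero_or_one (i : Fin 10) :
    (charA₁ i = 0 ∨ charA₁ i = 1) ∧ (charA₂ i = 0 ∨ charA₂ i = 1) := by
  revert i; decide

theorem sq_sub_nonneg {a : ℤ} (ha : a = 0 ∨ a = 1) (n : ℤ) :
    0 ≤ (2 * n + a) ^ 2 - a ∧ ((2 * n + a) ^ 2 - a = 0 ↔ n = 0 ∨ n = -a) := by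
  have h : (2 * n + a) ^ 2 - a = 4 * (n * (n + a)) := by rcases ha with rfl | rfl <;> ring
  rw [h]
  constructor
  · rcases le_or_gt 0 n with hn | hn <;> rcases ha with rfl | rfl <;> nlinarith
  · rw [mul_eq_zero, mul_eq_zero, add_eq_zero_iff_eq_neg]
    simp

/-- The leading exponentials of a theta function are those with `(2 n + a)² = a`. -/
theorem tendsto_evenTheta (k : ℕ) (i : Fin 10) (s : ℝ) (w : Fin 2 → ℝ) :
    Tendsto (fun y : ℝ => evenTheta i (ray k s y, fun j => (w j : ℂ)) *
      ((Real.exp (Real.pi / 4 * rayRate k i * y) : ℝ) : ℂ)) atTop (𝓝 (rayLead i s w)) := by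
  obtain ⟨h1, h2⟩ := charA_zero_or_one i
  set d : ℤ × ℤ → ℂ := fun n =>
    Complex.exp (Real.pi * I / 2 * ((2 * n.1 + charA₁ i) * (2 * n.2 + charA₂ i) * s) +
      Real.pi * I * ((2 * n.1 + charA₁ i) * (w 0 + charB₁ i / 2) +
        (2 * n.2 + charA₂ i) * (w 1 + charB₂ i / 2))) with hd
  set lam : ℤ × ℤ → ℝ := fun n => Real.pi / 4 *
    (((2 * n.1 + charA₁ i) ^ 2 - charA₁ i + (k + 1) * ((2 * n.2 + charA₂ i) ^ 2 - charA₂ i) : ℤ) : ℝ)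
    with hlam
  have hpi := Real.pi_pos
  have hsum : ∀ y : ℝ, 1 ≤ y → HasSum (fun n => d n * ((Real.exp (-(lam n * y)) : ℝ) : ℂ))
      (evenTheta i (ray k s y, fun j => (w j : ℂ)) *
        ((Real.exp (Real.pi / 4 * rayRate k i * y) : ℝ) : ℂ)) := fun y hy => by
    have h := (summable_thetaTerm (charA₁ i) (charA₂ i) (charB₁ i) (charB₂ i) (w 0) (w 1)
      (im_pos (ray k s y)) (im_det_pos (ray k s y))).hasSum.mul_right
        ((Real.exp (Real.pi / 4 * rayRate k i * y) : ℝ) : ℂ)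
    refine Eq.mp (congrArg (fun g => HasSum g _) (funext fun n => ?_)) h
    rw [thetaTerm, mat_ray k s hy, Complex.ofReal_exp, Complex.ofReal_exp, ← Complex.exp_add, hd,
      ← Complex.exp_add]
    congr 1
    simp only [of_apply, cons_val_zero, cons_val_one, hlam, rayRate]
    push_cast
    linear_combination (Real.pi / 4 * ((2 * n.1 + charA₁ i) ^ 2 * y +
      (2 * n.2 + charA₂ i) ^ 2 * ((k + 1) * y)) : ℂ) * Complex.I_mul_I
  have hzero : ∀ n, lam n = 0 ↔ n ∈ ({0, -charA₁ i} : Finset ℤ) ×ˢ ({0, -charA₂ i} : Finset ℤ) :=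
    fun n => by
    have e1 := sq_sub_nonneg h1 n.1
    have e2 := sq_sub_nonneg h2 n.2
    have hk : (0 : ℤ) < k + 1 := by positivity
    simp only [hlam, Finset.mem_product, Finset.mem_insert, Finset.mem_singleton]
    rw [mul_eq_zero, or_iff_right (by positivity), Int.cast_eq_zero, ← e1.2, ← e2.2]
    constructor
    · intro h
      have := mul_nonneg hk.le e2.1
      refine ⟨by linarith [e1.1], ?_⟩
      exact (mul_eq_zero.1 (by linarith [e1.1] :
        ((k : ℤ) + 1) * ((2 * n.2 + charA₂ i) ^ 2 - charA₂ i) = 0)).resolve_left hk.ne'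
    · rintro ⟨a, b⟩
      rw [a, b]; simp
  have ht := tendsto_tsum_exp_neg (d := d) (lam := lam) (fun n _ => ?_) (hsum 1 le_rfl).summable
  · have hl : ∑' n, (if lam n = 0 then d n else 0) = rayLead i s w := by
      rw [tsum_eq_sum (s := ({0, -charA₁ i} : Finset ℤ) ×ˢ ({0, -charA₂ i} : Finset ℤ))]
      · exact Finset.sum_congr rfl fun n hn => if_pos ((hzero n).2 hn)
      · exact fun n hn => if_neg fun h => hn ((hzero n).1 h)
    rw [hl] at ht
    refine ht.congr' ?_
    filter_upwards [eventually_ge_atTop 1] with y hy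
    exact (hsum y hy).tsum_eq
  · have e1 := (sq_sub_nonneg h1 n.1).1
    have e2 := (sq_sub_nonneg h2 n.2).1
    have : (0 : ℤ) ≤ (2 * n.1 + charA₁ i) ^ 2 - charA₁ i +
      (k + 1) * ((2 * n.2 + charA₂ i) ^ 2 - charA₂ i) := by positivity
    have : (0 : ℝ) ≤ (((2 * n.1 + charA₁ i) ^ 2 - charA₁ i +
      (k + 1) * ((2 * n.2 + charA₂ i) ^ 2 - charA₂ i) : ℤ) : ℝ) := by exact_mod_cast this
    positivity

theorem tendsto_evenNull (k : ℕ) (i : Fin 10) (s : ℝ) (w : Fin 2 → ℂ) :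
    Tendsto (fun y : ℝ => evenNull i (ray k s y, w) *
      ((Real.exp (Real.pi / 4 * rayRate k i * y) : ℝ) : ℂ)) atTop (𝓝 (rayLead i s 0)) := by
  have h := tendsto_evenTheta k i s 0
  have e : (fun j => (((0 : Fin 2 → ℝ) j : ℝ) : ℂ)) = 0 := by ext j; simp
  rw [e] at h
  exact h

theorem rayLead_zero (s : ℝ) (w : Fin 2 → ℝ) : rayLead 0 s w = 1 ∧ rayLead 1 s w = 1 ∧
    rayLead 2 s w = 1 ∧ rayLead 3 s w = 1 := by
  refine ⟨?_, ?_, ?_, ?_⟩ <;> simp [rayLead, charA₁, charA₂]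

theorem rayLead_one (s : ℝ) : rayLead 4 s 0 = 2 ∧ rayLead 5 s 0 = 2 ∧
    rayLead 6 s 0 = 2 ∧ rayLead 7 s 0 = 2 := by
  refine ⟨?_, ?_, ?_, ?_⟩ <;>
    simp [rayLead, charA₁, charA₂, charB₁, charB₂] <;> norm_num

theorem rayLead_eight (s : ℝ) : rayLead 8 s 0 =
    2 * (Complex.exp (Real.pi * I / 2 * s) + Complex.exp (-(Real.pi * I / 2 * s))) := by
  simp [rayLead, charA₁, charA₂, charB₁, charB₂, Finset.sum_product]
  norm_num
  ring

theorem rayLead_nine (s : ℝ) : rayLead 9 s 0 =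
    2 * (Complex.exp (-(Real.pi * I / 2 * s)) - Complex.exp (Real.pi * I / 2 * s)) := by
  have h1 : Complex.exp (Real.pi * I) = -1 := Complex.exp_pi_mul_I
  have h2 : Complex.exp (-(Real.pi * I)) = -1 := by rw [Complex.exp_neg, h1]; norm_num
  simp [rayLead, charA₁, charA₂, charB₁, charB₂, Finset.sum_product]
  norm_num [Complex.exp_add, h1, h2]
  ring


theorem rayLead_at_zero : rayLead 8 0 0 = 4 ∧ rayLead 9 0 0 = 0 := by
  rw [rayLead_eight, rayLead_nine]
  constructor <;> norm_num

theorem rayLead_at_half : rayLead 8 (1 / 2 : ℝ) 0 ^ 2 = 8 ∧ rayLead 9 (1 / 2 : ℝ) 0 ^ 2 = -8 := by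
  rw [rayLead_eight, rayLead_nine, Complex.exp_neg]
  set a := Complex.exp (Real.pi * I / 2 * ((1 / 2 : ℝ) : ℂ)) with ha
  have h2 : a ^ 2 = I := by
    rw [ha, ← Complex.exp_nat_mul]
    refine Eq.trans ?_ Complex.exp_pi_div_two_mul_I
    congr 1
    push_cast
    ring
  have h0 : a ≠ 0 := Complex.exp_ne_zero _
  have h4 : (a⁻¹) ^ 2 = -I := by rw [inv_pow, h2, Complex.inv_I]
  constructor
  · linear_combination 4 * h2 + 4 * h4 + 8 * mul_inv_cancel₀ h0
  · linear_combination 4 * h2 + 4 * h4 - 8 * mul_inv_cancel₀ h0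

theorem rayRate_nonneg (k : ℕ) (i : Fin 10) : 0 ≤ rayRate k i := by
  have h : 0 ≤ charA₁ i ∧ 0 ≤ charA₂ i := by revert i; decide
  have := h.1
  have := h.2
  unfold rayRate
  positivity

theorem tendsto_exp_neg_rate {r : ℝ} (hr : 0 ≤ r) :
    Tendsto (fun y : ℝ => ((Real.exp (-(r * y)) : ℝ) : ℂ)) atTop (𝓝 (if r = 0 then 1 else 0)) := by
  split_ifs with h
  · simp [h]
  · have h1 : Tendsto (fun y : ℝ => Real.exp (-(r * y))) atTop (𝓝 0) :=
      Real.tendsto_exp_neg_atTop_nhds_zero.comp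
        (tendsto_id.const_mul_atTop (lt_of_le_of_ne hr (Ne.symm h)))
    have h2 := (Complex.continuous_ofReal.tendsto 0).comp h1
    rwa [Complex.ofReal_zero] at h2

theorem exp_mul_exp_neg (x : ℝ) : ((Real.exp x : ℝ) : ℂ) * ((Real.exp (-x) : ℝ) : ℂ) = 1 := by
  rw [← Complex.ofReal_mul, ← Real.exp_add, add_neg_cancel, Real.exp_zero, Complex.ofReal_one]

theorem tendsto_of_mul_exp {F : ℝ → ℂ} {r : ℝ} {L : ℂ} (hr : 0 ≤ r)
    (h : Tendsto (fun y : ℝ => F y * ((Real.exp (r * y) : ℝ) : ℂ)) atTop (𝓝 L)) :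
    Tendsto F atTop (𝓝 (if r = 0 then L else 0)) := by
  have h1 := h.mul (tendsto_exp_neg_rate hr)
  rw [mul_ite, mul_one, mul_zero] at h1
  refine h1.congr fun y => ?_
  rw [mul_assoc, exp_mul_exp_neg, mul_one]

theorem rate_eq_zero_iff (k : ℕ) (i : Fin 10) :
    Real.pi / 4 * rayRate k i = 0 ↔ charA₁ i = 0 ∧ charA₂ i = 0 := by
  have h : 0 ≤ charA₁ i ∧ 0 ≤ charA₂ i := by revert i; decide
  have hpi := Real.pi_pos
  rw [mul_eq_zero, or_iff_right (by positivity), Int.cast_eq_zero, rayRate]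
  have hk : (0 : ℤ) < k + 1 := by positivity
  have h1 := mul_nonneg hk.le h.2
  constructor
  · intro e
    exact ⟨by linarith [h.1], (mul_eq_zero.1 (by linarith [h.1] :
      ((k : ℤ) + 1) * charA₂ i = 0)).resolve_left hk.ne'⟩
  · rintro ⟨a, b⟩
    rw [a, b]; simp

theorem tendsto_evenTheta_ray (k : ℕ) (i : Fin 10) (s : ℝ) (w : Fin 2 → ℝ) :
    Tendsto (fun y : ℝ => evenTheta i (ray k s y, fun j => (w j : ℂ))) atTop
      (𝓝 (if charA₁ i = 0 ∧ charA₂ i = 0 then rayLead i s w else 0)) := by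
  have h := tendsto_of_mul_exp (mul_nonneg (by positivity)
    (Int.cast_nonneg (rayRate_nonneg k i))) (tendsto_evenTheta k i s w)
  simpa only [rate_eq_zero_iff] using h

theorem tendsto_evenNull_ray (k : ℕ) (i : Fin 10) (s : ℝ) (w : Fin 2 → ℂ) :
    Tendsto (fun y : ℝ => evenNull i (ray k s y, w)) atTop
      (𝓝 (if charA₁ i = 0 ∧ charA₂ i = 0 then rayLead i s 0 else 0)) := by
  have h := tendsto_of_mul_exp (mul_nonneg (by positivity)
    (Int.cast_nonneg (rayRate_nonneg k i))) (tendsto_evenNull k i s w)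
  simpa only [rate_eq_zero_iff] using h

theorem ite_rayLead (i : Fin 10) (s : ℝ) (w : Fin 2 → ℝ) :
    (if charA₁ i = 0 ∧ charA₂ i = 0 then rayLead i s w else 0) = if i < 4 then 1 else 0 := by
  obtain ⟨h0, h1, h2, h3⟩ := rayLead_zero s w
  fin_cases i
  · exact h0
  · exact h1
  · exact h2
  · exact h3
  all_goals exact (if_neg (by decide)).trans (if_neg (by decide)).symm

theorem sum_ite_lt_four : ∑ i : Fin 10, (if i < 4 then (1 : ℂ) else 0) = 4 := by
  have h : (Finset.univ.filter fun i : Fin 10 => i < 4).card = 4 := by decide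
  rw [Finset.sum_boole, h]
  norm_num

theorem tendsto_modularFour (k : ℕ) (s : ℝ) (w : Fin 2 → ℂ) :
    Tendsto (fun y : ℝ => modularFour (ray k s y, w)) atTop (𝓝 4) := by
  have h := tendsto_finsetSum Finset.univ fun i _ => (tendsto_evenNull_ray k i s w).pow 8
  simp only [ite_rayLead, ite_pow, one_pow, ne_eq, OfNat.ofNat_ne_zero, not_false_eq_true,
    zero_pow, sum_ite_lt_four] at h
  exact h

theorem tendsto_jacobiFour (k : ℕ) (s : ℝ) (w : Fin 2 → ℝ) :
    Tendsto (fun y : ℝ => jacobiFour (ray k s y, fun j => (w j : ℂ))) atTop (𝓝 4) := by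
  have h := tendsto_finsetSum Finset.univ fun i _ =>
    ((tendsto_evenTheta_ray k i s w).mul (tendsto_evenTheta_ray k i s w)).mul
      ((tendsto_evenNull_ray k i s fun j => (w j : ℂ)).pow 6)
  have e : ∀ i : Fin 10, ((if i < 4 then (1 : ℂ) else 0) * if i < 4 then (1 : ℂ) else 0) *
      (if i < 4 then (1 : ℂ) else 0) ^ 6 = if i < 4 then 1 else 0 := fun i => by
    split_ifs <;> norm_num
  simp only [ite_rayLead, e, sum_ite_lt_four] at h
  exact h

theorem tendsto_chiFive (k : ℕ) (s : ℝ) (w : Fin 2 → ℂ) :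
    Tendsto (fun y : ℝ => chiFive (ray k s y, w) *
      ((Real.exp (Real.pi / 4 * ((∑ i, rayRate k i : ℤ) : ℝ) * y) : ℝ) : ℂ)) atTop
      (𝓝 (∏ i, rayLead i s 0)) := by
  have h := tendsto_finsetProd Finset.univ fun i _ => tendsto_evenNull k i s w
  refine h.congr fun y => ?_
  rw [Finset.prod_mul_distrib, ← Complex.ofReal_prod, ← Real.exp_sum, chiFive]
  congr 3
  push_cast
  rw [Finset.mul_sum, Finset.sum_mul]

/-- The polynomial `sexticSum (xᵢ u ^ dᵢ) / u ^ 4`, for the orders `dᵢ` of decay of the theta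
functions along `ray 0`. -/
def sexticReduced (x : Fin 10 → ℂ) (u : ℂ) : ℂ :=
  x 0 * x 1 * x 2 * x 4 * x 6 * x 9 + x 0 * x 1 * x 2 * x 5 * x 7 * x 8 +
  x 0 * x 1 * x 3 * x 4 * x 7 * x 9 + x 0 * x 1 * x 3 * x 5 * x 6 * x 8 +
  x 0 * x 1 * x 4 * x 5 * x 8 * x 9 * u ^ 2 + x 0 * x 2 * x 3 * x 4 * x 7 * x 8 +
  x 0 * x 2 * x 3 * x 5 * x 6 * x 9 + x 0 * x 2 * x 6 * x 7 * x 8 * x 9 * u ^ 2 +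
  x 0 * x 3 * x 4 * x 5 * x 6 * x 7 + x 1 * x 2 * x 3 * x 4 * x 6 * x 8 +
  x 1 * x 2 * x 3 * x 5 * x 7 * x 9 + x 1 * x 2 * x 4 * x 5 * x 6 * x 7 +
  x 1 * x 3 * x 6 * x 7 * x 8 * x 9 * u ^ 2 + x 2 * x 3 * x 4 * x 5 * x 8 * x 9 * u ^ 2 +
  x 4 * x 5 * x 6 * x 7 * x 8 * x 9 * u ^ 4

theorem sexticSum_eq_reduced (x : Fin 10 → ℂ) (u : ℂ) :
    sexticSum (fun i => x i * u ^ (rayRate 0 i).toNat) = u ^ 4 * sexticReduced x u := by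
  have h : ∀ i, (rayRate 0 i).toNat = ![0, 0, 0, 0, 1, 1, 1, 1, 2, 2] i := by decide
  simp only [h, sexticSum, sexticReduced]
  simp
  ring

theorem continuous_sexticReduced :
    Continuous fun p : (Fin 10 → ℂ) × ℂ => sexticReduced p.1 p.2 := by
  unfold sexticReduced
  fun_prop

theorem tendsto_cuspTwelve (s : ℝ) (w : Fin 2 → ℂ) :
    Tendsto (fun y : ℝ => cuspTwelve (ray 0 s y, w) *
      ((Real.exp (4 * Real.pi * y) : ℝ) : ℂ)) atTop
      (𝓝 (sexticReduced (fun i => rayLead i s 0 ^ 4) 0)) := by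
  have h1 : Tendsto (fun y : ℝ => fun i => (evenNull i (ray 0 s y, w) *
      ((Real.exp (Real.pi / 4 * rayRate 0 i * y) : ℝ) : ℂ)) ^ 4) atTop
      (𝓝 fun i => rayLead i s 0 ^ 4) :=
    tendsto_pi_nhds.2 fun i => (tendsto_evenNull 0 i s w).pow 4
  have h2 := tendsto_exp_neg_rate Real.pi_pos.le
  rw [if_neg Real.pi_ne_zero] at h2
  have h3 := (continuous_sexticReduced.tendsto _).comp (h1.prodMk_nhds h2)
  refine h3.congr fun y => ?_
  simp only [Function.comp_apply]
  have hu : ((Real.exp (4 * Real.pi * y) : ℝ) : ℂ) * ((Real.exp (-(Real.pi * y)) : ℝ) : ℂ) ^ 4 = 1 := by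
    rw [← exp_mul_exp_neg (4 * Real.pi * y), ← Complex.ofReal_pow, ← Real.exp_nat_mul]
    congr 3
    push_cast
    ring
  have e : (fun i => evenNull i (ray 0 s y, w) ^ 4) = fun i => (evenNull i (ray 0 s y, w) *
      ((Real.exp (Real.pi / 4 * rayRate 0 i * y) : ℝ) : ℂ)) ^ 4 *
        ((Real.exp (-(Real.pi * y)) : ℝ) : ℂ) ^ (rayRate 0 i).toNat := by
    funext i
    have hr : ((rayRate 0 i).toNat : ℝ) = rayRate 0 i := by
      exact_mod_cast Int.toNat_of_nonneg (rayRate_nonneg 0 i)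
    have hx : ((Real.exp (Real.pi / 4 * rayRate 0 i * y) : ℝ) : ℂ) ^ 4 *
        ((Real.exp (-(Real.pi * y)) : ℝ) : ℂ) ^ (rayRate 0 i).toNat = 1 := by
      rw [← exp_mul_exp_neg (Real.pi * rayRate 0 i * y), ← Complex.ofReal_pow,
        ← Complex.ofReal_pow, ← Real.exp_nat_mul, ← Real.exp_nat_mul, hr]
      congr 3
      · push_cast
        ring
      · ring
    rw [mul_pow, mul_assoc, hx, mul_one]
  rw [cuspTwelve, e, sexticSum_eq_reduced]
  linear_combination (-sexticReduced (fun i => (evenNull i (ray 0 s y, w) *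
      ((Real.exp (Real.pi / 4 * rayRate 0 i * y) : ℝ) : ℂ)) ^ 4)
        ((Real.exp (-(Real.pi * y)) : ℝ) : ℂ)) * hu

theorem tendsto_chiFive_sq (s : ℝ) (w : Fin 2 → ℂ) :
    Tendsto (fun y : ℝ => chiFive (ray 0 s y, w) ^ 2 *
      ((Real.exp (4 * Real.pi * y) : ℝ) : ℂ)) atTop (𝓝 ((∏ i, rayLead i s 0) ^ 2)) := by
  refine ((tendsto_chiFive 0 s w).pow 2).congr fun y => ?_
  have h : ∑ i, rayRate 0 i = 8 := by decide
  rw [mul_pow, ← Complex.ofReal_pow, ← Real.exp_nat_mul, h]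
  congr 3
  push_cast
  ring

theorem rayLead_half_ne_zero (i : Fin 10) : rayLead i (1 / 2 : ℝ) 0 ≠ 0 := by
  obtain ⟨h0, h1, h2, h3⟩ := rayLead_zero (1 / 2 : ℝ) 0
  obtain ⟨h4, h5, h6, h7⟩ := rayLead_one (1 / 2 : ℝ)
  obtain ⟨h8, h9⟩ := rayLead_at_half
  fin_cases i
  exacts [h0 ▸ one_ne_zero, h1 ▸ one_ne_zero, h2 ▸ one_ne_zero, h3 ▸ one_ne_zero,
    h4 ▸ two_ne_zero, h5 ▸ two_ne_zero, h6 ▸ two_ne_zero, h7 ▸ two_ne_zero,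
    fun h => by norm_num [show rayLead 8 (1 / 2 : ℝ) 0 = 0 from h] at h8,
    fun h => by norm_num [show rayLead 9 (1 / 2 : ℝ) 0 = 0 from h] at h9]

/-- The leading coefficient of `chiFive ^ 2` depends on the off-diagonal entry. -/
theorem prod_rayLead_ne : (∏ i, rayLead i 0 0) ^ 2 ≠ (∏ i, rayLead i (1 / 2 : ℝ) 0) ^ 2 := by
  have h0 : ∏ i, rayLead i 0 0 = 0 := Finset.prod_eq_zero (Finset.mem_univ 9) rayLead_at_zero.2
  rw [h0, zero_pow two_ne_zero]
  exact (pow_ne_zero 2 (Finset.prod_ne_zero_iff.2 fun i _ => rayLead_half_ne_zero i)).symm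

/-- The leading coefficient of `cuspTwelve` depends on the off-diagonal entry. -/
theorem sexticReduced_rayLead_ne : sexticReduced (fun i => rayLead i 0 0 ^ 4) 0 ≠
    sexticReduced (fun i => rayLead i (1 / 2 : ℝ) 0 ^ 4) 0 := by
  have hv : ∀ s : ℝ, sexticReduced (fun i => rayLead i s 0 ^ 4) 0 =
      2 ^ 16 * 2 + 2 ^ 8 * 4 * ((rayLead 8 s 0 ^ 2) ^ 2 + (rayLead 9 s 0 ^ 2) ^ 2) := fun s => by
    obtain ⟨h0, h1, h2, h3⟩ := rayLead_zero s 0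
    obtain ⟨h4, h5, h6, h7⟩ := rayLead_one s
    simp only [sexticReduced, h0, h1, h2, h3, h4, h5, h6, h7]
    ring
  rw [hv, hv, rayLead_at_half.1, rayLead_at_half.2, rayLead_at_zero.1, rayLead_at_zero.2]
  norm_num

/-! ### Nonvanishing, and the two families of Jacobi cusp forms -/

theorem posDef_convex {P Q : Matrix (Fin 2) (Fin 2) ℝ} (hP : P.PosDef) (hQ : Q.PosDef) {a b : ℝ}
    (ha : 0 ≤ a) (hb : 0 ≤ b) (hab : a + b = 1) : (a • P + b • Q).PosDef := by
  rcases ha.eq_or_lt with rfl | ha'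
  · rw [zero_add] at hab
    simpa [hab] using hQ
  · exact (hP.smul ha').add_posSemidef (hQ.posSemidef.smul hb)

/-- The part of a complex line through two points of `ℍ₂` that lies in `ℍ₂`. -/
theorem isPreconnected_line (x₀ x : SymMat 2) :
    IsPreconnected {t : ℂ | x₀ + t • (x - x₀) ∈ siegelSpace 2} := by
  have h : Convex ℝ {t : ℂ | x₀ + t • (x - x₀) ∈ siegelSpace 2} := by
    intro t ht u hu a b ha hb hab
    have h1 := posDef_convex ht hu ha hb hab
    have e : (((x₀ + (a • t + b • u) • (x - x₀) : SymMat 2) : Matrix (Fin 2) (Fin 2) ℂ).map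
        Complex.im) = a • (((x₀ + t • (x - x₀) : SymMat 2) : Matrix (Fin 2) (Fin 2) ℂ).map
        Complex.im) + b • (((x₀ + u • (x - x₀) : SymMat 2) : Matrix (Fin 2) (Fin 2) ℂ).map
        Complex.im) := by
      have ha' : a = 1 - b := by linarith
      subst ha'
      ext i j
      simp
      ring
    change (((x₀ + (a • t + b • u) • (x - x₀) : SymMat 2) : Matrix (Fin 2) (Fin 2) ℂ).map
        Complex.im).PosDef
    rw [e]
    exact h1
  exact h.isPreconnected

/-- The identity theorem on `ℍ₂`, by restriction to complex lines. -/
theorem eq_zero_of_eventually_eq_zero {G : SymMat 2 → ℂ} (hG : DifferentiableOn ℂ G (siegelSpace 2))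
    {x₀ : SymMat 2} (hx₀ : x₀ ∈ siegelSpace 2) (h : ∀ᶠ x in 𝓝 x₀, G x = 0) {x : SymMat 2}
    (hx : x ∈ siegelSpace 2) : G x = 0 := by
  set φ : ℂ → SymMat 2 := fun t => x₀ + t • (x - x₀) with hφ
  have hφd : Differentiable ℂ φ := by
    rw [hφ]; fun_prop
  have hopen : IsOpen (φ ⁻¹' siegelSpace 2) := isOpen_siegelSpace_two.preimage hφd.continuous
  have han : AnalyticOnNhd ℂ (G ∘ φ) (φ ⁻¹' siegelSpace 2) :=
    (hG.comp hφd.differentiableOn fun t ht => ht).analyticOnNhd hopen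
  have h0 : φ 0 = x₀ := by simp [hφ]
  have h1 : φ 1 = x := by simp [hφ]
  have hz : G ∘ φ =ᶠ[𝓝 0] 0 := by
    have hc := hφd.continuous.tendsto 0
    rw [h0] at hc
    exact hc.eventually h
  have := han.eqOn_zero_of_preconnected_of_eventuallyEq_zero (isPreconnected_line x₀ x)
    (by change φ 0 ∈ siegelSpace 2; rwa [h0]) hz (x := 1) (by change φ 1 ∈ siegelSpace 2; rwa [h1])
  simpa [h1] using this

theorem HasExpansion.exists_mul_ne_zero {S S' : Set Exponent}
    {F G : siegelSpace 2 × (Fin 2 → ℂ) → ℂ} (hF : HasExpansion S F) (hG : HasExpansion S' G)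
    (hF0 : ∃ Z, F (Z, 0) ≠ 0) (hG0 : ∃ Z, G (Z, 0) ≠ 0) : ∃ Z, F (Z, 0) * G (Z, 0) ≠ 0 := by
  by_contra! hcon
  obtain ⟨f, hf, ef⟩ := hF.exists_holomorphic
  obtain ⟨g, hg, eg⟩ := hG.exists_holomorphic
  obtain ⟨Z, hZ⟩ := hF0
  obtain ⟨W, hW⟩ := hG0
  have hres : ∀ {f : SymMat 2 × (Fin 2 → ℂ) → ℂ},
      DifferentiableOn ℂ f (siegelSpace 2 ×ˢ Set.univ) →
      DifferentiableOn ℂ (fun x : SymMat 2 => f (x, 0)) (siegelSpace 2) := fun hf =>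
    hf.comp (by fun_prop) fun x hx => ⟨hx, trivial⟩
  refine hW ?_
  rw [← eg]
  refine eq_zero_of_eventually_eq_zero (hres hg) Z.2 ?_ W.2
  have hnhds := isOpen_siegelSpace_two.mem_nhds Z.2
  have hc := ((hres hf).differentiableAt hnhds).continuousAt
  have hne : f (Z.1, 0) ≠ 0 := by rwa [ef]
  filter_upwards [hc.eventually_ne hne, hnhds] with x hx hxU
  have h1 := hcon ⟨x, hxU⟩
  rw [← ef, ← eg] at h1
  exact (mul_eq_zero.1 h1).resolve_left hx

theorem exists_prod_ne_zero {κ : Type*} (s : Finset κ) {S : AddSubmonoid Exponent}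
    {f : κ → siegelSpace 2 × (Fin 2 → ℂ) → ℂ}
    (h : ∀ i ∈ s, HasExpansion (S : Set Exponent) (f i))
    (h0 : ∀ i ∈ s, ∃ Z, f i (Z, 0) ≠ 0) : ∃ Z, ∏ i ∈ s, f i (Z, 0) ≠ 0 := by
  classical
  induction s using Finset.induction_on with
  | empty => exact ⟨ray 0 0 1, by simp⟩
  | insert i s hi ih =>
    simp only [Finset.prod_insert hi]
    exact (h i (Finset.mem_insert_self i s)).exists_mul_ne_zero
      (HasExpansion.prod s fun j hj => h j (Finset.mem_insert_of_mem hj))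
      (h0 i (Finset.mem_insert_self i s)) (ih (fun j hj => h j (Finset.mem_insert_of_mem hj))
        fun j hj => h0 j (Finset.mem_insert_of_mem hj))

theorem exists_evenNull_pow_ne_of_rate {i i' : Fin 10} (h : rayRate 2 i < rayRate 2 i') :
    ∃ Z, evenNull i (Z, 0) ^ 8 ≠ evenNull i' (Z, 0) ^ 8 := by
  by_contra! hcon
  have h1 := (tendsto_evenNull 2 i (1 / 2) 0).pow 8
  have h2 := (tendsto_evenNull 2 i' (1 / 2) 0).pow 8
  have hr : (0 : ℝ) < rayRate 2 i' - rayRate 2 i := by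
    rw [sub_pos]
    exact_mod_cast h
  have hpos : 0 < 2 * Real.pi * (rayRate 2 i' - rayRate 2 i) := by
    have := Real.pi_pos
    positivity
  have h3 := h2.mul (tendsto_exp_neg_rate hpos.le)
  rw [if_neg hpos.ne', mul_zero] at h3
  refine pow_ne_zero 8 (rayLead_half_ne_zero i) (tendsto_nhds_unique (h1.congr fun y => ?_) h3)
  rw [mul_pow, mul_pow, hcon, mul_assoc (evenNull i' _ ^ 8), ← Complex.ofReal_pow, ← Complex.ofReal_pow,
    ← Real.exp_nat_mul, ← Real.exp_nat_mul, ← Complex.ofReal_mul, ← Real.exp_add]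
  congr 3
  push_cast
  ring

theorem ThetaLaw.evenNull_pow_eq {M : Gam 2} {σ : Equiv.Perm (Fin 10)} (h : ThetaLaw M σ)
    {i i' : Fin 10} (he : ∀ Z, evenNull i (Z, 0) ^ 8 = evenNull i' (Z, 0) ^ 8) (Z : siegelSpace 2) :
    evenNull (σ i) (Z, 0) ^ 8 = evenNull (σ i') (Z, 0) ^ 8 := by
  obtain ⟨e, h⟩ := h.null
  obtain ⟨j, h1, -, -, -, h5⟩ := h Z
  have hj : j ^ 8 ≠ 0 := h1 ▸ pow_ne_zero 4 (denom_det_ne_zero M Z)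
  have := he (act M Z)
  rw [h5 0, h5 0] at this
  simp only [mul_pow, exp_eighth_pow, one_mul] at this
  exact mul_left_cancel₀ hj this

/-- The eighth powers of the theta constants are distinct: up to modular substitutions, any two
of them have different orders of decay along a ray. -/
theorem exists_evenNull_pow_ne {i i' : Fin 10} (h : i ≠ i') :
    ∃ Z, evenNull i (Z, 0) ^ 8 ≠ evenNull i' (Z, 0) ^ 8 := by
  have key : ∀ {a b : Fin 10}, rayRate 2 a ≠ rayRate 2 b →
      ∃ Z, evenNull a (Z, 0) ^ 8 ≠ evenNull b (Z, 0) ^ 8 := fun {a b} hab => by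
    rcases lt_or_gt_of_ne hab with h | h
    · exact exists_evenNull_pow_ne_of_rate h
    · obtain ⟨Z, hZ⟩ := exists_evenNull_pow_ne_of_rate h
      exact ⟨Z, hZ.symm⟩
  by_contra! hcon
  have hJ := thetaLaw_genJ.evenNull_pow_eq hcon
  have hW := thetaLaw_genJ.evenNull_pow_eq (thetaLaw_genW.evenNull_pow_eq hcon)
  have key' : ∀ {a b : Fin 10}, (∀ Z, evenNull a (Z, 0) ^ 8 = evenNull b (Z, 0) ^ 8) →
      ¬ rayRate 2 a ≠ rayRate 2 b := fun h hab => by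
    obtain ⟨Z, hZ⟩ := key hab
    exact hZ (h Z)
  have n1 := key' hcon
  have n2 := key' hJ
  have n3 := key' hW
  clear hJ hW hcon key key'
  revert i i'
  decide

theorem exists_thetaVandermonde_ne_zero : ∃ Z, thetaVandermonde (Z, 0) ≠ 0 := by
  have h1 : ∀ i j : Fin 10, HasExpansion (psdExponents : Set Exponent) fun p =>
      evenNull j p ^ 8 + -1 * evenNull i p ^ 8 := fun i j =>
    ((evenNull_psd j).pow 8).add (((evenNull_psd i).pow 8).smul (-1))
  have h := exists_prod_ne_zero (S := psdExponents) (Finset.univ : Finset (Fin 10))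
    (f := fun i p => ∏ j ∈ Finset.Ioi i, (evenNull j p ^ 8 + -1 * evenNull i p ^ 8))
    (fun i _ => HasExpansion.prod _ fun j _ => h1 i j)
    fun i _ => exists_prod_ne_zero (S := psdExponents) _ (fun j _ => h1 i j) fun j hj => by
      obtain ⟨Z, hZ⟩ := exists_evenNull_pow_ne (Finset.mem_Ioi.1 hj).ne'
      exact ⟨Z, by rwa [neg_one_mul, ← sub_eq_add_neg, sub_ne_zero]⟩
  obtain ⟨Z, hZ⟩ := h
  refine ⟨Z, ?_⟩
  rw [thetaVandermonde, det_vandermonde]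
  simpa only [neg_one_mul, ← sub_eq_add_neg] using hZ

theorem exists_ne_zero_of_tendsto {F : siegelSpace 2 × (Fin 2 → ℂ) → ℂ} {s : ℝ} {E : ℝ → ℂ} {L : ℂ}
    (h : Tendsto (fun y => F (ray 2 s y, 0) * E y) atTop (𝓝 L)) (hL : L ≠ 0) :
    ∃ Z, F (Z, 0) ≠ 0 := by
  by_contra! hcon
  simp only [hcon, zero_mul] at h
  exact hL (tendsto_nhds_unique h tendsto_const_nhds)

theorem exists_chiFive_ne_zero : ∃ Z, chiFive (Z, 0) ≠ 0 :=
  exists_ne_zero_of_tendsto (tendsto_chiFive 2 (1 / 2) 0)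
    (Finset.prod_ne_zero_iff.2 fun i _ => rayLead_half_ne_zero i)

theorem exists_modularFour_ne_zero : ∃ Z, modularFour (Z, 0) ≠ 0 := by
  refine exists_ne_zero_of_tendsto (s := 0) (E := fun _ => 1) (L := 4) ?_ (by norm_num)
  simpa using tendsto_modularFour 2 0 0

theorem exists_jacobiFour_ne_zero : ∃ Z, jacobiFour (Z, 0) ≠ 0 := by
  refine exists_ne_zero_of_tendsto (s := 0) (E := fun _ => 1) (L := 4) ?_ (by norm_num)
  have h := tendsto_jacobiFour 2 0 0
  have e : (fun j => (((0 : Fin 2 → ℝ) j : ℝ) : ℂ)) = 0 := by ext j; simp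
  rw [e] at h
  simpa using h

/-- Nonzero Jacobi cusp forms of odd weight. -/
theorem exists_jacobiCuspForm_ne_zero (i j : ℕ) :
    ∃ f ∈ jacobiCuspForms 2 (189 + 10 * j + 4 * i) 1, f ≠ 0 := by
  set G : siegelSpace 2 × (Fin 2 → ℂ) → ℂ := fun p =>
    chiFive p * (thetaVandermonde p * ((chiFive p ^ 2) ^ j * modularFour p ^ i)) with hG
  have hchi : HasExpansion (psdExponents : Set Exponent) chiFive :=
    HasExpansion.prod _ fun i _ => evenNull_psd i
  have hpow := (hchi.pow 2).pow j
  have h4 := modularFour_psd.pow i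
  have hV := psd_mul thetaVandermonde_psd (psd_mul hpow h4)
  have hexp : HasExpansion pdExponents G := chiFive_pd.pd_mul_psd hV
  have hlaw : ∀ M ∈ generators, JacobiLaw (185 + 10 * j + 4 * i) 0 G M := fun M hM => by
    obtain ⟨σ, hσ⟩ := thetaLaw_of_mem hM
    have h := (hσ.jacobiLaw_chiFive_mul_thetaVandermonde.mul_fun
      (hσ.jacobiLaw_chiFive_sq.pow_fun j)).mul_fun (hσ.jacobiLaw_modularFour.pow_fun i)
    rw [mul_comm j, mul_comm i] at h
    convert h using 1
    funext p
    rw [hG]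
    ring
  have hmem := mul_jacobiFour_mem hexp hlaw fun Z w => rfl
  rw [show 185 + 10 * j + 4 * i + 4 = 189 + 10 * j + 4 * i by ring] at hmem
  refine ⟨_, hmem, fun h0 => ?_⟩
  have pow_ne : ∀ {F : siegelSpace 2 × (Fin 2 → ℂ) → ℂ} (n : ℕ),
      HasExpansion (psdExponents : Set Exponent) F → (∃ Z, F (Z, 0) ≠ 0) →
      ∃ Z, F (Z, 0) ^ n ≠ 0 := fun n _ h => by
    obtain ⟨Z, hZ⟩ := h
    exact ⟨Z, pow_ne_zero n hZ⟩
  obtain ⟨Z, hZ⟩ := hexp.exists_mul_ne_zero jacobiFour_jacobi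
    (hchi.exists_mul_ne_zero hV exists_chiFive_ne_zero
      (thetaVandermonde_psd.exists_mul_ne_zero (psd_mul hpow h4) exists_thetaVandermonde_ne_zero
        (hpow.exists_mul_ne_zero h4
          (pow_ne j (hchi.pow 2) (pow_ne 2 hchi exists_chiFive_ne_zero))
          (pow_ne i modularFour_psd exists_modularFour_ne_zero))))
    exists_jacobiFour_ne_zero
  exact hZ (congrFun h0 (Z, 0))

theorem exists_asymmetric_aux {k : ℕ} {g : siegelSpace 2 × (Fin 2 → ℂ) → ℂ} {c : ℝ → ℂ}
    (hg : HasExpansion pdExponents g) (hlaw : ∀ M ∈ generators, JacobiLaw k 0 g M)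
    (hind : ∀ Z w, g (Z, w) = g (Z, 0)) (hc : c 0 ≠ c (1 / 2))
    (ht : ∀ (s : ℝ) (w : Fin 2 → ℂ), Tendsto (fun y : ℝ => g (ray 0 s y, w) *
      ((Real.exp (4 * Real.pi * y) : ℝ) : ℂ)) atTop (𝓝 (c s))) (i : ℕ) :
    ∃ f ∈ jacobiCuspForms 2 (k + 4 * i + 4) 1, ∃ c : ℝ → ℂ, c 0 ≠ c (1 / 2) ∧
      ∀ (s : ℝ) (w : Fin 2 → ℝ), Tendsto (fun y : ℝ => f (ray 0 s y, fun j => (w j : ℂ)) *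
        ((Real.exp (4 * Real.pi * y) : ℝ) : ℂ)) atTop (𝓝 (c s)) := by
  have hmem := mul_jacobiFour_mem (k := k + 4 * i) (hg.pd_mul_psd (modularFour_psd.pow i))
    (fun M hM => ?_) fun Z w => by rw [hind]; rfl
  · refine ⟨_, hmem, fun s => c s * 4 ^ i * 4, fun h => hc ?_, fun s w => ?_⟩
    · simpa using h
    · refine (((ht s fun j => (w j : ℂ)).mul ((tendsto_modularFour 0 s fun j => (w j : ℂ)).pow i)).mul
        (tendsto_jacobiFour 0 s w)).congr fun y => ?_
      ring
  · obtain ⟨σ, hσ⟩ := thetaLaw_of_mem hM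
    have h := (hlaw M hM).mul_fun (hσ.jacobiLaw_modularFour.pow_fun i)
    rwa [mul_comm i] at h

/-- A Jacobi cusp form of index `1` whose leading coefficient along the rays depends on the
off-diagonal entry of `Z` but not on `w`. -/
theorem exists_asymmetric {r : ℕ} (hr : Even r) (hr' : 16 ≤ r) :
    ∃ f ∈ jacobiCuspForms 2 r 1, ∃ c : ℝ → ℂ, c 0 ≠ c (1 / 2) ∧
      ∀ (s : ℝ) (w : Fin 2 → ℝ), Tendsto (fun y : ℝ => f (ray 0 s y, fun j => (w j : ℂ)) *
        ((Real.exp (4 * Real.pi * y) : ℝ) : ℂ)) atTop (𝓝 (c s)) := by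
  have hlaw : ∀ M ∈ generators, JacobiLaw 10 0 (fun p => chiFive p ^ 2) M ∧
      JacobiLaw 12 0 cuspTwelve M := fun M hM => by
    obtain ⟨σ, hσ⟩ := thetaLaw_of_mem hM
    exact ⟨hσ.jacobiLaw_chiFive_sq, hσ.jacobiLaw_cuspTwelve⟩
  have hchi : HasExpansion pdExponents fun p => chiFive p ^ 2 := by
    have h := chiFive_pd.pd_mul_psd (HasExpansion.prod Finset.univ fun i _ => evenNull_psd i)
    simp only [sq]
    exact h
  obtain ⟨m, rfl⟩ := hr
  rcases Nat.even_or_odd' m with ⟨l, rfl | rfl⟩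
  · have h := exists_asymmetric_aux cuspTwelve_pd (fun M hM => (hlaw M hM).2) (fun Z w => rfl)
      sexticReduced_rayLead_ne tendsto_cuspTwelve (l - 4)
    rwa [show 12 + 4 * (l - 4) + 4 = 2 * l + 2 * l by lia] at h
  · have h := exists_asymmetric_aux hchi (fun M hM => (hlaw M hM).1) (fun Z w => rfl)
      prod_rayLead_ne tendsto_chiFive_sq (l - 3)
    rwa [show 10 + 4 * (l - 3) + 4 = 2 * l + 1 + (2 * l + 1) by lia] at h

/-! ### Points of `ℍ₃` above `ℍ₂ × ℂ²`, and the laws of the Fourier-Jacobi coefficients -/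

section Glue

variable {R : Type*}

/-- The block matrix `(X, u; vᵗ, x)` of size `3`. -/
def glueMat (X : Matrix (Fin 2) (Fin 2) R) (u v : Fin 2 → R) (x : R) : Matrix (Fin 3) (Fin 3) R :=
  !![X 0 0, X 0 1, u 0; X 1 0, X 1 1, u 1; v 0, v 1, x]

theorem glueMat_mul [CommRing R] (X X' : Matrix (Fin 2) (Fin 2) R) (u v u' v' : Fin 2 → R)
    (x x' : R) : glueMat X u v x * glueMat X' u' v' x' =
      glueMat (X * X' + vecMulVec u v') (X *ᵥ u' + x' • u) (v ᵥ* X' + x • v')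
        (v ⬝ᵥ u' + x * x') := by
  ext i j
  fin_cases i <;> fin_cases j <;>
    simp [glueMat, Matrix.mul_apply, Fin.sum_univ_succ, vecMulVec_apply, vecMul, dotProduct] <;> ring

theorem glueMat_add [CommRing R] (X X' : Matrix (Fin 2) (Fin 2) R) (u v u' v' : Fin 2 → R)
    (x x' : R) : glueMat X u v x + glueMat X' u' v' x' =
      glueMat (X + X') (u + u') (v + v') (x + x') := by
  ext i j
  fin_cases i <;> fin_cases j <;> simp [glueMat]

theorem glueMat_transpose (X : Matrix (Fin 2) (Fin 2) R) (u v : Fin 2 → R) (x : R) :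
    (glueMat X u v x)ᵀ = glueMat Xᵀ v u x := by
  ext i j
  fin_cases i <;> fin_cases j <;> rfl

theorem glueMat_map {R' : Type*} (f : R → R') (X : Matrix (Fin 2) (Fin 2) R) (u v : Fin 2 → R)
    (x : R) : (glueMat X u v x).map f =
      glueMat (X.map f) (fun i => f (u i)) (fun i => f (v i)) (f x) := by
  ext i j
  fin_cases i <;> fin_cases j <;> rfl

theorem glueMat_one [CommRing R] : glueMat (1 : Matrix (Fin 2) (Fin 2) R) 0 0 1 = 1 := by
  ext i j
  fin_cases i <;> fin_cases j <;> simp [glueMat]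

theorem det_glueMat [CommRing R] (X : Matrix (Fin 2) (Fin 2) R) (u : Fin 2 → R) :
    (glueMat X u 0 1).det = X.det := by
  rw [det_fin_three, det_fin_two]
  simp [glueMat]

end Glue

theorem mat_eq_glueMat (W : siegelSpace 3) :
    mat W = glueMat (mat (hatBlock W)) (hatVec W) (hatVec W) (lastEntry W) := by
  have hs : ∀ i j, mat W i j = mat W j i := fun i j => congrFun (congrFun (mat_isSymm W) j) i
  ext i j
  fin_cases i <;> fin_cases j <;>
    first
      | rfl
      | exact hs _ _

theorem hat_eq_of_mat_eq {W : siegelSpace 3} {Z : siegelSpace 2} {z : Fin 2 → ℂ} {τ : ℂ}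
    (h : mat W = glueMat (mat Z) z z τ) : hatBlock W = Z ∧ hatVec W = z ∧ lastEntry W = τ := by
  refine ⟨?_, ?_, ?_⟩
  · apply Subtype.ext
    apply Subtype.ext
    change (mat W).submatrix Fin.castSucc Fin.castSucc = mat Z
    rw [h]
    ext i j
    fin_cases i <;> fin_cases j <;> rfl
  · ext i
    change mat W i.castSucc (Fin.last 2) = z i
    rw [h]
    fin_cases i <;> rfl
  · change mat W (Fin.last 2) (Fin.last 2) = τ
    rw [h]
    rfl

/-- Every point of `ℍ₂ × ℂ²` is the upper right part of points of `ℍ₃`, whose last entry may be any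
complex number with sufficiently large imaginary part. -/
theorem exists_glue (Z : siegelSpace 2) (z : Fin 2 → ℂ) :
    ∃ y₀ : ℝ, ∀ τ : ℂ, y₀ < τ.im → ∃ W : siegelSpace 3, mat W = glueMat (mat Z) z z τ := by
  obtain ⟨c, hc, hb⟩ := quadratic_lower_bound (im_pos Z) (im_det_pos Z)
  refine ⟨((z 0).im ^ 2 + (z 1).im ^ 2) / c, fun τ hτ => ?_⟩
  rw [div_lt_iff₀ hc] at hτ
  refine ⟨mk (glueMat (mat Z) z z τ) ?_ ?_, rfl⟩
  · change _ = _
    rw [glueMat_transpose, mat_isSymm]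
  · rw [glueMat_map, posDef_iff_dotProduct_mulVec]
    refine ⟨?_, fun x hx => ?_⟩
    · ext i j
      fin_cases i <;> fin_cases j <;> simp [glueMat, mat_one_zero]
    · have h1 := hb (x 0) (x 1)
      have e : star x ⬝ᵥ (glueMat ((mat Z).map Complex.im) (fun i => (z i).im) (fun i => (z i).im)
          τ.im) *ᵥ x = (x 0 ^ 2 * (mat Z 0 0).im + 2 * (x 0 * x 1) * (mat Z 0 1).im +
          x 1 ^ 2 * (mat Z 1 1).im) + 2 * x 2 * (x 0 * (z 0).im + x 1 * (z 1).im) +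
          x 2 ^ 2 * τ.im := by
        simp [glueMat, mulVec, dotProduct, Fin.sum_univ_succ, mat_one_zero]
        ring
      rw [e]
      have key : 0 < c * (c * (x 0 ^ 2 + x 1 ^ 2) + 2 * x 2 * (x 0 * (z 0).im + x 1 * (z 1).im) +
          x 2 ^ 2 * τ.im) := by
        have e2 : c * (c * (x 0 ^ 2 + x 1 ^ 2) + 2 * x 2 * (x 0 * (z 0).im + x 1 * (z 1).im) +
            x 2 ^ 2 * τ.im) = (c * x 0 + x 2 * (z 0).im) ^ 2 + (c * x 1 + x 2 * (z 1).im) ^ 2 +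
            x 2 ^ 2 * (τ.im * c - ((z 0).im ^ 2 + (z 1).im ^ 2)) := by ring
        rw [e2]
        by_cases h2 : x 2 = 0
        · have h01 : x 0 ≠ 0 ∨ x 1 ≠ 0 := by
            by_contra! hcon
            apply hx
            ext i
            fin_cases i
            exacts [hcon.1, hcon.2, h2]
          rw [h2]
          simp only [zero_mul, add_zero, ne_eq, OfNat.ofNat_ne_zero, not_false_eq_true, zero_pow]
          rcases h01 with h | h
          · positivity
          · positivity
        · have h3 : 0 < τ.im * c - ((z 0).im ^ 2 + (z 1).im ^ 2) := by linarith
          positivity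
      have := pos_of_mul_pos_right key hc.le
      linarith

/-- The Fourier-Jacobi coefficients at `(Z, z)` are determined by the values at the points of `ℍ₃`
above `(Z, z)`. -/
theorem IsFourierJacobiExpansion.coeff_eq {F : siegelSpace 3 → ℂ}
    {Φ : ℕ → siegelSpace 2 × (Fin 2 → ℂ) → ℂ} (hΦ : IsFourierJacobiExpansion F Φ)
    {Z : siegelSpace 2} {z : Fin 2 → ℂ} {α : ℕ → ℂ}
    (h : ∀ W : siegelSpace 3, hatBlock W = Z → hatVec W = z →
      HasSum (fun m : ℕ => α m * expTwoPiI (m * lastEntry W)) (F W)) (m : ℕ) :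
    Φ m (Z, z) = α m := by
  obtain ⟨y₀, hy⟩ := exists_glue Z z
  choose W hW using hy
  set f : ℂ → ℂ := fun τ => if h : y₀ < τ.im then F (W τ h) else 0 with hf
  have h1 : ∀ τ : ℂ, y₀ < τ.im → HasSum (fun m : ℕ => Φ m (Z, z) * expTwoPiI (m * τ)) (f τ) :=
    fun τ hτ => by
      obtain ⟨e1, e2, e3⟩ := hat_eq_of_mat_eq (hW τ hτ)
      have := hΦ (W τ hτ)
      rw [e1, e2, e3] at this
      rwa [show f τ = F (W τ hτ) from dif_pos hτ]
  have h2 : ∀ τ : ℂ, y₀ < τ.im → HasSum (fun m : ℕ => α m * expTwoPiI (m * τ)) (f τ) :=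
    fun τ hτ => by
      obtain ⟨e1, e2, e3⟩ := hat_eq_of_mat_eq (hW τ hτ)
      have := h (W τ hτ) e1 e2
      rw [e3] at this
      rwa [show f τ = F (W τ hτ) from dif_pos hτ]
  exact congrFun (coeff_eq_of_hasSum h1 h2) m

/-- A modular substitution of `ℍ₃` that maps the points above `(Z, z)` to those above `(Z', z')`
gives a transformation law of the Fourier-Jacobi coefficients. -/
theorem IsFourierJacobiExpansion.transfer {r : ℕ} {F : siegelSpace 3 → ℂ}
    {Φ : ℕ → siegelSpace 2 × (Fin 2 → ℂ) → ℂ} (hΦ : IsFourierJacobiExpansion F Φ)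
    (hF : ∀ (M : Gam 3) (W : siegelSpace 3), F (act M W) = (denom M W).det ^ r * F W)
    (M : Gam 3) {Z Z' : siegelSpace 2} {z z' : Fin 2 → ℂ} {q d : ℂ} (hd : d ≠ 0)
    (h : ∀ W : siegelSpace 3, hatBlock W = Z → hatVec W = z → (denom M W).det = d ∧
      mat (act M W) = glueMat (mat Z') z' z' (lastEntry W + q)) (m : ℕ) :
    Φ m (Z', z') * expTwoPiI (m * q) = d ^ r * Φ m (Z, z) := by
  have h1 := hΦ.coeff_eq (Z := Z) (z := z)
    (α := fun m => (d ^ r)⁻¹ * (Φ m (Z', z') * expTwoPiI (m * q))) (fun W hZ hz => ?_) m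
  · rw [h1, mul_inv_cancel_left₀ (pow_ne_zero r hd)]
  · obtain ⟨e1, e2⟩ := h W hZ hz
    obtain ⟨e3, e4, e5⟩ := hat_eq_of_mat_eq e2
    have h2 := (hΦ (act M W)).mul_left (d ^ r)⁻¹
    rw [hF M W, e1, inv_mul_cancel_left₀ (pow_ne_zero r hd), e3, e4, e5] at h2
    refine Eq.mp (congrArg (fun g => HasSum g (F W)) (funext fun m => ?_)) h2
    rw [mul_add, expTwoPiI_add]
    ring

theorem blockA_eq_add {n : ℕ} (M : Gam n) (Z : siegelSpace n) :
    blockA M = mat (act M Z) * blockC M + ((denom M Z)⁻¹)ᵀ := by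
  have h1 := denom_transpose_mul_blockA M Z
  rw [← mat_act_mul_denom, transpose_mul, mat_isSymm, Matrix.mul_assoc, ← Matrix.mul_sub] at h1
  rw [transpose_nonsing_inv, ← sub_eq_iff_eq_add']
  exact (inv_eq_right_inv h1).symm

/-- The embedding of `Sp(2, ℤ)` into `Sp(3, ℤ)` that fixes the last variable. -/
def extend (M : Gam 2) : Gam 3 :=
  ⟨fromBlocks (glueMat M.1.toBlocks₁₁ 0 0 1) (glueMat M.1.toBlocks₁₂ 0 0 0)
    (glueMat M.1.toBlocks₂₁ 0 0 0) (glueMat M.1.toBlocks₂₂ 0 0 1), by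
    obtain ⟨h1, h2, h3⟩ := entry_relations M
    rw [SymplecticGroup.fromBlocks_mem_iff]
    simp only [glueMat_transpose, glueMat_mul]
    refine ⟨by simp [h1], by simp [h2], ?_⟩
    rw [← glueMat_one, ← h3, sub_eq_add_neg]
    ext i j
    fin_cases i <;> fin_cases j <;> simp [glueMat, sub_eq_add_neg]⟩

theorem block_extend (M : Gam 2) : blockA (extend M) = glueMat (blockA M) 0 0 1 ∧
    blockB (extend M) = glueMat (blockB M) 0 0 0 ∧ blockC (extend M) = glueMat (blockC M) 0 0 0 ∧
    blockD (extend M) = glueMat (blockD M) 0 0 1 := by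
  refine ⟨?_, ?_, ?_, ?_⟩ <;>
    simp [blockA, blockB, blockC, blockD, extend, glueMat_map] <;> rfl

section Laws

variable {r : ℕ} {F : siegelSpace 3 → ℂ} {Φ : ℕ → siegelSpace 2 × (Fin 2 → ℂ) → ℂ}

theorem IsFourierJacobiExpansion.modular (hΦ : IsFourierJacobiExpansion F Φ)
    (hF : ∀ (M : Gam 3) (W : siegelSpace 3), F (act M W) = (denom M W).det ^ r * F W)
    (m : ℕ) (M : Gam 2) : JacobiLaw r m (Φ m) M := fun Z z => by
  obtain ⟨hA, hB, hC, hD⟩ := block_extend M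
  set q := z ⬝ᵥ ((denom M Z)⁻¹ * blockC M) *ᵥ z with hq
  have hu := isUnit_denom_det M Z
  have h := hΦ.transfer (r := r) hF (extend M) (Z := Z) (z := z) (Z' := act M Z)
    (z' := ((denom M Z)⁻¹)ᵀ *ᵥ z) (q := -q) (denom_det_ne_zero M Z) (fun W hZ hz => ?_) m
  · rw [mul_assoc, mul_comm (expTwoPiI _) (Φ m _), ← mul_assoc, ← h, mul_assoc, ← expTwoPiI_add]
    simp [expTwoPiI_zero]
  · have hden : denom (extend M) W = glueMat (denom M Z) (blockC M *ᵥ z) 0 1 := by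
      rw [denom, mat_eq_glueMat, hZ, hz, hC, hD, glueMat_mul, glueMat_add, denom]
      simp
    have hnum : numer (extend M) W = glueMat (numer M Z) (blockA M *ᵥ z) z (lastEntry W) := by
      rw [numer, mat_eq_glueMat, hZ, hz, hA, hB, glueMat_mul, glueMat_add, numer]
      simp
    refine ⟨by rw [hden, det_glueMat], ?_⟩
    have hinv : glueMat (mat (act M Z)) (((denom M Z)⁻¹)ᵀ *ᵥ z) (((denom M Z)⁻¹)ᵀ *ᵥ z)
        (lastEntry W + -q) * denom (extend M) W = numer (extend M) W := by
      rw [hden, hnum, glueMat_mul, mat_act_mul_denom, blockA_eq_add M Z, mulVec_transpose,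
        vecMul_vecMul, nonsing_inv_mul _ hu]
      congr 1
      · simp
      · rw [one_smul, add_mulVec, mulVec_mulVec, mulVec_transpose]
      · simp
      · rw [← dotProduct_mulVec, mulVec_mulVec, ← hq]
        ring
    rw [mat_act, ← hinv, Matrix.mul_assoc, mul_nonsing_inv _ (isUnit_denom_det _ W),
      Matrix.mul_one]

theorem IsFourierJacobiExpansion.add_int (hΦ : IsFourierJacobiExpansion F Φ)
    (hF : ∀ (M : Gam 3) (W : siegelSpace 3), F (act M W) = (denom M W).det ^ r * F W)
    (m : ℕ) (k : Fin 2 → ℤ) (Z : siegelSpace 2) (z : Fin 2 → ℂ) :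
    Φ m (Z, z + fun i => (k i : ℂ)) = Φ m (Z, z) := by
  have hS : (glueMat 0 k k 0 : Matrix (Fin 3) (Fin 3) ℤ)ᵀ = glueMat 0 k k 0 := by
    rw [glueMat_transpose, transpose_zero]
  have h := hΦ.transfer (r := r) hF (translation _ hS) (Z := Z) (z := z) (Z' := Z)
    (z' := z + fun i => (k i : ℂ)) (q := 0) one_ne_zero (fun W hZ hz => ?_) m
  · simpa [expTwoPiI_zero] using h
  · refine ⟨by rw [denom_translation, det_one], ?_⟩
    rw [mat_act_translation, mat_eq_glueMat W, hZ, hz, glueMat_map, glueMat_add]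
    congr 1
    · ext i j; simp
    · simp

theorem IsFourierJacobiExpansion.add_mulVec (hΦ : IsFourierJacobiExpansion F Φ)
    (hF : ∀ (M : Gam 3) (W : siegelSpace 3), F (act M W) = (denom M W).det ^ r * F W)
    (m : ℕ) (l : Fin 2 → ℤ) (Z : siegelSpace 2) (z : Fin 2 → ℂ) :
    Φ m (Z, z + mat Z *ᵥ fun i => (l i : ℂ)) * expTwoPiI (m * ((fun i => (l i : ℂ)) ⬝ᵥ
      mat Z *ᵥ (fun i => (l i : ℂ)) + 2 * ((fun i => (l i : ℂ)) ⬝ᵥ z))) = Φ m (Z, z) := by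
  have hU : (glueMat 1 0 l 1 : Matrix (Fin 3) (Fin 3) ℤ)ᵀ * glueMat 1 (-l) 0 1 = 1 := by
    rw [glueMat_transpose, glueMat_mul, ← glueMat_one]
    congr 1 <;> simp
  have h := hΦ.transfer (r := r) hF (levi _ _ hU) (Z := Z) (z := z) (Z' := Z)
    (z' := z + mat Z *ᵥ fun i => (l i : ℂ)) (q := (fun i => (l i : ℂ)) ⬝ᵥ
      mat Z *ᵥ (fun i => (l i : ℂ)) + 2 * ((fun i => (l i : ℂ)) ⬝ᵥ z)) one_ne_zero
    (fun W hZ hz => ?_) m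
  · rw [h, one_pow, one_mul]
  · have hl : ∀ v : Fin 2 → ℂ, v ᵥ* mat Z = mat Z *ᵥ v := fun v => by
      rw [← mulVec_transpose, mat_isSymm]
    have h1 : (1 : Matrix (Fin 2) (Fin 2) ℤ).map (Int.cast : ℤ → ℂ) = 1 :=
      Matrix.map_one _ (by simp) (by simp)
    refine ⟨?_, ?_⟩
    · rw [denom_levi, glueMat_map, h1]
      have h0 : (fun i => (((0 : Fin 2 → ℤ) i : ℤ) : ℂ)) = 0 := by ext i; simp
      rw [h0, Int.cast_one, det_glueMat, det_one]
    · rw [mat_act_levi, mat_eq_glueMat W, hZ, hz, glueMat_map, glueMat_transpose, glueMat_mul,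
        glueMat_mul, h1]
      have h0 : (fun i => (((0 : Fin 2 → ℤ) i : ℤ) : ℂ)) = 0 := by ext i; simp
      rw [h0, Int.cast_one]
      congr 1
      · simp
      · simp [add_comm]
      · simp [hl, add_comm]
      · simp only [dotProduct, vecMul, mulVec, Fin.sum_univ_two, Pi.add_apply, Pi.smul_apply,
          smul_eq_mul, mat_one_zero]
        simp
        ring

end Laws

/-! ### Fourier coefficients of cusp forms of degree three -/

theorem HalfIntegral.symm_apply {n : ℕ} (T : HalfIntegral n) (i j : Fin n) : T.1 i j = T.1 j i :=
  congrFun (congrFun T.2.1 j) i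

/-- The exponent `(N, R)` of the upper blocks of `T = (N, R / 2; Rᵗ / 2, m)`. -/
def hatExponent (T : HalfIntegral 3) : Exponent :=
  (!![T.1 0 0, T.1 0 1; T.1 1 0, T.1 1 1], ![2 * T.1 0 2, 2 * T.1 1 2])

theorem expTwoPiI_pairing (T : HalfIntegral 3) (W : siegelSpace 3) :
    expTwoPiI (pairing T W) =
      character (hatExponent T) (hatBlock W, hatVec W) * expTwoPiI (T.1 2 2 * lastEntry W) := by
  rw [character_eq, ← expTwoPiI_add, pairing, mat_eq_glueMat W]
  congr 1
  simp [trace, Matrix.mul_apply, Fin.sum_univ_succ, glueMat, hatExponent, T.symm_apply 2 0,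
    T.symm_apply 2 1, mat_one_zero]
  ring

/-- The indices of the Fourier coefficients that contribute to the first Fourier-Jacobi
coefficient. -/
def firstIndices : Set (HalfIntegral 3) := {T | T.1.PosDef ∧ T.1 2 2 = 1}

theorem hatExponent_mem {T : HalfIntegral 3} (hT : T ∈ firstIndices) :
    hatExponent T ∈ integralCuspExponents := by
  obtain ⟨hs, hd, hh⟩ := T.2
  refine ⟨?_, fun i => ?_, fun i j => ?_, fun i => ?_, fun x hx => ?_⟩
  · ext i j
    fin_cases i <;> fin_cases j <;> simp [hatExponent, T.symm_apply 1 0]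
  · fin_cases i
    exacts [hd 0, hd 1]
  · fin_cases i <;> fin_cases j
    exacts [hh 0 0, hh 0 1, hh 1 0, hh 1 1]
  · fin_cases i
    exacts [hh 0 2, hh 1 2]
  · -- complete the square: the minimum over the last variable is at `- Rᵗ x / 2`
    set c := -(T.1 0 2 * x 0 + T.1 1 2 * x 1) with hc
    have hne : (![x 0, x 1, c] : Fin 3 → ℝ) ≠ 0 := fun h => hx (by
      ext i
      fin_cases i
      exacts [congrFun h 0, congrFun h 1])
    have h := (posDef_iff_dotProduct_mulVec.1 hT.1).2 hne
    have e : star (![x 0, x 1, c] : Fin 3 → ℝ) ⬝ᵥ T.1 *ᵥ ![x 0, x 1, c] =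
        quad (hatExponent T) x - ((hatExponent T).2 ⬝ᵥ x) ^ 2 / 4 := by
      simp [quad, hatExponent, mulVec, dotProduct, Fin.sum_univ_succ, T.symm_apply 2 0,
        T.symm_apply 2 1, T.symm_apply 1 0, hT.2, hc]
      ring
    rw [e] at h
    linarith

theorem exists_nat_diag {T : HalfIntegral 3} (hT : T.1.PosDef) (i : Fin 3) :
    ∃ k : ℕ, T.1 i i = k + 1 := by
  obtain ⟨k, hk⟩ := T.2.2.1 i
  have h := hT.diag_pos (i := i)
  rw [hk, Int.cast_pos] at h
  obtain ⟨l, rfl⟩ := Int.eq_succ_of_zero_lt h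
  exact ⟨l, by rw [hk]; push_cast; rfl⟩

section Coefficients

variable {F : siegelSpace 3 → ℂ} {Φ : ℕ → siegelSpace 2 × (Fin 2 → ℂ) → ℂ} {a : HalfIntegral 3 → ℂ}

/-- The Fourier expansion of the first Fourier-Jacobi coefficient. -/
theorem IsFourierJacobiExpansion.hasSum_first (hΦ : IsFourierJacobiExpansion F Φ)
    (ha : ∀ T, ¬ T.1.PosDef → a T = 0)
    (hs : ∀ W, HasSum (fun T => a T * expTwoPiI (pairing T W)) (F W))
    (p : siegelSpace 2 × (Fin 2 → ℂ)) :
    HasSum (fun T : firstIndices => a T * character (hatExponent T) p) (Φ 1 p) := by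
  obtain ⟨Z, z⟩ := p
  set key : HalfIntegral 3 → ℕ := fun T => ⌊T.1 2 2⌋₊
  have hkey' : ∀ {T}, T.1.PosDef → ((key T : ℝ)) = T.1 2 2 := fun {T} hT => by
    obtain ⟨k, hk⟩ := exists_nat_diag hT 2
    have : (k : ℝ) + 1 = ((k + 1 : ℕ) : ℝ) := by push_cast; rfl
    change ((⌊T.1 2 2⌋₊ : ℕ) : ℝ) = _
    rw [hk, this, Nat.floor_natCast]
  have hterm : ∀ (T : HalfIntegral 3) (W : siegelSpace 3), hatBlock W = Z → hatVec W = z →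
      a T * expTwoPiI (pairing T W) =
        a T * character (hatExponent T) (Z, z) * expTwoPiI (key T * lastEntry W) := by
    intro T W hZ hz
    by_cases hT : T.1.PosDef
    · rw [expTwoPiI_pairing, hZ, hz, ← hkey' hT, mul_assoc, Complex.ofReal_natCast]
    · rw [ha T hT]; simp
  have hcoeff := hΦ.coeff_eq (Z := Z) (z := z)
    (α := fun m => ∑' T : {T // key T = m}, a T * character (hatExponent T) (Z, z))
    (fun W hZ hz => by
      refine Eq.mp (congrArg (fun g => HasSum g (F W)) (funext fun m => ?_))
        (hasSum_fiber (hs W) key)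
      rw [← tsum_mul_right]
      refine tsum_congr ?_
      rintro ⟨T, rfl⟩
      exact hterm T W hZ hz) 1
  have hset : (fun T : firstIndices => a T * character (hatExponent T) (Z, z)) =
      (fun T => a T * character (hatExponent T) (Z, z)) ∘ ((↑) : firstIndices → HalfIntegral 3) :=
    rfl
  have hind : firstIndices.indicator (fun T => a T * character (hatExponent T) (Z, z)) =
      {T | key T = 1}.indicator fun T => a T * character (hatExponent T) (Z, z) := by
    funext T
    by_cases hT : T.1.PosDef
    · have hiff : T ∈ firstIndices ↔ T ∈ {T | key T = 1} := by
        refine ⟨fun h => ?_, fun h => ⟨hT, ?_⟩⟩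
        · have := hkey' hT
          rw [h.2] at this
          exact_mod_cast this
        · rw [← hkey' hT, show key T = 1 from h, Nat.cast_one]
      by_cases hm : T ∈ firstIndices
      · rw [Set.indicator_of_mem hm, Set.indicator_of_mem (hiff.1 hm)]
      · rw [Set.indicator_of_notMem hm, Set.indicator_of_notMem fun h => hm (hiff.2 h)]
    · rw [Set.indicator_of_notMem fun h => hT h.1]
      simp only [Set.indicator_apply, ha T hT, zero_mul, ite_self]
  rw [hset, hasSum_subtype_iff_indicator, hind, ← hasSum_subtype_iff_indicator, hcoeff]
  refine Summable.hasSum ?_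
  obtain ⟨y₀, hy⟩ := exists_glue Z z
  obtain ⟨W, hW⟩ := hy (I * ((y₀ + 1 : ℝ) : ℂ)) (by simp)
  obtain ⟨e1, e2, -⟩ := hat_eq_of_mat_eq hW
  have h1 := ((hs W).summable.subtype {T | key T = 1}).mul_right (expTwoPiI (-lastEntry W))
  refine h1.congr ?_
  rintro ⟨T, hT⟩
  have hT' : key T = 1 := hT
  simp only [Function.comp_apply]
  rw [hterm T W e1 e2, mul_assoc, ← expTwoPiI_add, hT']
  simp [expTwoPiI_zero]

end Coefficients

/-- The first Fourier-Jacobi coefficients of cusp forms are Jacobi cusp forms. -/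
theorem fourierJacobi_le (r : ℕ) : fourierJacobiCuspForms 2 r 1 ≤ jacobiCuspForms 2 r 1 := by
  rintro _ ⟨F, hF, Φ, hΦ, rfl⟩
  obtain ⟨-, hmod, a, ha, hs⟩ := hF
  have hexp : HasExpansion integralCuspExponents (Φ 1) :=
    ⟨firstIndices, fun T => a T, fun T => hatExponent T, fun T => hatExponent_mem T.2,
      hΦ.hasSum_first ha hs⟩
  refine ⟨hexp.exists_holomorphic, fun M => hΦ.modular hmod 1 M, fun l k Z z => ?_, hexp.cuspidal⟩
  rw [hΦ.add_int hmod 1 k Z, ← hΦ.add_mulVec hmod 1 l Z z, mul_comm (Φ 1 _), ← mul_assoc,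
    ← expTwoPiI_add, neg_add_cancel, expTwoPiI_zero, one_mul]

/-- Cusp forms of degree three and odd weight vanish, as `-1` acts trivially. -/
theorem eq_zero_of_odd {r : ℕ} (hr : Odd r) {F : siegelSpace 3 → ℂ}
    (hF : ∀ (M : Gam 3) (W : siegelSpace 3), F (act M W) = (denom M W).det ^ r * F W) : F = 0 := by
  funext W
  have h := hF (levi (-1) (-1) (by simp)) W
  have h1 : (-1 : Matrix (Fin 3) (Fin 3) ℤ).map (Int.cast : ℤ → ℂ) = -1 := by
    ext i j
    simp [Matrix.one_apply, apply_ite]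
  have e : act (levi (-1) (-1) (by simp)) W = W := by
    apply Subtype.ext
    apply Subtype.ext
    change mat (act (levi (-1) (-1) _) W) = mat W
    rw [mat_act_levi, h1]
    simp
  rw [e, denom_levi, h1, det_neg, det_one] at h
  simp only [Fintype.card_fin, mul_one, ← pow_mul, Odd.neg_one_pow (Odd.mul (by decide : Odd 3) hr)]
    at h
  exact self_eq_neg.1 (by simpa using h)

/-- The exchange of the last two variables on half-integral matrices. -/
def swapLast (T : HalfIntegral 3) : HalfIntegral 3 :=
  ⟨T.1.submatrix (Equiv.swap 1 2) (Equiv.swap 1 2), T.2.1.submatrix _, fun _ => T.2.2.1 _,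
    fun _ _ => T.2.2.2 _ _⟩

theorem swapLast_apply (T : HalfIntegral 3) : (swapLast T).1 0 0 = T.1 0 0 ∧ (swapLast T).1 1 1 = T.1 2 2 ∧
    (swapLast T).1 2 2 = T.1 1 1 ∧ (swapLast T).1 0 1 = T.1 0 2 ∧ (swapLast T).1 0 2 = T.1 0 1 ∧
    (swapLast T).1 1 2 = T.1 1 2 :=
  ⟨rfl, rfl, rfl, rfl, rfl, T.symm_apply 2 1⟩

theorem swapLast_swapLast (T : HalfIntegral 3) : swapLast (swapLast T) = T := by
  apply Subtype.ext
  ext i j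
  simp [swapLast]

/-- `swapLast` as a permutation. -/
def swapLastEquiv : Equiv.Perm (HalfIntegral 3) := ⟨swapLast, swapLast, swapLast_swapLast, swapLast_swapLast⟩

theorem posDef_swapLast {T : HalfIntegral 3} : (swapLast T).1.PosDef ↔ T.1.PosDef := by
  have h : ∀ {T : HalfIntegral 3}, T.1.PosDef → (swapLast T).1.PosDef := fun hT =>
    hT.submatrix (Equiv.swap 1 2).injective
  exact ⟨fun hT => swapLast_swapLast T ▸ h hT, h⟩

/-- A cusp form of even weight has a Fourier expansion that is symmetric in the last two
variables. -/
theorem exists_symmetric_expansion {r : ℕ} (hr : Even r) {F : siegelSpace 3 → ℂ}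
    (hF : IsSiegelCuspForm 3 r F) : ∃ a : HalfIntegral 3 → ℂ, (∀ T, ¬ T.1.PosDef → a T = 0) ∧
      (∀ T, a (swapLast T) = a T) ∧
      ∀ W, HasSum (fun T => a T * expTwoPiI (pairing T W)) (F W) := by
  obtain ⟨-, hmod, a, ha, hs⟩ := hF
  refine ⟨fun T => (a T + a (swapLast T)) / 2, fun T hT => ?_, fun T => ?_, fun W => ?_⟩
  · dsimp only
    rw [ha T hT, ha (swapLast T) fun h => hT (posDef_swapLast.1 h)]
    simp
  · dsimp only
    rw [swapLast_swapLast, add_comm]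
  · set P : Matrix (Fin 3) (Fin 3) ℤ := !![1, 0, 0; 0, 0, 1; 0, 1, 0] with hP
    have hPP : Pᵀ * P = 1 := by decide
    have hF' : F (act (levi P P hPP) W) = F W := by
      have h := hmod (levi P P hPP) W
      have hdet : (P.map (Int.cast : ℤ → ℂ)).det = -1 := by
        rw [det_fin_three]
        simp [hP]
      rwa [denom_levi, hdet, hr.neg_one_pow, one_mul] at h
    have hpair : ∀ T, pairing (swapLast T) (act (levi P P hPP) W) = pairing T W := fun T => by
      rw [pairing, pairing, mat_act_levi]
      simp [trace, Matrix.mul_apply, Fin.sum_univ_succ, hP, swapLast, Equiv.swap_apply_def]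
      ring
    have h2 := (Equiv.hasSum_iff swapLastEquiv).2 (hs (act (levi P P hPP) W))
    rw [hF'] at h2
    have h3 : HasSum (fun T => a (swapLast T) * expTwoPiI (pairing T W)) (F W) := by
      refine Eq.mp (congrArg (fun g => HasSum g (F W)) (funext fun T => ?_)) h2
      change a (swapLast T) * expTwoPiI (pairing (swapLast T) (act (levi P P hPP) W)) = _
      rw [hpair]
    have h4 := ((hs W).add h3).div_const 2
    rw [add_self_div_two] at h4
    refine Eq.mp (congrArg (fun g => HasSum g (F W)) (funext fun T => ?_)) h4
    ring

/-- The sum of the Fourier coefficients of a cusp form of degree three over the matrices with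
diagonal entries `1`, as a Fourier series in the off-diagonal entries. -/
noncomputable def cornerSum (a : HalfIntegral 3 → ℂ) (s₁ s₂ s₃ : ℝ) : ℂ :=
  ∑' T : HalfIntegral 3, {T : HalfIntegral 3 | T.1 0 0 = 1 ∧ T.1 1 1 = 1 ∧ T.1 2 2 = 1}.indicator
    (fun T => a T * expTwoPiI (2 * T.1 0 1 * s₁ + 2 * T.1 0 2 * s₂ + 2 * T.1 1 2 * s₃)) T

theorem cornerSum_swap {a : HalfIntegral 3 → ℂ} (ha : ∀ T, a (swapLast T) = a T) (s₁ s₂ s₃ : ℝ) :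
    cornerSum a s₁ s₂ s₃ = cornerSum a s₂ s₁ s₃ := by
  rw [cornerSum, cornerSum, ← swapLastEquiv.tsum_eq]
  refine tsum_congr fun T => ?_
  obtain ⟨h1, h2, h3, h4, h5, h6⟩ := swapLast_apply T
  change Set.indicator _ _ (swapLast T) = _
  simp only [Set.indicator_apply, Set.mem_ofPred_eq, h1, h2, h3, h4, h5, h6, ha,
    and_comm (a := T.1 2 2 = 1)]
  split_ifs
  · congr 2
    ring
  · rfl

/-- The leading behaviour along the rays of the first Fourier-Jacobi coefficient. -/
theorem tendsto_first {F : siegelSpace 3 → ℂ} {Φ : ℕ → siegelSpace 2 × (Fin 2 → ℂ) → ℂ}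
    {a : HalfIntegral 3 → ℂ} (hΦ : IsFourierJacobiExpansion F Φ)
    (ha : ∀ T, ¬ T.1.PosDef → a T = 0)
    (hs : ∀ W, HasSum (fun T => a T * expTwoPiI (pairing T W)) (F W)) (s : ℝ) (w : Fin 2 → ℝ) :
    Tendsto (fun y : ℝ => Φ 1 (ray 0 s y, fun j => (w j : ℂ)) *
      ((Real.exp (4 * Real.pi * y) : ℝ) : ℂ)) atTop (𝓝 (cornerSum a s (w 0) (w 1))) := by
  set d : firstIndices → ℂ := fun T => a T *
    expTwoPiI (2 * T.1.1 0 1 * s + 2 * T.1.1 0 2 * w 0 + 2 * T.1.1 1 2 * w 1) with hd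
  set lam : firstIndices → ℝ := fun T => 2 * Real.pi * (T.1.1 0 0 + T.1.1 1 1 - 2) with hlam
  have hpi := Real.pi_pos
  have hsum : ∀ y : ℝ, 1 ≤ y → HasSum (fun T => d T * ((Real.exp (-(lam T * y)) : ℝ) : ℂ))
      (Φ 1 (ray 0 s y, fun j => (w j : ℂ)) * ((Real.exp (4 * Real.pi * y) : ℝ) : ℂ)) :=
    fun y hy => by
      have h := (hΦ.hasSum_first ha hs (ray 0 s y, fun j => (w j : ℂ))).mul_right
        ((Real.exp (4 * Real.pi * y) : ℝ) : ℂ)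
      refine Eq.mp (congrArg (fun g => HasSum g _) (funext fun T => ?_)) h
      rw [hd, hlam, character_eq, mat_ray 0 s hy]
      simp only [mul_assoc]
      congr 1
      rw [Complex.ofReal_exp, Complex.ofReal_exp, expTwoPiI, expTwoPiI, ← Complex.exp_add,
        ← Complex.exp_add]
      congr 1
      simp [hatExponent, T.1.symm_apply 1 0]
      linear_combination (2 * Real.pi * y * (T.1.1 0 0 + T.1.1 1 1) : ℂ) * Complex.I_mul_I
  have hone : ∀ (T : firstIndices) (i : Fin 3), 1 ≤ T.1.1 i i := fun T i => by
    obtain ⟨k, hk⟩ := exists_nat_diag T.2.1 i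
    rw [hk]
    have : (0 : ℝ) ≤ k := k.cast_nonneg
    linarith
  have ht := tendsto_tsum_exp_neg (d := d) (lam := lam) (fun T _ => ?_) (hsum 1 le_rfl).summable
  · have hl : ∑' T, (if lam T = 0 then d T else 0) = cornerSum a s (w 0) (w 1) := by
      rw [cornerSum, ← tsum_subtype_eq_of_support_subset (s := firstIndices)]
      · refine tsum_congr fun T => ?_
        have hiff : lam T = 0 ↔ T.1.1 0 0 = 1 ∧ T.1.1 1 1 = 1 ∧ T.1.1 2 2 = 1 := by
          rw [hlam]
          dsimp only
          rw [mul_eq_zero, or_iff_right (by positivity)]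
          have h0 := hone T 0
          have h1 := hone T 1
          refine ⟨fun h => ⟨by linarith, by linarith, T.2.2⟩, fun h => by linarith [h.1, h.2.1]⟩
        simp only [Set.indicator_apply, Set.mem_ofPred_eq, hiff]
        rfl
      · intro T hT
        rw [Function.mem_support] at hT
        have h1 := Set.mem_of_indicator_ne_zero hT
        rw [Set.indicator_of_mem h1] at hT
        exact ⟨by_contra fun h => hT (by rw [ha T h, zero_mul]), h1.2.2⟩
    rw [hl] at ht
    refine ht.congr' ?_
    filter_upwards [eventually_ge_atTop 1] with y hy
    exact (hsum y hy).tsum_eq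
  · have h0 := hone T 0
    have h1 := hone T 1
    have : 0 ≤ T.1.1 0 0 + T.1.1 1 1 - 2 := by linarith
    positivity

end SiegelJacobi

theorem theorem2 :
    ∃ r₀ : ℕ, ∀ r : ℕ, r₀ ≤ r →
      SiegelJacobi.fourierJacobiCuspForms 2 r 1 < SiegelJacobi.jacobiCuspForms 2 r 1 := by
  refine ⟨200, fun r hr => SetLike.lt_iff_le_and_exists.2 ⟨SiegelJacobi.fourierJacobi_le r, ?_⟩⟩
  rcases Nat.even_or_odd r with he | ho
  · obtain ⟨f, hf, c, hc, ht⟩ := SiegelJacobi.exists_asymmetric he (by lia)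
    refine ⟨f, hf, ?_⟩
    rintro ⟨F, hF, Φ, hΦ, rfl⟩
    obtain ⟨a, ha, hsymm, hs⟩ := SiegelJacobi.exists_symmetric_expansion he hF
    have hlim : ∀ (s : ℝ) (w : Fin 2 → ℝ), c s = SiegelJacobi.cornerSum a s (w 0) (w 1) :=
      fun s w => tendsto_nhds_unique (ht s w) (SiegelJacobi.tendsto_first hΦ ha hs s w)
    apply hc
    rw [hlim 0 ![1 / 2, 0], hlim (1 / 2) ![0, 0]]
    exact SiegelJacobi.cornerSum_swap hsymm _ _ _
  · -- `r - 189 = 10 j + 4 i`, where `j` is the parity of `(r - 189) / 2`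
    obtain ⟨i, j, rfl⟩ : ∃ i j, r = 189 + 10 * j + 4 * i := by
      obtain ⟨m, rfl⟩ := ho
      exact ⟨(m - 94 - 5 * ((m - 94) % 2)) / 2, (m - 94) % 2, by lia⟩
    obtain ⟨f, hf, hne⟩ := SiegelJacobi.exists_jacobiCuspForm_ne_zero i j
    refine ⟨f, hf, ?_⟩
    rintro ⟨F, hF, Φ, hΦ, rfl⟩
    apply hne
    funext p
    refine hΦ.coeff_eq (α := 0) (fun W _ _ => ?_) 1
    rw [SiegelJacobi.eq_zero_of_odd ho hF.modular]
    simp
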